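/- Definitions. A graph $G$ is a compact Hausdorff space that is a union of finitely many homeomorphic copies of $[0,1]$, any two of which meet at most at their endpoints; $\mathrm{Ver}(G)$ is the set of points without an open neighbourhood homeomorphic to $]0,1[$. A continuous map $f:G\to G$ is a PMG (piecewise monotone graph) map if there is a finite $C\subseteq G$ such that $f$ is injective on each connected component of $G\setminus C$. $\mathrm{Fix}^-(f^n)$ is the (finite) set of fixed points $x\notin\mathrm{Ver}(G)$ of $f^n$ such that $f^n$ reverses orientation on a neighbourhood of $x$. With $f_{*i}$ the map induced by $f$ on the singular homology $H_i(G;\mathbb R)$, put $$\zeta^-(z)=\exp\sum_{n\ge1}\frac{2\,\#\mathrm{Fix}^-(f^n)}{n}z^n,\qquad \zeta^L(z)=\exp\sum_{n\ge1}\frac{\mathrm{tr}(f_{*0})^n-\mathrm{tr}(f_{*1})^n}{n}z^n,\qquad \zeta^{MT}(z)=\zeta^-(z)\,\zeta^L(z)^{-1}.$$ Let $\Omega=[a_1,b_1]\cup\dots\cup[a_m,b_m]\subset\mathbb R$ with $a_1<b_1<a_2<\dots<a_m<b_m$, and $\partial\Omega=\{a_1,b_1,\dots,a_m,b_m\}$.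 A PM (piecewise monotone) map is a map $F:\Omega\setminus C_F\to\Omega$ with $C_F\subset\Omega$ finite, $\partial\Omega\subseteq C_F$, that is continuous and strictly monotone on each connected component of $\Omega\setminus C_F$. The PMG map $f$ is induced by $F$ if there is a continuous $\pi:\Omega\to G$ with $\mathrm{Ver}(G)\subseteq\pi(\partial\Omega)$ that maps $\Omega\setminus\partial\Omega$ homeomorphically onto $G\setminus\pi(\partial\Omega)$ and satisfies $\pi\circ F=f\circ\pi$ on $\Omega\setminus C_F$. Let $S_0$ be the real vector space with basis $\Omega$ and $S_1\subseteq S_0$ the subspace spanned by the vectors $y-x$ with $x,y$ in the same component of $\Omega$. Let $\epsilon F_{\#0}$ be the endomorphism of $S_0$ with $x\mapsto\epsilon(x)F(x)$ for $x\in\Omega\setminus C_F$ and $x\mapsto0$ for $x\in C_F$, and $\epsilon F_{\#1}$ the unique endomorphism of $S_1$ with $y-x\mapsto\epsilon([x,y])\,(F(y-)-F(x+))$ whenever $x<y$ and $]x,y[\,\subseteq\Omega\setminus C_F$; here $\epsilon=+1$ or $-1$ according to whether $F$ is increasing or decreasing near $x$, respectively on $]x,y[$. For endomorphisms $\varphi_0,\varphi_1$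 of finite-codimensional subspaces $V_0,V_1$ of a real vector space $V$ that have extensions $\overline\varphi_0,\overline\varphi_1:V\to V$ with $\overline\varphi_1-\overline\varphi_0$ of finite rank, put $\mathrm{tr}(\varphi_0,\varphi_1)=\mathrm{tr}(\overline\varphi_1-\overline\varphi_0)-\mathrm{tr}\,\widetilde\varphi_1+\mathrm{tr}\,\widetilde\varphi_0$, where $\widetilde\varphi_j$ is the endomorphism of $V/V_j$ induced by $\overline\varphi_j$ (this does not depend on the extensions). The kneading determinant of $F$ is $$D(z)=\exp\Bigl(-\sum_{n\ge1}\mathrm{tr}\bigl((\epsilon F_{\#0})^n,(\epsilon F_{\#1})^n\bigr)\frac{z^n}{n}\Bigr).$$ Theorem. Let $f:G\to G$ be a PMG map induced by a PM map $F:\Omega\setminus C_F\to\Omega$. Then $D(z)$ has integer coefficients and constant term $1$ (so $D(z)^{-1}\in\mathbb Z[[z]]$), and there is a formal power series $H(z)\in\mathbb Q[[z]]$ that converges and has a nonzero value for every complex $z$ with $|z|<1$, such that, as formal power series, $$\zeta^{MT}(z)=H(z)\,D(z)^{-1}.$$ -/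

import Mathlib

open Set Filter Topology

noncomputable section

namespace KneadingGraph

universe u

/-! ### Zeta-type power series -/

/-- The formal power series `exp (∑_{n ≥ 1} (t n / n) z ^ n)`.  In Lean `t 0 / 0 = 0`, so the
series that is substituted into `exp` has constant coefficient zero, as it must. -/
def expSeries (t : ℕ → ℝ) : PowerSeries ℝ :=
  (PowerSeries.exp ℝ).subst (PowerSeries.mk fun n => t n / (n : ℝ))

/-! ### Pairs of linear endomorphisms -/

section Pairs

variable {V : Type*} [AddCommGroup V] [Module ℝ V]

/-- The trace of an endomorphism of finite rank of a (possibly infinite-dimensional) space: the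
trace of its restriction to its image. -/
def finiteRankTrace (φ : Module.End ℝ V) : ℝ :=
  LinearMap.trace ℝ (LinearMap.range φ)
    (φ.restrict (p := LinearMap.range φ) (q := LinearMap.range φ)
      fun x _ => LinearMap.mem_range_self φ x)

/-- Extensions `ext₀`, `ext₁` to all of `V` of a pair `(φ₀, φ₁)` of endomorphisms of subspaces
`V₀`, `V₁` of `V`, such that `ext₁ - ext₀` has finite rank. -/
structure PairExtension {V₀ V₁ : Submodule ℝ V}
    (φ₀ : Module.End ℝ V₀) (φ₁ : Module.End ℝ V₁) where
  ext₀ : Module.End ℝ V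
  ext₁ : Module.End ℝ V
  ext₀_apply : ∀ x : V₀, ext₀ (x : V) = (φ₀ x : V)
  ext₁_apply : ∀ x : V₁, ext₁ (x : V) = (φ₁ x : V)
  finite_rank : FiniteDimensional ℝ (LinearMap.range (ext₁ - ext₀))

namespace PairExtension

variable {V₀ V₁ : Submodule ℝ V} {φ₀ : Module.End ℝ V₀} {φ₁ : Module.End ℝ V₁}

/-- The endomorphism of `V / V₀` induced by `ext₀`. -/
def quot₀ (e : PairExtension φ₀ φ₁) : Module.End ℝ (V ⧸ V₀) :=
  V₀.mapQ V₀ e.ext₀ fun x hx => by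
    rw [Submodule.mem_comap, e.ext₀_apply ⟨x, hx⟩]
    exact (φ₀ ⟨x, hx⟩).2

/-- The endomorphism of `V / V₁` induced by `ext₁`. -/
def quot₁ (e : PairExtension φ₀ φ₁) : Module.End ℝ (V ⧸ V₁) :=
  V₁.mapQ V₁ e.ext₁ fun x hx => by
    rw [Submodule.mem_comap, e.ext₁_apply ⟨x, hx⟩]
    exact (φ₁ ⟨x, hx⟩).2

/-- `tr (ext₁ - ext₀) - tr quot₁ + tr quot₀`; the number does not depend on the extensions when
`V₀` and `V₁` have finite codimension. -/
def pairTrace (e : PairExtension φ₀ φ₁) : ℝ :=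
  finiteRankTrace (e.ext₁ - e.ext₀) - LinearMap.trace ℝ (V ⧸ V₁) e.quot₁
    + LinearMap.trace ℝ (V ⧸ V₀) e.quot₀

end PairExtension

open Classical in
/-- The trace of a pair of endomorphisms of finite rank (`0` if the pair has not finite rank). -/
def pairTrace {V₀ V₁ : Submodule ℝ V} (φ₀ : Module.End ℝ V₀) (φ₁ : Module.End ℝ V₁) : ℝ :=
  if h : Nonempty (PairExtension φ₀ φ₁) then h.some.pairTrace else 0

/-- The determinant `exp (-∑_{n ≥ 1} tr (φ₀ ^ n, φ₁ ^ n) z ^ n / n)` of a pair of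
endomorphisms of finite rank. -/
def pairDet {V₀ V₁ : Submodule ℝ V} (φ₀ : Module.End ℝ V₀) (φ₁ : Module.End ℝ V₁) :
    PowerSeries ℝ :=
  expSeries fun n => -pairTrace (φ₀ ^ n) (φ₁ ^ n)

end Pairs

/-- The subspace `S₁(X; ℝ)` of `S₀(X; ℝ) = X →₀ ℝ` generated by the vectors `y - x` with `x` and
`y` in the same connected component of `X`. -/
def chainsOne (X : Type*) [TopologicalSpace X] : Submodule ℝ (X →₀ ℝ) :=
  Submodule.span ℝ {v | ∃ x y : X, y ∈ connectedComponent x ∧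
    v = Finsupp.single y 1 - Finsupp.single x 1}

/-! ### Piecewise monotone maps on the line -/

/-- The union `Ω` of the intervals `[a i, b i]`, as a type. -/
abbrev Omega {m : ℕ} (a b : Fin m → ℝ) : Type := {t : ℝ // ∃ i, t ∈ Icc (a i) (b i)}

/-- A piecewise monotone map `F : Ω \ C → Ω` on
`Ω = [a₁, b₁] ∪ ⋯ ∪ [aₘ, bₘ]`, `a₁ < b₁ < a₂ < b₂ < ⋯ < aₘ < bₘ`. -/
structure PMMap where
  m : ℕ
  a : Fin m → ℝ
  b : Fin m → ℝ
  a_lt_b : ∀ i, a i < b i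
  b_lt_a : ∀ i j, i < j → b i < a j
  C : Finset (Omega a b)
  boundary_subset : ∀ x : Omega a b, (∃ i, (x : ℝ) = a i ∨ (x : ℝ) = b i) → x ∈ C
  toFun : {x : Omega a b // x ∉ C} → Omega a b
  continuousOn : ∀ x, ContinuousOn toFun (connectedComponent x)
  strictMonotone : ∀ x, StrictMonoOn toFun (connectedComponent x) ∨
    StrictAntiOn toFun (connectedComponent x)

namespace PMMap

variable (F : PMMap)

/-- The space `Ω`. -/
abbrev Sp : Type := Omega F.a F.b

/-- The domain `Ω \ C` of `F`. -/
abbrev Dom : Type := {x : F.Sp // x ∉ F.C}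

/-- The boundary `∂Ω = {a₁, b₁, …, aₘ, bₘ}`. -/
def boundary : Set F.Sp := {x | ∃ i, (x : ℝ) = F.a i ∨ (x : ℝ) = F.b i}

/-- The point of the real line underlying a point of `Ω \ C`. -/
def val (w : F.Dom) : ℝ := ((w : F.Sp) : ℝ)

/-- `F` is monotone on `[x, y]`: `x < y` and `]x, y[ ⊆ Ω \ C`. -/
def MonoInterval (x y : F.Sp) : Prop :=
  x < y ∧ ∀ t ∈ Ioo (x : ℝ) y, ∃ w : F.Dom, F.val w = t

/-- The points of `Ω \ C` in `]x, y[`. -/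
def between (x y : F.Sp) : Set F.Dom := {w | (x : ℝ) < F.val w ∧ F.val w < y}

open Classical in
/-- The sign `ε([x, y])`: `1` or `-1` according to whether `F` is increasing or decreasing
on `]x, y[`. -/
def signOn (x y : F.Sp) : ℝ := if StrictMonoOn F.toFun (F.between x y) then 1 else -1

open Classical in
/-- The sign `ε(x)`: `1` or `-1` according to whether `F` is increasing or decreasing
on a neighbourhood of `x ∈ Ω \ C`. -/
def signAt (x : F.Dom) : ℝ := if ∃ U ∈ 𝓝 x, StrictMonoOn F.toFun U then 1 else -1

/-- `v = F(y-)`. -/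
def IsLeftLimit (y v : F.Sp) : Prop := Tendsto F.toFun (comap F.val (𝓝[<] (y : ℝ))) (𝓝 v)

/-- `u = F(x+)`. -/
def IsRightLimit (x u : F.Sp) : Prop := Tendsto F.toFun (comap F.val (𝓝[>] (x : ℝ))) (𝓝 u)

open Classical in
/-- The endomorphism `εF_{#0}` of `S₀(Ω; ℝ)`: `x ↦ ε(x) F(x)` for `x ∈ Ω \ C`, and `x ↦ 0` for
`x ∈ C`. -/
def signedZero : Module.End ℝ (F.Sp →₀ ℝ) :=
  Finsupp.linearCombination ℝ fun x : F.Sp =>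
    if h : x ∉ F.C then F.signAt ⟨x, h⟩ • Finsupp.single (F.toFun ⟨x, h⟩) (1 : ℝ) else 0

/-- The property that characterises the endomorphism `εF_{#1}` of `S₁(Ω; ℝ)`:
`y - x ↦ ε([x, y]) (F(y-) - F(x+))` whenever `F` is monotone on `[x, y]`. -/
def IsSignedOne (φ : Module.End ℝ (chainsOne F.Sp)) : Prop :=
  ∀ x y : F.Sp, F.MonoInterval x y →
    ∀ u v : F.Sp, F.IsRightLimit x u → F.IsLeftLimit y v →
      ∀ h : Finsupp.single y 1 - Finsupp.single x 1 ∈ chainsOne F.Sp,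
        (φ ⟨Finsupp.single y 1 - Finsupp.single x 1, h⟩ : F.Sp →₀ ℝ) =
          F.signOn x y • (Finsupp.single v 1 - Finsupp.single u 1)


theorem isEmbedding_val : IsEmbedding F.val :=
  IsEmbedding.subtypeVal.comp IsEmbedding.subtypeVal

theorem isPreconnected_between {x y : F.Sp} (h : F.MonoInterval x y) :
    IsPreconnected (F.between x y) := by
  rw [← F.isEmbedding_val.isInducing.isPreconnected_image]
  have : F.val '' F.between x y = Ioo (x : ℝ) y := by
    ext t
    constructor
    · rintro ⟨w, hw, rfl⟩
      exact hw
    · intro ht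
      obtain ⟨w, rfl⟩ := h.2 t ht
      exact ⟨w, ht, rfl⟩
  rw [this]
  exact isPreconnected_Ioo

theorem between_nonempty {x y : F.Sp} (h : F.MonoInterval x y) : (F.between x y).Nonempty := by
  obtain ⟨t, ht⟩ := exists_between (show (x : ℝ) < y from h.1)
  obtain ⟨w, rfl⟩ := h.2 t ht
  exact ⟨w, ht⟩

theorem exists_between_subset {x y : F.Sp} (h : F.MonoInterval x y) :
    ∃ w, F.between x y ⊆ connectedComponent w := by
  obtain ⟨w, hw⟩ := F.between_nonempty h
  exact ⟨w, (F.isPreconnected_between h).subset_connectedComponent hw⟩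

theorem mono_or_anti {x y : F.Sp} (h : F.MonoInterval x y) :
    StrictMonoOn F.toFun (F.between x y) ∨ StrictAntiOn F.toFun (F.between x y) := by
  obtain ⟨w, hw⟩ := F.exists_between_subset h
  exact (F.strictMonotone w).imp (fun H => H.mono hw) (fun H => H.mono hw)

theorem continuousOn_between {x y : F.Sp} (h : F.MonoInterval x y) :
    ContinuousOn F.toFun (F.between x y) := by
  obtain ⟨w, hw⟩ := F.exists_between_subset h
  exact (F.continuousOn w).mono hw

theorem signOn_eq_of_subset {x y x' y' : F.Sp} (h : F.MonoInterval x y)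
    (h' : F.MonoInterval x' y') (hs : F.between x y ⊆ F.between x' y') :
    F.signOn x y = F.signOn x' y' := by
  unfold signOn
  rcases F.mono_or_anti h' with H | H
  · rw [if_pos H, if_pos (H.mono hs)]
  · have key : ∀ {p q : F.Sp}, F.MonoInterval p q → StrictAntiOn F.toFun (F.between p q) →
        ¬ StrictMonoOn F.toFun (F.between p q) := by
      intro p q hpq H1 H2
      obtain ⟨t, ht⟩ := exists_between (show (p : ℝ) < q from hpq.1)
      obtain ⟨t', ht'⟩ := exists_between ht.2
      obtain ⟨w, rfl⟩ := hpq.2 t ht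
      obtain ⟨w', rfl⟩ := hpq.2 t' ⟨ht.1.trans ht'.1, ht'.2⟩
      have m1 : w ∈ F.between p q := ht
      have m2 : w' ∈ F.between p q := ⟨ht.1.trans ht'.1, ht'.2⟩
      have hlt : w < w' := ht'.1
      exact lt_asymm (H1 m1 m2 hlt) (H2 m1 m2 hlt)
    rw [if_neg (key h' H), if_neg (key h (H.mono hs))]

theorem mem_left {x y : F.Sp} (h : F.MonoInterval x y) :
    F.between x y ∈ comap F.val (𝓝[<] (y : ℝ)) :=
  ⟨Ioo (x : ℝ) y, Ioo_mem_nhdsLT (show (x : ℝ) < y from h.1), fun _ hw => hw⟩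

theorem mem_right {x y : F.Sp} (h : F.MonoInterval x y) :
    F.between x y ∈ comap F.val (𝓝[>] (x : ℝ)) :=
  ⟨Ioo (x : ℝ) y, Ioo_mem_nhdsGT (show (x : ℝ) < y from h.1), fun _ hw => hw⟩

theorem neBot_left {x y : F.Sp} (h : F.MonoInterval x y) :
    (comap F.val (𝓝[<] (y : ℝ))).NeBot := by
  rw [comap_neBot_iff]
  intro s hs
  have h2 := inter_mem hs (Ioo_mem_nhdsLT (show (x : ℝ) < y from h.1))
  obtain ⟨t, ht1, ht2⟩ := (inferInstance : (𝓝[<] (y : ℝ)).NeBot).nonempty_of_mem h2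
  obtain ⟨w, rfl⟩ := h.2 t ht2
  exact ⟨w, ht1⟩

theorem neBot_right {x y : F.Sp} (h : F.MonoInterval x y) :
    (comap F.val (𝓝[>] (x : ℝ))).NeBot := by
  rw [comap_neBot_iff]
  intro s hs
  have h2 := inter_mem hs (Ioo_mem_nhdsGT (show (x : ℝ) < y from h.1))
  obtain ⟨t, ht1, ht2⟩ := (inferInstance : (𝓝[>] (x : ℝ)).NeBot).nonempty_of_mem h2
  obtain ⟨w, rfl⟩ := h.2 t ht2
  exact ⟨w, ht1⟩

theorem isCompact_omega : IsCompact {t : ℝ | ∃ i, t ∈ Icc (F.a i) (F.b i)} := by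
  have : {t : ℝ | ∃ i, t ∈ Icc (F.a i) (F.b i)} = ⋃ i, Icc (F.a i) (F.b i) := by
    ext; simp
  rw [this]
  exact isCompact_iUnion fun i => isCompact_Icc

theorem exists_real_limits {x y : F.Sp} (h : F.MonoInterval x y) :
    (∃ l, Tendsto (fun w => (F.toFun w : ℝ)) (comap F.val (𝓝[<] (y : ℝ))) (𝓝 l)) ∧
    (∃ l, Tendsto (fun w => (F.toFun w : ℝ)) (comap F.val (𝓝[>] (x : ℝ))) (𝓝 l)) := by
  classical
  set f : ℝ → ℝ := fun t => if ht : ∃ w, F.val w = t then (F.toFun ht.choose : ℝ) else 0 with hf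
  have hfw : ∀ w, f (F.val w) = (F.toFun w : ℝ) := by
    intro w
    have hw : ∃ w', F.val w' = F.val w := ⟨w, rfl⟩
    simp only [hf, dif_pos hw]
    rw [F.isEmbedding_val.injective hw.choose_spec]
  have hfe : (fun w => (F.toFun w : ℝ)) = f ∘ F.val := funext fun w => (hfw w).symm
  have hlt : (x : ℝ) < y := h.1
  have hne : (Ioo (x : ℝ) y).Nonempty := nonempty_Ioo.2 hlt
  have hsub : f '' Ioo (x : ℝ) y ⊆ {t : ℝ | ∃ i, t ∈ Icc (F.a i) (F.b i)} := by
    rintro _ ⟨t, ht, rfl⟩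
    obtain ⟨w, rfl⟩ := h.2 t ht
    rw [hfw]
    exact (F.toFun w).2
  have hbb := F.isCompact_omega.bddBelow.mono hsub
  have hba := F.isCompact_omega.bddAbove.mono hsub
  rw [hfe]
  rcases F.mono_or_anti h with H | H
  · have Hm : MonotoneOn f (Ioo (x : ℝ) y) := by
      intro s hs t ht hst
      obtain ⟨w, rfl⟩ := h.2 s hs
      obtain ⟨w', rfl⟩ := h.2 t ht
      rw [hfw, hfw]
      exact H.monotoneOn hs ht hst
    exact ⟨⟨_, (Hm.tendsto_nhdsWithin_Ioo_left hne hba).comp tendsto_comap⟩,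
      ⟨_, (Hm.tendsto_nhdsWithin_Ioo_right hne hbb).comp tendsto_comap⟩⟩
  · have Hm : AntitoneOn f (Ioo (x : ℝ) y) := by
      intro s hs t ht hst
      obtain ⟨w, rfl⟩ := h.2 s hs
      obtain ⟨w', rfl⟩ := h.2 t ht
      rw [hfw, hfw]
      exact H.antitoneOn hs ht hst
    have Hn : MonotoneOn (fun t => - f t) (Ioo (x : ℝ) y) := Hm.neg
    have him : (fun t => - f t) '' Ioo (x : ℝ) y = - (f '' Ioo (x : ℝ) y) := by
      rw [← image_neg_eq_neg, image_image]
    have h1 := (Hn.tendsto_nhdsWithin_Ioo_left hne (by rw [him]; exact hbb.neg)).neg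
    have h2 := (Hn.tendsto_nhdsWithin_Ioo_right hne (by rw [him]; exact hba.neg)).neg
    simp only [neg_neg] at h1 h2
    exact ⟨⟨_, h1.comp tendsto_comap⟩, ⟨_, h2.comp tendsto_comap⟩⟩

theorem exists_lift {l : Filter F.Dom} [l.NeBot] {r : ℝ}
    (h : Tendsto (fun w => (F.toFun w : ℝ)) l (𝓝 r)) : ∃ v : F.Sp, Tendsto F.toFun l (𝓝 v) := by
  have hr : r ∈ {t : ℝ | ∃ i, t ∈ Icc (F.a i) (F.b i)} :=
    F.isCompact_omega.isClosed.mem_of_tendsto h (Eventually.of_forall fun w => (F.toFun w).2)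
  exact ⟨⟨r, hr⟩, tendsto_subtype_rng.2 h⟩

theorem exists_leftLimit {x y : F.Sp} (h : F.MonoInterval x y) : ∃ v, F.IsLeftLimit y v := by
  have := F.neBot_left h
  obtain ⟨l, hl⟩ := (F.exists_real_limits h).1
  exact F.exists_lift hl

theorem exists_rightLimit {x y : F.Sp} (h : F.MonoInterval x y) : ∃ u, F.IsRightLimit x u := by
  have := F.neBot_right h
  obtain ⟨l, hl⟩ := (F.exists_real_limits h).2
  exact F.exists_lift hl

theorem limits_mem_component {x y u v : F.Sp} (h : F.MonoInterval x y)
    (hu : F.IsRightLimit x u) (hv : F.IsLeftLimit y v) : v ∈ connectedComponent u := by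
  have := F.neBot_right h
  have := F.neBot_left h
  have hc : IsPreconnected (closure (F.toFun '' F.between x y)) :=
    ((F.isPreconnected_between h).image _ (F.continuousOn_between h)).closure
  have hu' : u ∈ closure (F.toFun '' F.between x y) :=
    mem_closure_of_tendsto hu (mem_of_superset (F.mem_right h) fun w hw => ⟨w, hw, rfl⟩)
  have hv' : v ∈ closure (F.toFun '' F.between x y) :=
    mem_closure_of_tendsto hv (mem_of_superset (F.mem_left h) fun w hw => ⟨w, hw, rfl⟩)
  exact hc.subset_connectedComponent hu' hv'

theorem between_subset {x y x' y' : F.Sp} (hx : x' ≤ x) (hy : y ≤ y') :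
    F.between x y ⊆ F.between x' y' := fun _ hw =>
  ⟨lt_of_le_of_lt (show (x' : ℝ) ≤ x from hx) hw.1, lt_of_lt_of_le hw.2 (show (y : ℝ) ≤ y' from hy)⟩

theorem MonoInterval.mono {F : PMMap} {x y x' y' : F.Sp} (h : F.MonoInterval x' y') (hxy : x < y)
    (hx : x' ≤ x) (hy : y ≤ y') : F.MonoInterval x y :=
  ⟨hxy, fun t ht => h.2 t ⟨lt_of_le_of_lt (show (x' : ℝ) ≤ x from hx) ht.1,
    lt_of_lt_of_le ht.2 (show (y : ℝ) ≤ y' from hy)⟩⟩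

theorem MonoInterval.union {F : PMMap} {x y z : F.Sp} (h : F.MonoInterval x y)
    (h' : F.MonoInterval y z) (hy : y ∉ F.C) : F.MonoInterval x z :=
  ⟨h.1.trans h'.1, fun t ht => by
    rcases lt_trichotomy t (y : ℝ) with hty | hty | hty
    · exact h.2 t ⟨ht.1, hty⟩
    · exact ⟨⟨y, hy⟩, hty.symm⟩
    · exact h'.2 t ⟨hty, ht.2⟩⟩

theorem tendsto_of_not_mem {x y z : F.Sp} (h : F.MonoInterval x y)
    (h' : F.MonoInterval y z) (hy : y ∉ F.C) : Tendsto F.toFun (comap F.val (𝓝 (y : ℝ)))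
      (𝓝 (F.toFun ⟨y, hy⟩)) := by
  have hb := F.continuousOn_between (h.union h' hy)
  have hm : (⟨y, hy⟩ : F.Dom) ∈ F.between x z := ⟨h.1, h'.1⟩
  have hn : F.between x z ∈ comap F.val (𝓝 (y : ℝ)) :=
    ⟨Ioo (x : ℝ) z, Ioo_mem_nhds h.1 h'.1, fun _ hw => hw⟩
  have he : 𝓝 (⟨y, hy⟩ : F.Dom) = comap F.val (𝓝 (y : ℝ)) :=
    F.isEmbedding_val.isInducing.nhds_eq_comap _
  rw [← he] at hn ⊢
  exact hb.continuousAt hn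

open Classical in
/-- The vector `ε(y-) F(y-)`. -/
def leftVec (y : F.Sp) : F.Sp →₀ ℝ :=
  if h : ∃ p : F.Sp × F.Sp, F.MonoInterval p.1 y ∧ F.IsLeftLimit y p.2 then
    F.signOn h.choose.1 y • Finsupp.single h.choose.2 1 else 0

open Classical in
/-- The vector `ε(x+) F(x+)`. -/
def rightVec (x : F.Sp) : F.Sp →₀ ℝ :=
  if h : ∃ p : F.Sp × F.Sp, F.MonoInterval x p.1 ∧ F.IsRightLimit x p.2 then
    F.signOn x h.choose.1 • Finsupp.single h.choose.2 1 else 0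

theorem leftVec_eq {x y v : F.Sp} (h : F.MonoInterval x y) (hv : F.IsLeftLimit y v) :
    F.leftVec y = F.signOn x y • Finsupp.single v 1 := by
  have H : ∃ p : F.Sp × F.Sp, F.MonoInterval p.1 y ∧ F.IsLeftLimit y p.2 := ⟨(x, v), h, hv⟩
  have := F.neBot_left h
  rw [leftVec, dif_pos H, tendsto_nhds_unique H.choose_spec.2 hv]
  congr 1
  rcases le_total H.choose.1 x with hle | hle
  · exact (F.signOn_eq_of_subset h H.choose_spec.1 (F.between_subset hle le_rfl)).symm
  · exact F.signOn_eq_of_subset H.choose_spec.1 h (F.between_subset hle le_rfl)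

theorem rightVec_eq {x y u : F.Sp} (h : F.MonoInterval x y) (hu : F.IsRightLimit x u) :
    F.rightVec x = F.signOn x y • Finsupp.single u 1 := by
  have H : ∃ p : F.Sp × F.Sp, F.MonoInterval x p.1 ∧ F.IsRightLimit x p.2 := ⟨(y, u), h, hu⟩
  have := F.neBot_right h
  rw [rightVec, dif_pos H, tendsto_nhds_unique H.choose_spec.2 hu]
  congr 1
  rcases le_total y H.choose.1 with hle | hle
  · exact (F.signOn_eq_of_subset h H.choose_spec.1 (F.between_subset le_rfl hle)).symm
  · exact F.signOn_eq_of_subset H.choose_spec.1 h (F.between_subset le_rfl hle)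

/-- A point of `Ω` outside `C` has intervals of monotonicity on both sides. -/
theorem exists_left_interval {x : F.Sp} (hx : x ∉ F.C) :
    ∃ z, F.MonoInterval z x := by
  obtain ⟨i, hi⟩ := x.2
  have hne : F.a i ≠ x := fun h => hx (F.boundary_subset x ⟨i, Or.inl h.symm⟩)
  have hlt : F.a i < x := lt_of_le_of_ne hi.1 hne
  let p : F.Sp := ⟨F.a i, i, left_mem_Icc.2 (F.a_lt_b i).le⟩
  have hp : p ∈ F.C := F.boundary_subset p ⟨i, Or.inl rfl⟩
  have hS : (F.C.filter (· < x)).Nonempty := ⟨p, Finset.mem_filter.2 ⟨hp, hlt⟩⟩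
  set z := (F.C.filter (· < x)).max' hS with hz
  have hzm := Finset.mem_filter.1 ((F.C.filter (· < x)).max'_mem hS)
  have hpz : p ≤ z := Finset.le_max' _ _ (Finset.mem_filter.2 ⟨hp, hlt⟩)
  refine ⟨z, hzm.2, fun t ht => ?_⟩
  have hai : F.a i ≤ z := hpz
  let w : F.Sp := ⟨t, i, hai.trans ht.1.le, ht.2.le.trans hi.2⟩
  have hw : w ∉ F.C := by
    intro hw
    have : w ≤ z := Finset.le_max' _ _ (Finset.mem_filter.2 ⟨hw, ht.2⟩)
    exact absurd ht.1 (not_lt.2 (show t ≤ z from this))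
  exact ⟨⟨w, hw⟩, rfl⟩

open Classical in
/-- A potential of the signed variation of `F`. -/
def potential (x : F.Sp) : F.Sp →₀ ℝ :=
  F.leftVec x + ∑ c ∈ F.C with c < x, (F.leftVec c - F.rightVec c)

theorem potential_sub {x y u v : F.Sp} (h : F.MonoInterval x y)
    (hu : F.IsRightLimit x u) (hv : F.IsLeftLimit y v) :
    F.potential y - F.potential x =
      F.signOn x y • (Finsupp.single v 1 - Finsupp.single u 1) := by
  classical
  have hfree : ∀ c ∈ F.C, c < y → c ≤ x := by
    intro c hc hcy
    by_contra hcx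
    obtain ⟨w, hw⟩ := h.2 c ⟨not_le.1 hcx, hcy⟩
    have : (w : F.Sp) = c := Subtype.ext hw
    exact w.2 (this ▸ hc)
  have hsum : F.potential y - F.potential x = F.leftVec y - F.rightVec x := by
    unfold potential
    by_cases hx : x ∈ F.C
    · have : F.C.filter (· < y) = insert x (F.C.filter (· < x)) := by
        ext c
        simp only [Finset.mem_filter, Finset.mem_insert]
        constructor
        · rintro ⟨hc, hcy⟩
          rcases (hfree c hc hcy).eq_or_lt with h1 | h1
          · exact Or.inl h1
          · exact Or.inr ⟨hc, h1⟩
        · rintro (rfl | ⟨hc, hcx⟩)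
          · exact ⟨hx, h.1⟩
          · exact ⟨hc, hcx.trans h.1⟩
      rw [this, Finset.sum_insert (by simp)]
      abel
    · have : F.C.filter (· < y) = F.C.filter (· < x) := by
        ext c
        simp only [Finset.mem_filter]
        constructor
        · rintro ⟨hc, hcy⟩
          refine ⟨hc, lt_of_le_of_ne (hfree c hc hcy) ?_⟩
          rintro rfl
          exact hx hc
        · rintro ⟨hc, hcx⟩
          exact ⟨hc, hcx.trans h.1⟩
      obtain ⟨z, hz⟩ := F.exists_left_interval hx
      have ht := F.tendsto_of_not_mem hz h hx
      have hl : F.IsLeftLimit x (F.toFun ⟨x, hx⟩) :=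
        ht.mono_left (comap_mono nhdsWithin_le_nhds)
      have hr : F.IsRightLimit x (F.toFun ⟨x, hx⟩) :=
        ht.mono_left (comap_mono nhdsWithin_le_nhds)
      rw [this, F.leftVec_eq hz hl, F.rightVec_eq h hr,
        F.signOn_eq_of_subset hz (hz.union h hx) (F.between_subset le_rfl h.1.le),
        F.signOn_eq_of_subset h (hz.union h hx) (F.between_subset hz.1.le le_rfl)]
      abel
  rw [hsum, F.leftVec_eq h hv, F.rightVec_eq h hu, smul_sub]

/-- Any two points of the same component of `Ω` are joined by a finite chain of intervals of
monotonicity. -/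
theorem chain_induction {P : F.Sp → F.Sp → Prop}
    (base : ∀ x y, F.MonoInterval x y → P x y)
    (trans : ∀ x y z, P x y → P y z → P x z) :
    ∀ x y : F.Sp, x < y → y ∈ connectedComponent x → P x y := by
  classical
  have key : ∀ n, ∀ x y : F.Sp, x < y → Icc (x : ℝ) y ⊆ {t | ∃ i, t ∈ Icc (F.a i) (F.b i)} →
      (F.C.filter fun c => x < c ∧ c < y).card = n → P x y := by
    intro n
    induction n using Nat.strong_induction_on with
    | _ n ih =>
      intro x y hxy hsub hn
      by_cases hC : ∃ c ∈ F.C, x < c ∧ c < y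
      · obtain ⟨c, hc, hxc, hcy⟩ := hC
        refine trans x c y (ih _ ?_ x c hxc ?_ rfl) (ih _ ?_ c y hcy ?_ rfl)
        · rw [← hn]
          refine Finset.card_lt_card ⟨fun d hd => ?_, fun hh => ?_⟩
          · simp only [Finset.mem_filter] at hd ⊢
            exact ⟨hd.1, hd.2.1, hd.2.2.trans hcy⟩
          · have := hh (Finset.mem_filter.2 ⟨hc, hxc, hcy⟩)
            exact lt_irrefl _ (Finset.mem_filter.1 this).2.2
        · exact (Icc_subset_Icc_right (show (c : ℝ) ≤ y from hcy.le)).trans hsub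
        · rw [← hn]
          refine Finset.card_lt_card ⟨fun d hd => ?_, fun hh => ?_⟩
          · simp only [Finset.mem_filter] at hd ⊢
            exact ⟨hd.1, hxc.trans hd.2.1, hd.2.2⟩
          · have := hh (Finset.mem_filter.2 ⟨hc, hxc, hcy⟩)
            exact lt_irrefl _ (Finset.mem_filter.1 this).2.1
        · exact (Icc_subset_Icc_left (show (x : ℝ) ≤ c from hxc.le)).trans hsub
      · refine base x y ⟨hxy, fun t ht => ?_⟩
        let w : F.Sp := ⟨t, hsub ⟨ht.1.le, ht.2.le⟩⟩
        exact ⟨⟨w, fun hw => hC ⟨w, hw, ht.1, ht.2⟩⟩, rfl⟩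
  intro x y hxy hc
  refine key _ x y hxy ?_ rfl
  have hp : IsPreconnected ((fun t : F.Sp => (t : ℝ)) '' connectedComponent x) :=
    isPreconnected_connectedComponent.image _ continuous_subtype_val.continuousOn
  have := hp.ordConnected.out ⟨x, mem_connectedComponent, rfl⟩ ⟨y, hc, rfl⟩
  intro t ht
  obtain ⟨w, _, rfl⟩ := this ht
  exact w.2

theorem single_sub_mem {X : Type*} [TopologicalSpace X] {x y : X} (h : y ∈ connectedComponent x) :
    Finsupp.single y (1 : ℝ) - Finsupp.single x 1 ∈ chainsOne X :=
  Submodule.subset_span ⟨x, y, h, rfl⟩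

theorem potential_sub_mem {x y : F.Sp} (h : y ∈ connectedComponent x) :
    F.potential y - F.potential x ∈ chainsOne F.Sp := by
  have key : ∀ x y : F.Sp, x < y → y ∈ connectedComponent x →
      F.potential y - F.potential x ∈ chainsOne F.Sp := by
    refine F.chain_induction (fun x y hxy => ?_) fun x y z h1 h2 => ?_
    · obtain ⟨u, hu⟩ := F.exists_rightLimit hxy
      obtain ⟨v, hv⟩ := F.exists_leftLimit hxy
      rw [F.potential_sub hxy hu hv]
      exact Submodule.smul_mem _ _ (single_sub_mem (F.limits_mem_component hxy hu hv))
    · rw [← sub_add_sub_cancel]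
      exact Submodule.add_mem _ h2 h1
  rcases lt_trichotomy x y with h1 | rfl | h1
  · exact key x y h1 h
  · rw [sub_self]
    exact Submodule.zero_mem _
  · rw [← neg_sub]
    refine Submodule.neg_mem _ (key y x h1 ?_)
    rw [← connectedComponent_eq h]
    exact mem_connectedComponent

theorem exists_isSignedOne : ∃ φ, F.IsSignedOne φ := by
  let ψ : Module.End ℝ (F.Sp →₀ ℝ) := Finsupp.linearCombination ℝ F.potential
  have hψ : ∀ x y : F.Sp, ψ (Finsupp.single y 1 - Finsupp.single x 1) =
      F.potential y - F.potential x := by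
    intro x y
    simp [ψ]
  have hm : ∀ v ∈ chainsOne F.Sp, ψ v ∈ chainsOne F.Sp := by
    have : chainsOne F.Sp ≤ (chainsOne F.Sp).comap ψ := by
      refine Submodule.span_le.2 ?_
      rintro _ ⟨x, y, h, rfl⟩
      change ψ _ ∈ chainsOne F.Sp
      rw [hψ]
      exact F.potential_sub_mem h
    exact this
  refine ⟨ψ.restrict hm, fun x y hxy u v hu hv h => ?_⟩
  change ψ (Finsupp.single y 1 - Finsupp.single x 1) = _
  rw [hψ, F.potential_sub hxy hu hv]

theorem IsSignedOne.unique {F : PMMap} {φ φ' : Module.End ℝ (chainsOne F.Sp)}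
    (h : F.IsSignedOne φ) (h' : F.IsSignedOne φ') : φ = φ' := by
  have key : ∀ x y : F.Sp, x < y → y ∈ connectedComponent x →
      ∃ hm : Finsupp.single y 1 - Finsupp.single x 1 ∈ chainsOne F.Sp,
        φ ⟨_, hm⟩ = φ' ⟨_, hm⟩ := by
    refine F.chain_induction (fun x y hxy => ?_) ?_
    · have hc : Icc (x : ℝ) y ⊆ range fun t : F.Sp => (t : ℝ) := by
        intro t ht
        rcases eq_or_lt_of_le ht.1 with rfl | h1
        · exact ⟨x, rfl⟩
        rcases eq_or_lt_of_le ht.2 with rfl | h2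
        · exact ⟨y, rfl⟩
        obtain ⟨w, rfl⟩ := hxy.2 t ⟨h1, h2⟩
        exact ⟨w, rfl⟩
      have hp : IsPreconnected (Icc x y) := by
        have hi : IsInducing fun t : F.Sp => (t : ℝ) := IsEmbedding.subtypeVal.isInducing
        rw [← hi.isPreconnected_image]
        have : (fun t : F.Sp => (t : ℝ)) '' Icc x y = Icc (x : ℝ) y := by
          ext t
          constructor
          · rintro ⟨w, hw, rfl⟩
            exact hw
          · intro ht
            obtain ⟨w, rfl⟩ := hc ht
            exact ⟨w, ht, rfl⟩
        rw [this]
        exact isPreconnected_Icc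
      have hm := single_sub_mem (hp.subset_connectedComponent (left_mem_Icc.2 hxy.1.le)
        (right_mem_Icc.2 hxy.1.le))
      obtain ⟨u, hu⟩ := F.exists_rightLimit hxy
      obtain ⟨v, hv⟩ := F.exists_leftLimit hxy
      exact ⟨hm, Subtype.ext ((h x y hxy u v hu hv hm).trans (h' x y hxy u v hu hv hm).symm)⟩
    · rintro x y z ⟨h1, e1⟩ ⟨h2, e2⟩
      have hs : Finsupp.single z (1 : ℝ) - Finsupp.single x 1 =
          (Finsupp.single z 1 - Finsupp.single y 1) + (Finsupp.single y 1 - Finsupp.single x 1) :=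
        (sub_add_sub_cancel _ _ _).symm
      have hm : Finsupp.single z (1 : ℝ) - Finsupp.single x 1 ∈ chainsOne F.Sp := by
        rw [hs]
        exact Submodule.add_mem _ h2 h1
      refine ⟨hm, ?_⟩
      have : (⟨_, hm⟩ : chainsOne F.Sp) = ⟨_, h2⟩ + ⟨_, h1⟩ := Subtype.ext hs
      rw [this, map_add, map_add, e1, e2]
  have hall : ∀ v (hv : v ∈ chainsOne F.Sp), φ ⟨v, hv⟩ = φ' ⟨v, hv⟩ := by
    have hgen : ∀ x y : F.Sp, y ∈ connectedComponent x →
        ∀ hm : Finsupp.single y 1 - Finsupp.single x 1 ∈ chainsOne F.Sp,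
          φ ⟨_, hm⟩ = φ' ⟨_, hm⟩ := by
      intro x y hc hm
      rcases lt_trichotomy x y with h1 | rfl | h1
      · exact (key x y h1 hc).2
      · have : (⟨_, hm⟩ : chainsOne F.Sp) = 0 := Subtype.ext (sub_self _)
        rw [this, map_zero, map_zero]
      · have hc' : x ∈ connectedComponent y := by
          rw [← connectedComponent_eq hc]
          exact mem_connectedComponent
        obtain ⟨hm', e⟩ := key y x h1 hc'
        have : (⟨_, hm⟩ : chainsOne F.Sp) = -⟨_, hm'⟩ := Subtype.ext (neg_sub _ _).symm
        rw [this]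
        exact ((map_neg φ _).trans (congrArg _ e)).trans (map_neg φ' _).symm
    intro v hv
    induction hv using Submodule.span_induction with
    | mem v hv' =>
      obtain ⟨x, y, hc, rfl⟩ := hv'
      exact hgen x y hc _
    | zero => exact (map_zero φ).trans (map_zero φ').symm
    | add v w hv hw e1 e2 =>
      have : (⟨v + w, Submodule.add_mem _ hv hw⟩ : chainsOne F.Sp) = ⟨v, hv⟩ + ⟨w, hw⟩ := rfl
      rw [this, map_add, map_add]
      exact congrArg₂ _ e1 e2
    | smul r v hv e =>
      have : (⟨r • v, Submodule.smul_mem _ r hv⟩ : chainsOne F.Sp) = r • ⟨v, hv⟩ := rfl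
      rw [this, map_smul, map_smul]
      exact congrArg _ e
  ext1 v
  exact hall v.1 v.2

/-- The endomorphism `εF_{#1}` of `S₁(Ω; ℝ)`: the unique endomorphism with
`y - x ↦ ε([x, y]) (F(y-) - F(x+))` whenever `F` is monotone on `[x, y]`. -/
def signedOne : Module.End ℝ (chainsOne F.Sp) := F.exists_isSignedOne.choose

theorem isSignedOne_signedOne : F.IsSignedOne F.signedOne := F.exists_isSignedOne.choose_spec

/-- The kneading determinant `D(z)` of `F`: the determinant of the pair `(εF_{#0}, εF_{#1})`
of endomorphisms of the subspaces `S₀(Ω; ℝ)` and `S₁(Ω; ℝ)` of `S₀(Ω; ℝ)`. -/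
def kneadingDet : PowerSeries ℝ :=
  pairDet (V₀ := (⊤ : Submodule ℝ (F.Sp →₀ ℝ))) (V₁ := chainsOne F.Sp)
    (Submodule.topEquiv.symm.conj F.signedZero) F.signedOne

end PMMap

/-! ### Graphs and piecewise monotone graph maps -/

section Graphs

variable (G : Type u) [TopologicalSpace G]

/-- A graph: a compact Hausdorff space that is a union of finitely many homeomorphic copies of
`[0, 1]`, any two of which intersect at most at their endpoints. -/
structure IsTopGraph : Prop where
  compact : CompactSpace G
  hausdorff : T2Space G
  exists_edges : ∃ (k : ℕ) (e : Fin k → unitInterval → G),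
    (∀ i, IsEmbedding (e i)) ∧ (⋃ i, range (e i)) = univ ∧
      ∀ i j, i ≠ j → ∀ s t, e i s = e j t → (s = 0 ∨ s = 1) ∧ (t = 0 ∨ t = 1)

/-- The vertices of `G`: the points without an open neighbourhood homeomorphic to `]0, 1[`. -/
def vertices : Set G :=
  {x | ¬ ∃ U : Set G, IsOpen U ∧ x ∈ U ∧ Nonempty (U ≃ₜ Ioo (0 : ℝ) 1)}

variable {G}

/-- A piecewise monotone graph map: a continuous map that is injective on each connected component
of the complement of some finite set. -/
def IsPMG (f : C(G, G)) : Prop :=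
  ∃ C : Set G, C.Finite ∧ ∀ x ∈ Cᶜ, InjOn f (connectedComponentIn Cᶜ x)

/-- The fixed points of negative type of a self-map `g` of `G`: the fixed points `x` that are not
vertices and near which, in a local coordinate `e` of `G` around `x`, the map `g` is given by a
strictly decreasing function `q`. -/
def negFix (g : G → G) : Set G :=
  {x | g x = x ∧ x ∉ vertices G ∧
    ∃ (e : ℝ → G) (t : ℝ), IsOpenEmbedding e ∧ e t = x ∧
      ∃ W ∈ 𝓝 t, ∃ q : ℝ → ℝ, StrictAntiOn q W ∧ ∀ s ∈ W, g (e s) = e (q s)}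

/-- The endomorphism `f_{*i}` of the singular homology group `H_i(G; ℝ)`. -/
def homologyMap (f : C(G, G)) (i : ℕ) :
    Module.End ℝ ((((AlgebraicTopology.singularHomologyFunctor (ModuleCat.{u} ℝ) i).obj
      (ModuleCat.of ℝ (ULift.{u} ℝ))).obj (TopCat.of G)) : ModuleCat.{u} ℝ) :=
  (((AlgebraicTopology.singularHomologyFunctor (ModuleCat.{u} ℝ) i).obj
      (ModuleCat.of ℝ (ULift.{u} ℝ))).map (TopCat.ofHom f)).hom

/-- The Lefschetz zeta function
`ζ^L(z) = exp (∑_{n ≥ 1} (tr (f_{*0}) ^ n - tr (f_{*1}) ^ n) z ^ n / n)`. -/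
def zetaLefschetz (f : C(G, G)) : PowerSeries ℝ :=
  expSeries fun n => LinearMap.trace ℝ _ (homologyMap f 0 ^ n) -
    LinearMap.trace ℝ _ (homologyMap f 1 ^ n)

/-- The negative zeta function `ζ⁻(z) = exp (∑_{n ≥ 1} 2 #Fix⁻(f ^ n) z ^ n / n)`. -/
def zetaNeg (f : C(G, G)) : PowerSeries ℝ :=
  expSeries fun n => 2 * ((negFix (f^[n])).ncard : ℝ)

/-- The Milnor-Thurston zeta function `ζ^{MT}(z) = ζ⁻(z) ζ^L(z)⁻¹`. -/
def zetaMT (f : C(G, G)) : PowerSeries ℝ := zetaNeg f * (zetaLefschetz f)⁻¹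

/-- `f` is induced by `F` through the continuous map `p : Ω → G`:
`Ver(G) ⊆ p(∂Ω)`, `p` maps `Ω \ ∂Ω` homeomorphically onto `G \ p(∂Ω)`, and `p ∘ F = f ∘ p`
on `Ω \ C`. -/
structure IsInducedBy (f : C(G, G)) (F : PMMap) (p : F.Sp → G) : Prop where
  continuous : Continuous p
  vertices_subset : vertices G ⊆ p '' F.boundary
  isEmbedding : IsEmbedding (F.boundaryᶜ.domRestrict p)
  image_eq : p '' F.boundaryᶜ = (p '' F.boundary)ᶜ
  commutes : ∀ w : F.Dom, p (F.toFun w) = f (p (w : F.Sp))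

end Graphs

end KneadingGraph

end

/-!
The quotient `ζ^{MT}(z) D(z)` is `H(z) = exp (∑ h_n z ^ n / n)` with
`h_n = 2 #Fix⁻(f ^ n) - (tr (f_{*0}) ^ n - tr (f_{*1}) ^ n) - tr ((εF_{#0}) ^ n, (εF_{#1}) ^ n)`,
and everything follows from the fact that the `h_n` are integers which are bounded independently of
`n`. For bounded integers `h_n` the recursion `n H_n = ∑ h_{n - j} H_j` shows that the coefficients
of `H` grow at most polynomially; so `H` converges on the unit disc, and it has no zero there since
the same holds for its inverse, the series of `-h_n` (`exists_hasSum_zetaSeries`).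

The iterate `F ^ n` is again a piecewise monotone map that induces `f ^ n`, and its endomorphisms
`εF_{#0}`, `εF_{#1}` are the powers of those of `F` (`PMMap.signedZero_iter`,
`PMMap.signedOne_iter`), so it suffices to bound `h_1`, by a multiple of the number of points in a
set that contains `∂Ω` and those `c ∈ C` with `f(p(c)) = p(c)` (`IsInducedBy.exists_defect`). One
finite set serves for all iterates: if `c` is exceptional for `F ^ n`, then `p(c)` is in the orbit
of one of the periodic points in the finite set `p(C)` (`IsInducedBy.exists_uniform_finset`).

The three terms of `h_1` are compared lap by lap.
* There is an extension of `εF_{#1}` to `S₀(Ω)` with values in `S₁(Ω)` which differs from `εF_{#0}`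
  by an operator of finite rank carried by the one-sided values of `F` at the points of `C`
  (`PMMap.signedOneExt_sub_signedZero`). Therefore the trace of the pair is a sum over the laps of
  `F`, with signs; without the signs it changes by twice the number of decreasing laps that contain
  a fixed point (`PMMap.pairTrace_eq_add`), and these correspond to the fixed points of negative type
  of `f`, up to fixed points in `p(C)` (`IsInducedBy.card_negLaps`).
* The graph `G` arises from `Ω` by identifying points of `∂Ω`, and its singular homology is that of
  the complex spanned by the components of `Ω` (edges) and the points of `p(∂Ω)` (vertices)
  (`IsGluing.edgeMap_injective`, `IsGluing.map_edgeMap`, `IsGluing.ker_projection`). Winding numbers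
  show that no combination of edges is a boundary. That the edges and vertices suffice is proved by
  duality: a functional on singular `1`-chains modulo boundaries which vanishes on all paths inside
  edges is zero, because locally every path is homotopic to a composition of such paths
  (`IsGluing.eq_zero_of_pathTo`). Hopf's trace formula then expresses the Lefschetz number of `f` by
  the traces on vertices and edges (`IsInducedBy.lefschetz_eq`).
* The trace on the edges is again a sum over the laps, and differs from the sum of the unsigned terms
  only by contributions of points of `∂Ω` and of fixed points in `C`: at any other `c ∈ C` the limits
  `F(c-)` and `F(c+)` have the same image in `G`, and their contributions cancel
  (`IsInducedBy.exists_sum_lapTerm_sub`).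

The coefficients of `D` are integers because, again by the finite rank of the difference of
`εF_{#1}` and `εF_{#0}`, the series `D(z)` is the determinant of a matrix `1 - z M(z)`, where the
coefficients of `M(z)` are integral matrices (`det_eq_zetaSeries_finiteRankTrace`,
`PMMap.exists_int_kneadingDet`).
-/

open Set Filter Topology

noncomputable section

namespace KneadingGraph

/-! ### Exponential power series of zeta type -/

section FormalSeries

open PowerSeries

variable {K : Type*} [Field K] [CharZero K]

/-- A linear differential equation `y' = g y` has at most one solution with `y(0) = 1`. -/
theorem eq_of_derivative_eq_mul {g y w : PowerSeries K} (hy : d⁄dX K y = g * y)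
    (hw : d⁄dX K w = g * w) (hy0 : constantCoeff y = 1) (hw0 : constantCoeff w = 1) : y = w := by
  ext n
  induction n using Nat.strong_induction_on with
  | _ n ih =>
    cases n with
    | zero => simp [hy0, hw0]
    | succ n =>
      have h1 := congrArg (coeff n) hy
      have h2 := congrArg (coeff n) hw
      rw [coeff_derivative, coeff_mul] at h1 h2
      have : ((n : K) + 1) ≠ 0 := by exact_mod_cast Nat.succ_ne_zero n
      apply mul_right_cancel₀ this
      rw [h1, h2]
      refine Finset.sum_congr rfl fun x hx => ?_
      rw [ih x.2 (by have := Finset.HasAntidiagonal.mem_antidiagonal.1 hx; lia)]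

theorem hasSubst_logSeries (t : ℕ → K) :
    PowerSeries.HasSubst (PowerSeries.mk fun n => t n / (n : K)) :=
  HasSubst.of_constantCoeff_zero' (by simp)

variable [Algebra ℚ K]

/-- The formal power series `exp (∑_{n ≥ 1} (t n / n) z ^ n)` over a field of characteristic
zero; over `ℝ` it is `expSeries t`. -/
def zetaSeries (t : ℕ → K) : PowerSeries K :=
  (PowerSeries.exp K).subst (PowerSeries.mk fun n => t n / (n : K))

theorem constantCoeff_zetaSeries (t : ℕ → K) : constantCoeff (zetaSeries t) = 1 := by
  have h := constantCoeff_subst_eq_zero (R := K) (S := K) (τ := Unit)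
    (a := PowerSeries.mk fun n => t n / (n : K)) (by
      change PowerSeries.constantCoeff _ = 0
      simp) (PowerSeries.exp K - 1) (by simp)
  rw [subst_sub (hasSubst_logSeries t)] at h
  have h1 : (1 : PowerSeries K).subst (PowerSeries.mk fun n => t n / (n : K)) = 1 := by
    rw [← coe_substAlgHom (hasSubst_logSeries t), map_one]
  rw [h1] at h
  rw [map_sub, map_one] at h
  exact sub_eq_zero.1 h

/-- The differential equation of `zetaSeries t`, on which all its identities rest. -/
theorem derivative_zetaSeries (t : ℕ → K) :
    d⁄dX K (zetaSeries t) = (PowerSeries.mk fun n => t (n + 1)) * zetaSeries t := by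
  rw [zetaSeries, derivative_subst (hasSubst_logSeries t), derivative_exp, mul_comm]
  congr 1
  ext n
  rw [coeff_derivative, coeff_mk, coeff_mk]
  have : ((n : K) + 1) ≠ 0 := by exact_mod_cast Nat.succ_ne_zero n
  push_cast
  field_simp

theorem zetaSeries_add (s t : ℕ → K) :
    zetaSeries (fun n => s n + t n) = zetaSeries s * zetaSeries t := by
  refine eq_of_derivative_eq_mul (derivative_zetaSeries _) ?_ (constantCoeff_zetaSeries _) ?_
  · rw [Derivation.leibniz, derivative_zetaSeries, derivative_zetaSeries, smul_eq_mul, smul_eq_mul]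
    have : (PowerSeries.mk fun n => s (n + 1) + t (n + 1)) =
        (PowerSeries.mk fun n => s (n + 1)) + (PowerSeries.mk fun n => t (n + 1)) := by
      ext; simp
    rw [this]
    ring
  · rw [map_mul, constantCoeff_zetaSeries, constantCoeff_zetaSeries, mul_one]

theorem zetaSeries_zero : zetaSeries (fun _ => (0 : K)) = 1 :=
  eq_of_derivative_eq_mul (g := 0) (by rw [derivative_zetaSeries]; congr 1) (by simp)
    (constantCoeff_zetaSeries _) (by simp)

theorem zetaSeries_mul_neg (t : ℕ → K) : zetaSeries t * zetaSeries (fun n => -t n) = 1 := by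
  rw [← zetaSeries_add]
  simp only [add_neg_cancel]
  exact zetaSeries_zero

theorem zetaSeries_neg (t : ℕ → K) : zetaSeries (fun n => -t n) = (zetaSeries t)⁻¹ := by
  rw [PowerSeries.eq_inv_iff_mul_eq_one (by rw [constantCoeff_zetaSeries]; exact one_ne_zero),
    mul_comm]
  exact zetaSeries_mul_neg t

/-- The values at `0` of `t` play no role. -/
theorem zetaSeries_congr {s t : ℕ → K} (h : ∀ n, s (n + 1) = t (n + 1)) :
    zetaSeries s = zetaSeries t := by
  refine eq_of_derivative_eq_mul (derivative_zetaSeries _) ?_ (constantCoeff_zetaSeries _)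
    (constantCoeff_zetaSeries _)
  rw [derivative_zetaSeries]
  simp only [h]

theorem map_zetaSeries {L : Type*} [Field L] [CharZero L] [Algebra ℚ L] (φ : K →+* L)
    (t : ℕ → K) : PowerSeries.map φ (zetaSeries t) = zetaSeries fun n => φ (t n) := by
  refine eq_of_derivative_eq_mul (K := L) (g := PowerSeries.mk fun n => φ (t (n + 1))) ?_
    (derivative_zetaSeries _) ?_ (constantCoeff_zetaSeries _)
  · have h := congrArg (PowerSeries.map φ) (derivative_zetaSeries t)
    rw [map_mul] at h
    have h1 : PowerSeries.map φ (PowerSeries.mk fun n => t (n + 1)) =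
        PowerSeries.mk fun n => φ (t (n + 1)) := by ext; simp
    rw [← h1, ← h]
    ext n
    simp [coeff_derivative]
  · rw [← PowerSeries.coeff_zero_eq_constantCoeff_apply, PowerSeries.coeff_map,
      PowerSeries.coeff_zero_eq_constantCoeff_apply, constantCoeff_zetaSeries, map_one]

/-- If the exponents `h n` are integers bounded by `k`, the coefficients of
`exp (∑ (h n / n) z ^ n)` grow at most polynomially: by `n H_n = ∑_{j < n} h_{n - j} H_j`, the
partial sums `S_n = ∑_{j < n} |H_j|` satisfy `S_{n + 1} ≤ (1 + k / n) S_n ≤ (1 + 1 / n) ^ k S_n`. -/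
theorem sum_abs_coeff_zetaSeries_le {h : ℕ → ℤ} {k : ℕ} (hk : ∀ n, |h (n + 1)| ≤ k) (n : ℕ) :
    ∑ j ∈ Finset.range (n + 1), |coeff j (zetaSeries fun n => (h n : ℚ))| ≤ ((n : ℚ) + 1) ^ k := by
  set H := zetaSeries fun n => (h n : ℚ) with hH
  induction n with
  | zero => simp [hH, constantCoeff_zetaSeries]
  | succ n ih =>
    have hpos : (0 : ℚ) < (n : ℚ) + 1 := by positivity
    have hrec := congrArg (coeff n) (derivative_zetaSeries fun n => (h n : ℚ))
    rw [coeff_derivative, coeff_mul, ← hH] at hrec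
    have hb : |coeff (n + 1) H| * ((n : ℚ) + 1) ≤
        k * ∑ j ∈ Finset.range (n + 1), |coeff j H| := by
      rw [← abs_of_pos hpos, ← abs_mul, hrec, Finset.mul_sum]
      refine (Finset.abs_sum_le_sum_abs _ _).trans ?_
      rw [Finset.Nat.sum_antidiagonal_eq_sum_range_succ_mk, ← Finset.sum_range_reflect]
      refine Finset.sum_le_sum fun j hj => ?_
      have hj' := Finset.mem_range.1 hj
      rw [abs_mul, coeff_mk]
      have e : n - (n + 1 - 1 - j) = j := by lia
      simp only [e]
      refine mul_le_mul_of_nonneg_right ?_ (abs_nonneg _)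
      exact_mod_cast hk _
    rw [Finset.sum_range_succ]
    set S := ∑ j ∈ Finset.range (n + 1), |coeff j H| with hS
    have hS0 : 0 ≤ S := Finset.sum_nonneg fun _ _ => abs_nonneg _
    have h1 : |coeff (n + 1) H| ≤ k * S / ((n : ℚ) + 1) := (le_div_iff₀ hpos).2 hb
    have h2 : 1 + (k : ℚ) * (1 / ((n : ℚ) + 1)) ≤ (1 + 1 / ((n : ℚ) + 1)) ^ k :=
      one_add_mul_le_pow (le_trans (by norm_num) (by positivity : (0 : ℚ) ≤ 1 / ((n : ℚ) + 1))) k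
    calc S + |coeff (n + 1) H| ≤ S + k * S / ((n : ℚ) + 1) := by gcongr
      _ = S * (1 + (k : ℚ) * (1 / ((n : ℚ) + 1))) := by ring
      _ ≤ ((n : ℚ) + 1) ^ k * (1 + 1 / ((n : ℚ) + 1)) ^ k :=
        mul_le_mul ih h2 (by positivity) (by positivity)
      _ = (((n + 1 : ℕ) : ℚ) + 1) ^ k := by
        rw [← mul_pow]
        congr 1
        push_cast
        field_simp

/-- Polynomial growth of the coefficients gives absolute convergence in the unit disc. -/
theorem summable_norm_zetaSeries {h : ℕ → ℤ} {k : ℕ} (hk : ∀ n, |h (n + 1)| ≤ k) {z : ℂ}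
    (hz : ‖z‖ < 1) :
    Summable fun n => ‖((coeff n (zetaSeries fun n => (h n : ℚ)) : ℚ) : ℂ) * z ^ n‖ := by
  have hs : Summable fun n : ℕ => (((n + 1 : ℕ) : ℝ) ^ k) * ‖z‖ ^ n := by
    have h1 := (summable_nat_add_iff 1).2
      (summable_pow_mul_geometric_of_norm_lt_one k (r := ‖z‖) (by simpa using hz))
    by_cases h0 : ‖z‖ = 0
    · refine summable_of_ne_finset_zero (s := {0}) fun n hn => ?_
      rw [h0, zero_pow (by simpa using hn), mul_zero]
    · refine (h1.mul_right (‖z‖⁻¹)).congr fun n => ?_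
      rw [pow_succ]
      field_simp
  refine Summable.of_nonneg_of_le (fun _ => norm_nonneg _) (fun n => ?_) hs
  rw [norm_mul, norm_pow]
  refine mul_le_mul_of_nonneg_right ?_ (by positivity)
  have h1 := sum_abs_coeff_zetaSeries_le hk n
  have h2 : |coeff n (zetaSeries fun n => (h n : ℚ))| ≤ ((n : ℚ) + 1) ^ k :=
    (Finset.single_le_sum (f := fun j => |coeff j (zetaSeries fun n => (h n : ℚ))|)
      (fun _ _ => abs_nonneg _) (Finset.self_mem_range_succ n)).trans h1
  have h3 : ((|coeff n (zetaSeries fun n => (h n : ℚ))| : ℚ) : ℝ) ≤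
      ((((n : ℚ) + 1) ^ k : ℚ) : ℝ) := Rat.cast_le.2 h2
  rw [Complex.norm_ratCast]
  push_cast at h3 ⊢
  exact h3

/-- For bounded integers `h n` the series `exp (∑ (h n / n) z ^ n)` converges on the unit disc and
has no zero there, because its inverse, the series of `-h`, converges as well. -/
theorem exists_hasSum_zetaSeries {h : ℕ → ℤ} {k : ℕ} (hk : ∀ n, |h (n + 1)| ≤ k) {z : ℂ}
    (hz : ‖z‖ < 1) : ∃ w : ℂ, w ≠ 0 ∧
      HasSum (fun n : ℕ => ((coeff n (zetaSeries fun n => (h n : ℚ)) : ℚ) : ℂ) * z ^ n) w := by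
  have h1 := summable_norm_zetaSeries hk hz
  have h2 := summable_norm_zetaSeries (h := fun n => -h n) (k := k)
    (fun n => by rw [abs_neg]; exact hk n) hz
  refine ⟨_, ?_, h1.of_norm.hasSum⟩
  intro h0
  have hm := tsum_mul_tsum_eq_tsum_sum_antidiagonal_of_summable_norm h1 h2
  rw [h0, zero_mul] at hm
  have hone := zetaSeries_mul_neg fun n => (h n : ℚ)
  have : ∀ n, ∑ x ∈ Finset.HasAntidiagonal.antidiagonal n,
      ((coeff x.1 (zetaSeries fun n => (h n : ℚ)) : ℚ) : ℂ) * z ^ x.1 *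
        (((coeff x.2 (zetaSeries fun n => ((-h n : ℤ) : ℚ)) : ℚ) : ℂ) * z ^ x.2) =
      if n = 0 then 1 else 0 := by
    intro n
    have hn := congrArg (coeff n) hone
    rw [coeff_mul, coeff_one] at hn
    have hn' := congrArg (fun q : ℚ => (q : ℂ) * z ^ n) hn
    simp only [Rat.cast_sum, Rat.cast_mul, Finset.sum_mul] at hn'
    trans (((if n = 0 then 1 else 0 : ℚ) : ℂ)) * z ^ n
    · rw [← hn']
      refine Finset.sum_congr rfl fun x hx => ?_
      rw [← Finset.HasAntidiagonal.mem_antidiagonal.1 hx, pow_add]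
      push_cast
      ring
    · split_ifs with hn0
      · simp [hn0]
      · simp
  rw [tsum_congr this, tsum_ite_eq] at hm
  exact zero_ne_one hm

end FormalSeries

/-! ### Determinants of matrices of power series -/

section FormalDeterminants

open PowerSeries

/-- Jacobi's formula for the derivative of a determinant. -/
theorem derivation_det {R A ι : Type*} [CommRing R] [CommRing A] [Algebra R A] [Fintype ι]
    [DecidableEq ι] (D : Derivation R A A) (M : Matrix ι ι A) :
    D M.det = (M.adjugate * M.map D).trace := by
  have hprod : ∀ (s : Finset ι) (g : ι → A),
      D (∏ i ∈ s, g i) = ∑ j ∈ s, ∏ i ∈ s, Function.update g j (D (g j)) i := by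
    intro s g
    induction s using Finset.induction_on with
    | empty => simp
    | insert a s ha ih =>
      rw [Finset.prod_insert ha, Derivation.leibniz, ih, Finset.sum_insert ha,
        Finset.prod_insert ha, Function.update_self, smul_eq_mul, smul_eq_mul, Finset.mul_sum,
        add_comm]
      congr 1
      · rw [mul_comm]
        congr 1
        refine Finset.prod_congr rfl fun i hi => ?_
        rw [Function.update_of_ne]
        rintro rfl
        exact ha hi
      · refine Finset.sum_congr rfl fun j hj => ?_
        rw [Finset.prod_insert ha, Function.update_of_ne]
        rintro rfl
        exact ha hj
  have hrow : ∀ j, (M.updateRow j (fun i => D (M j i))).det = ∑ i, M.adjugate i j * D (M j i) := by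
    intro j
    rw [← Matrix.cramer_transpose_apply, Matrix.cramer_eq_adjugate_mulVec,
      ← Matrix.adjugate_transpose, Matrix.mulVec, dotProduct]
    refine Finset.sum_congr rfl fun i _ => ?_
    rfl
  have hleft : D M.det = ∑ j, (M.updateRow j (fun i => D (M j i))).det := by
    simp only [Matrix.det_apply', map_sum]
    rw [Finset.sum_comm]
    refine Finset.sum_congr rfl fun σ _ => ?_
    rw [← zsmul_eq_mul, map_zsmul, ← Equiv.prod_comp σ⁻¹, hprod, zsmul_eq_mul, Finset.mul_sum]
    refine Finset.sum_congr rfl fun j _ => ?_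
    rw [← Equiv.prod_comp σ⁻¹ (fun i => M.updateRow j _ (σ i) i)]
    congr 1
    refine Finset.prod_congr rfl fun i _ => ?_
    by_cases hij : i = j
    · subst hij
      simp
    · simp [Function.update_of_ne hij, Matrix.updateRow_ne hij]
  rw [hleft]
  simp only [hrow, Matrix.trace, Matrix.diag, Matrix.mul_apply, Matrix.map_apply]
  exact Finset.sum_comm

variable {ι : Type*} [Fintype ι] [DecidableEq ι]

/-- The matrix of power series with coefficient matrices `s n`. -/
def matrixSeries {R : Type*} [CommRing R] (s : ℕ → Matrix ι ι R) : Matrix ι ι (PowerSeries R) :=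
  Matrix.of fun i j => PowerSeries.mk fun n => s n i j

/-- If the coefficients of `M(z)` and `P(z)` satisfy `P (1 - z M) = (z M)'`, then
`det (1 - z M) = exp (-∫ tr P)`. -/
theorem det_one_sub_matrixSeries {M P : ℕ → Matrix ι ι ℝ} (h0 : P 0 = M 0)
    (hs : ∀ n, P (n + 1) = ((n : ℝ) + 2) • M (n + 1) +
      ∑ x ∈ Finset.HasAntidiagonal.antidiagonal n, P x.1 * M x.2)
    {t : ℕ → ℝ} (ht : ∀ n, t (n + 1) = (P n).trace) :
    (1 - (X : PowerSeries ℝ) • matrixSeries M).det = zetaSeries fun n => -t n := by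
  set W := 1 - (X : PowerSeries ℝ) • matrixSeries M with hW
  have hmap : W.map (d⁄dX ℝ) = -(matrixSeries P * W) := by
    have h1 : W.map (d⁄dX ℝ) = -((X : PowerSeries ℝ) • matrixSeries M).map (d⁄dX ℝ) := by
      ext1 i j
      simp only [hW, Matrix.map_apply, Matrix.sub_apply, map_sub, Matrix.neg_apply,
        Matrix.one_apply]
      split_ifs <;> simp
    rw [h1, hW, mul_sub, mul_one, mul_smul_comm]
    congr 1
    ext i j n
    simp only [Matrix.map_apply, Matrix.smul_apply, Matrix.sub_apply, map_sub, smul_eq_mul,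
      coeff_derivative, coeff_succ_X_mul]
    cases n with
    | zero => simp [matrixSeries, h0]
    | succ n =>
      rw [coeff_succ_X_mul]
      simp only [matrixSeries, Matrix.of_apply, coeff_mk, Matrix.mul_apply, map_sum, coeff_mul]
      rw [hs, Finset.sum_comm]
      simp only [Matrix.add_apply, Matrix.smul_apply, Matrix.sum_apply, Matrix.mul_apply,
        smul_eq_mul]
      push_cast
      ring
  refine eq_of_derivative_eq_mul ?_ (derivative_zetaSeries _) ?_
    (constantCoeff_zetaSeries _)
  · rw [derivation_det, hmap, mul_neg, Matrix.trace_neg, ← mul_assoc, Matrix.trace_mul_comm,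
      ← mul_assoc, Matrix.mul_adjugate, Matrix.smul_mul, one_mul, Matrix.trace_smul, smul_eq_mul,
      mul_comm, ← neg_mul]
    congr 1
    ext n
    simp [Matrix.trace, matrixSeries, ht]
  · rw [RingHom.map_det]
    have : (constantCoeff (R := ℝ)).mapMatrix W = 1 := by
      ext i j
      simp [hW, Matrix.one_apply, apply_ite]
    rw [this, Matrix.det_one]

/-- `det (1 - z M(z))` inherits integrality from the coefficients of `M(z)`. -/
theorem exists_int_det_one_sub_matrixSeries {M : ℕ → Matrix ι ι ℝ}
    (hM : ∀ n i j, ∃ k : ℤ, M n i j = k) :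
    ∃ D : PowerSeries ℤ, constantCoeff D = 1 ∧
      PowerSeries.map (algebraMap ℤ ℝ) D =
        (1 - (X : PowerSeries ℝ) • matrixSeries M).det := by
  choose m hm using hM
  refine ⟨(1 - (X : PowerSeries ℤ) • matrixSeries fun n => Matrix.of (m n)).det, ?_, ?_⟩
  · rw [RingHom.map_det]
    have : (constantCoeff (R := ℤ)).mapMatrix
        (1 - (X : PowerSeries ℤ) • matrixSeries fun n => Matrix.of (m n)) = 1 := by
      ext i j
      simp [Matrix.one_apply, apply_ite]
    rw [this, Matrix.det_one]
  · rw [RingHom.map_det]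
    congr 1
    ext i j n
    simp only [RingHom.mapMatrix_apply, Matrix.map_apply, Matrix.sub_apply, Matrix.smul_apply,
      map_sub, smul_eq_mul, map_mul, PowerSeries.map_X, Matrix.one_apply]
    congr 1
    · split_ifs <;> simp
    · congr 2
      ext k
      simp [matrixSeries, hm]

end FormalDeterminants

/-! ### Traces and determinants of operators of finite rank -/

section FiniteRank

variable {V : Type*} [AddCommGroup V] [Module ℝ V]
variable {E : Type*} [AddCommGroup E] [Module ℝ E] [FiniteDimensional ℝ E]

theorem finiteDimensional_range_comp (B : E →ₗ[ℝ] V) (A : V →ₗ[ℝ] E) :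
    FiniteDimensional ℝ (LinearMap.range (B ∘ₗ A)) :=
  Submodule.finiteDimensional_of_le (LinearMap.range_comp_le_range A B)

/-- The trace of an endomorphism that factors through a finite-dimensional space. -/
theorem finiteRankTrace_comp (B : E →ₗ[ℝ] V) (A : V →ₗ[ℝ] E) :
    finiteRankTrace (B ∘ₗ A) = LinearMap.trace ℝ E (A ∘ₗ B) := by
  have := finiteDimensional_range_comp B A
  let W := LinearMap.range (B ∘ₗ A)
  let R := LinearMap.range A
  have hR : ∀ x, (A ∘ₗ B) x ∈ R := fun x => ⟨B x, rfl⟩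
  rw [← LinearMap.trace_restrict_eq_of_forall_mem R (A ∘ₗ B) hR]
  let B' : R →ₗ[ℝ] W := (B.domRestrict R).codRestrict W (by
    rintro ⟨_, v, rfl⟩
    exact ⟨v, rfl⟩)
  let A' : W →ₗ[ℝ] R := (A.domRestrict W).codRestrict R fun w => ⟨w, rfl⟩
  have h1 : (A ∘ₗ B).restrict (fun x (_ : x ∈ R) => hR x) = A' ∘ₗ B' := rfl
  have h2 : (B ∘ₗ A).restrict (p := W) (q := W) (fun x _ => LinearMap.mem_range_self _ x) =
    B' ∘ₗ A' := rfl
  rw [h1, LinearMap.trace_comp_comm', ← h2]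
  rfl

theorem finiteRankTrace_eq_of_range_le {φ : Module.End ℝ V} {W : Submodule ℝ V}
    [FiniteDimensional ℝ W] (h : LinearMap.range φ ≤ W) :
    finiteRankTrace φ = LinearMap.trace ℝ W
      (φ.codRestrict W (fun x => h (LinearMap.mem_range_self φ x)) ∘ₗ W.subtype) := by
  rw [← finiteRankTrace_comp]
  rfl

theorem finiteRankTrace_add {φ ψ : Module.End ℝ V} (hφ : FiniteDimensional ℝ (LinearMap.range φ))
    (hψ : FiniteDimensional ℝ (LinearMap.range ψ)) :
    finiteRankTrace (φ + ψ) = finiteRankTrace φ + finiteRankTrace ψ := by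
  have h1 : LinearMap.range φ ≤ LinearMap.range φ ⊔ LinearMap.range ψ := le_sup_left
  have h2 : LinearMap.range ψ ≤ LinearMap.range φ ⊔ LinearMap.range ψ := le_sup_right
  have h3 : LinearMap.range (φ + ψ) ≤ LinearMap.range φ ⊔ LinearMap.range ψ :=
    LinearMap.range_add_le φ ψ
  rw [finiteRankTrace_eq_of_range_le h1, finiteRankTrace_eq_of_range_le h2,
    finiteRankTrace_eq_of_range_le h3, ← map_add]
  rfl

/-- A finite sum of operators of finite rank has finite rank, and the trace is additive. -/
theorem finiteRankTrace_sum {κ : Type*} (s : Finset κ) (φ : κ → Module.End ℝ V)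
    (h : ∀ k ∈ s, FiniteDimensional ℝ (LinearMap.range (φ k))) :
    FiniteDimensional ℝ (LinearMap.range (∑ k ∈ s, φ k)) ∧
      finiteRankTrace (∑ k ∈ s, φ k) = ∑ k ∈ s, finiteRankTrace (φ k) := by
  classical
  induction s using Finset.induction_on with
  | empty =>
    have h0 : (∑ k ∈ (∅ : Finset κ), φ k) =
        (0 : (⊥ : Submodule ℝ V) →ₗ[ℝ] V) ∘ₗ (0 : V →ₗ[ℝ] (⊥ : Submodule ℝ V)) := by
      rw [Finset.sum_empty, LinearMap.zero_comp]
    have h1 : ∀ ψ : Module.End ℝ V, ψ = (0 : (⊥ : Submodule ℝ V) →ₗ[ℝ] V) ∘ₗ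
        (0 : V →ₗ[ℝ] (⊥ : Submodule ℝ V)) →
        FiniteDimensional ℝ (LinearMap.range ψ) ∧ finiteRankTrace ψ = 0 := by
      rintro _ rfl
      refine ⟨finiteDimensional_range_comp _ _, ?_⟩
      rw [finiteRankTrace_comp, LinearMap.comp_zero, map_zero]
    exact h1 _ h0
  | insert a s ha ih =>
    have ih' := ih fun k hk => h k (Finset.mem_insert_of_mem hk)
    have h1 := h a (Finset.mem_insert_self a s)
    have h2 := ih'.1
    rw [Finset.sum_insert ha, Finset.sum_insert ha]
    refine ⟨Submodule.finiteDimensional_of_le (LinearMap.range_add_le _ _), ?_⟩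
    rw [finiteRankTrace_add h1 h2, ih'.2]

/-- If an extension `ψ` of `φ₁` maps all of `V` into `V₁`, the trace of the pair `(φ₀, φ₁)` is the
trace of `ψ - φ₀`: two extensions of `φ₁` differ by an operator that factors through `V / V₁`, and
its trace is accounted for by the trace on the quotient. -/
theorem pairTrace_eq_finiteRankTrace {V₁ : Submodule ℝ V} [FiniteDimensional ℝ (V ⧸ V₁)]
    (φ₀ ψ : Module.End ℝ V) (φ₁ : Module.End ℝ V₁) (hψ : ∀ x : V₁, ψ (x : V) = φ₁ x)
    (hV : ∀ x, ψ x ∈ V₁) (hfr : FiniteDimensional ℝ (LinearMap.range (ψ - φ₀))) :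
    pairTrace (V₀ := (⊤ : Submodule ℝ V)) (Submodule.topEquiv.symm.conj φ₀) φ₁ =
      finiteRankTrace (ψ - φ₀) := by
  have hne : Nonempty (PairExtension (V₀ := (⊤ : Submodule ℝ V))
      (Submodule.topEquiv.symm.conj φ₀) φ₁) := ⟨⟨φ₀, ψ, fun x => rfl, hψ, hfr⟩⟩
  rw [pairTrace, dif_pos hne]
  generalize hne.some = e
  have h0 : e.ext₀ = φ₀ := LinearMap.ext fun x => e.ext₀_apply ⟨x, trivial⟩
  have hker : V₁ ≤ LinearMap.ker (e.ext₁ - ψ) := by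
    intro x hx
    rw [LinearMap.mem_ker, LinearMap.sub_apply, e.ext₁_apply ⟨x, hx⟩, hψ ⟨x, hx⟩, sub_self]
  have hfac : e.ext₁ - ψ = V₁.liftQ (e.ext₁ - ψ) hker ∘ₗ V₁.mkQ := (V₁.liftQ_mkQ _ hker).symm
  have hq1 : e.quot₁ = V₁.mkQ ∘ₗ V₁.liftQ (e.ext₁ - ψ) hker := by
    apply Submodule.linearMap_qext
    ext x
    simp only [PairExtension.quot₁, LinearMap.comp_apply, Submodule.mkQ_apply, Submodule.mapQ_apply,
      Submodule.liftQ_apply, LinearMap.sub_apply, Submodule.Quotient.mk_sub]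
    rw [(Submodule.Quotient.mk_eq_zero V₁).2 (hV x), sub_zero]
  have hq0 : LinearMap.trace ℝ (V ⧸ (⊤ : Submodule ℝ V)) e.quot₀ = 0 := by
    have : e.quot₀ = 0 := Subsingleton.elim _ _
    rw [this, map_zero]
  have hsum : e.ext₁ - e.ext₀ = (e.ext₁ - ψ) + (ψ - φ₀) := by rw [h0]; abel
  rw [PairExtension.pairTrace, hq0, hsum, finiteRankTrace_add _ hfr, hq1]
  · nth_rewrite 1 [hfac]
    rw [finiteRankTrace_comp]
    ring
  · rw [hfac]
    exact finiteDimensional_range_comp _ _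

/-- `φ₁ ^ n - φ₀ ^ n` telescopes when `φ₁ - φ₀ = B ∘ A`. -/
theorem pow_sub_pow_eq_sum (φ₀ φ₁ : Module.End ℝ V) (n : ℕ) :
    φ₁ ^ (n + 1) - φ₀ ^ (n + 1) =
      ∑ x ∈ Finset.HasAntidiagonal.antidiagonal n, φ₁ ^ x.1 * (φ₁ - φ₀) * φ₀ ^ x.2 := by
  induction n with
  | zero => simp
  | succ n ih =>
    rw [Finset.Nat.sum_antidiagonal_succ']
    simp only [pow_succ φ₀, ← mul_assoc, ← Finset.sum_mul, ← ih, pow_zero, mul_one]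
    rw [mul_sub, sub_mul, ← pow_succ, pow_succ φ₁ (n + 1)]
    abel

/-- The recursion behind `det_eq_zetaSeries_finiteRankTrace`: comparing the coefficient sums of
`(1 - z φ₀)⁻¹ (1 - z φ₁)⁻¹` with the derivative of `z (1 - z φ₀)⁻¹`. -/
theorem sum_pow_mul_pow_eq (φ₀ φ₁ : Module.End ℝ V) (n : ℕ) :
    ∑ x ∈ Finset.HasAntidiagonal.antidiagonal (n + 1), φ₀ ^ x.2 * φ₁ ^ x.1 =
      ((n : ℝ) + 2) • φ₀ ^ (n + 1) + ∑ x ∈ Finset.HasAntidiagonal.antidiagonal n,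
        (∑ y ∈ Finset.HasAntidiagonal.antidiagonal x.1, φ₀ ^ y.2 * φ₁ ^ y.1) *
          (φ₁ - φ₀) * φ₀ ^ x.2 := by
  induction n with
  | zero =>
    simp [two_smul, Finset.Nat.sum_antidiagonal_succ]
  | succ n ih =>
    rw [Finset.Nat.sum_antidiagonal_succ]
    have h1 : ∑ p ∈ Finset.HasAntidiagonal.antidiagonal (n + 1), φ₀ ^ p.2 * φ₁ ^ (p.1 + 1) =
        (∑ x ∈ Finset.HasAntidiagonal.antidiagonal (n + 1), φ₀ ^ x.2 * φ₁ ^ x.1) *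
          (φ₁ - φ₀) + (∑ x ∈ Finset.HasAntidiagonal.antidiagonal (n + 1),
            φ₀ ^ x.2 * φ₁ ^ x.1) * φ₀ := by
      rw [← mul_add, sub_add_cancel, Finset.sum_mul]
      exact Finset.sum_congr rfl fun x _ => by rw [pow_succ, mul_assoc]
    have h2 := Finset.Nat.sum_antidiagonal_succ' (n := n) (f := fun x : ℕ × ℕ =>
      (∑ y ∈ Finset.HasAntidiagonal.antidiagonal x.1, φ₀ ^ y.2 * φ₁ ^ y.1) *
          (φ₁ - φ₀) * φ₀ ^ x.2)
    simp only [pow_succ φ₀ (_ : ℕ), pow_zero, mul_one] at h2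
    have h3 : ∑ x ∈ Finset.HasAntidiagonal.antidiagonal n,
        (∑ y ∈ Finset.HasAntidiagonal.antidiagonal x.1, φ₀ ^ y.2 * φ₁ ^ y.1) *
          (φ₁ - φ₀) * (φ₀ ^ x.2 * φ₀) = (∑ x ∈ Finset.HasAntidiagonal.antidiagonal n,
        (∑ y ∈ Finset.HasAntidiagonal.antidiagonal x.1, φ₀ ^ y.2 * φ₁ ^ y.1) *
          (φ₁ - φ₀) * φ₀ ^ x.2) * φ₀ := by
      rw [Finset.sum_mul]
      exact Finset.sum_congr rfl fun x _ => by rw [← mul_assoc]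
    rw [h2, h3, h1]
    nth_rewrite 2 [ih]
    rw [add_mul, smul_mul_assoc, ← pow_succ]
    push_cast
    simp only [pow_zero, mul_one]
    module

/-- The powers of two operators that differ by a finite rank operator `B ∘ A` differ by an operator
of finite rank, whose trace is computed on the finite-dimensional space in the middle. -/
theorem finiteRankTrace_pow_sub {φ₀ φ₁ : Module.End ℝ V} {B : E →ₗ[ℝ] V}
    {A : V →ₗ[ℝ] E} (h : φ₁ - φ₀ = B ∘ₗ A) (n : ℕ) :
    FiniteDimensional ℝ (LinearMap.range (φ₁ ^ (n + 1) - φ₀ ^ (n + 1))) ∧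
    finiteRankTrace (φ₁ ^ (n + 1) - φ₀ ^ (n + 1)) =
      ∑ x ∈ Finset.HasAntidiagonal.antidiagonal n,
        LinearMap.trace ℝ E (A ∘ₗ (φ₀ ^ x.2 * φ₁ ^ x.1 : Module.End ℝ V) ∘ₗ B) := by
  have key : ∀ x : ℕ × ℕ, φ₁ ^ x.1 * (φ₁ - φ₀) * φ₀ ^ x.2 =
      ((φ₁ ^ x.1 : Module.End ℝ V) ∘ₗ B) ∘ₗ (A ∘ₗ (φ₀ ^ x.2 : Module.End ℝ V)) := by
    intro x
    rw [h]
    rfl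
  rw [pow_sub_pow_eq_sum]
  have hs := finiteRankTrace_sum (Finset.HasAntidiagonal.antidiagonal n)
    (fun x => φ₁ ^ x.1 * (φ₁ - φ₀) * φ₀ ^ x.2) fun x _ => by
      rw [key]
      exact finiteDimensional_range_comp _ _
  refine ⟨hs.1, hs.2.trans (Finset.sum_congr rfl fun x _ => ?_)⟩
  rw [key, finiteRankTrace_comp]
  rfl

/-- The determinant of a pair whose members differ by a finite rank operator `B ∘ A` is the
determinant of `1 - z A (1 - z φ₀)⁻¹ B`. -/
theorem det_eq_zetaSeries_finiteRankTrace {ι : Type*} [Fintype ι] [DecidableEq ι]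
    {φ₀ φ₁ : Module.End ℝ V} {B : (ι → ℝ) →ₗ[ℝ] V}
    {A : V →ₗ[ℝ] (ι → ℝ)} (h : φ₁ - φ₀ = B ∘ₗ A) :
    (1 - (PowerSeries.X : PowerSeries ℝ) • matrixSeries fun n =>
      LinearMap.toMatrix' (A ∘ₗ (φ₀ ^ n : Module.End ℝ V) ∘ₗ B)).det =
      zetaSeries fun n => -finiteRankTrace (φ₁ ^ n - φ₀ ^ n) := by
  let P : ℕ → ((ι → ℝ) →ₗ[ℝ] (ι → ℝ)) := fun n =>
    ∑ x ∈ Finset.HasAntidiagonal.antidiagonal n, A ∘ₗ (φ₀ ^ x.2 * φ₁ ^ x.1 : Module.End ℝ V) ∘ₗ B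
  have hP : ∀ n, P n = A ∘ₗ (∑ x ∈ Finset.HasAntidiagonal.antidiagonal n, φ₀ ^ x.2 * φ₁ ^ x.1) ∘ₗ B := by
    intro n
    refine LinearMap.ext fun v => ?_
    simp [P]
  refine det_one_sub_matrixSeries (P := fun n => LinearMap.toMatrix' (P n)) ?_ (fun n => ?_)
    fun n => ?_
  · simp [P]
  · simp only [← LinearMap.toMatrix'_mul, ← map_sum, ← map_smul, ← map_add]
    congr 1
    rw [hP, sum_pow_mul_pow_eq, h]
    refine LinearMap.ext fun v => ?_
    simp only [hP, LinearMap.comp_apply, LinearMap.add_apply, LinearMap.smul_apply, map_add,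
      map_smul, LinearMap.sum_apply, map_sum, Module.End.mul_apply]
  · rw [(finiteRankTrace_pow_sub h n).2, ← map_sum, LinearMap.trace_eq_matrix_trace ℝ (Pi.basisFun ℝ ι),
      LinearMap.toMatrix_eq_toMatrix']

end FiniteRank

namespace PMMap

variable (F : PMMap)

/-! ### The trace of the pair `(εF_{#0}, εF_{#1})` -/

/-- The index of the component of `Ω` that contains `x`. -/
def idx (x : F.Sp) : Fin F.m := x.2.choose

theorem idx_mem (x : F.Sp) : (x : ℝ) ∈ Icc (F.a (F.idx x)) (F.b (F.idx x)) := x.2.choose_spec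

theorem idx_eq_of_mem {x : F.Sp} {i : Fin F.m} (h : (x : ℝ) ∈ Icc (F.a i) (F.b i)) :
    F.idx x = i := by
  have h' := F.idx_mem x
  rcases lt_trichotomy (F.idx x) i with hlt | heq | hlt
  · exact absurd (F.b_lt_a _ _ hlt) (not_lt.2 (h.1.trans h'.2))
  · exact heq
  · exact absurd (F.b_lt_a _ _ hlt) (not_lt.2 (h'.1.trans h.2))

/-- The left end point of the `i`-th component of `Ω`. -/
def leftPt (i : Fin F.m) : F.Sp := ⟨F.a i, i, left_mem_Icc.2 (F.a_lt_b i).le⟩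

/-- The right end point of the `i`-th component of `Ω`. -/
def rightPt (i : Fin F.m) : F.Sp := ⟨F.b i, i, right_mem_Icc.2 (F.a_lt_b i).le⟩

@[simp] theorem idx_leftPt (i : Fin F.m) : F.idx (F.leftPt i) = i :=
  F.idx_eq_of_mem (left_mem_Icc.2 (F.a_lt_b i).le)

@[simp] theorem idx_rightPt (i : Fin F.m) : F.idx (F.rightPt i) = i :=
  F.idx_eq_of_mem (right_mem_Icc.2 (F.a_lt_b i).le)

theorem leftPt_mem (i : Fin F.m) : F.leftPt i ∈ F.C := F.boundary_subset _ ⟨i, Or.inl rfl⟩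

theorem rightPt_mem (i : Fin F.m) : F.rightPt i ∈ F.C := F.boundary_subset _ ⟨i, Or.inr rfl⟩

theorem leftPt_le {i : Fin F.m} {x : F.Sp} (h : F.idx x = i) : F.leftPt i ≤ x := by
  subst h
  exact (F.idx_mem x).1

theorem le_rightPt {i : Fin F.m} {x : F.Sp} (h : F.idx x = i) : x ≤ F.rightPt i := by
  subst h
  exact (F.idx_mem x).2

theorem mem_boundary_iff {x : F.Sp} :
    x ∈ F.boundary ↔ ∃ i, x = F.leftPt i ∨ x = F.rightPt i := by
  simp only [boundary, mem_ofPred_eq, Subtype.ext_iff]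
  rfl

theorem boundary_subset_C : F.boundary ⊆ F.C := fun x hx => F.boundary_subset x hx

theorem leftPt_mem_boundary (i : Fin F.m) : F.leftPt i ∈ F.boundary :=
  F.mem_boundary_iff.2 ⟨i, Or.inl rfl⟩

theorem rightPt_mem_boundary (i : Fin F.m) : F.rightPt i ∈ F.boundary :=
  F.mem_boundary_iff.2 ⟨i, Or.inr rfl⟩

theorem finite_boundary : F.boundary.Finite := F.C.finite_toSet.subset F.boundary_subset_C

theorem idx_of_mem_Icc {x y z : F.Sp} (h : F.idx x = F.idx y) (hx : x ≤ z) (hy : z ≤ y) :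
    F.idx z = F.idx x :=
  F.idx_eq_of_mem ⟨(F.idx_mem x).1.trans hx, (show (z : ℝ) ≤ y from hy).trans
    (h ▸ (F.idx_mem y).2)⟩

theorem isClosed_idx_preimage (s : Set (Fin F.m)) : IsClosed (F.idx ⁻¹' s) := by
  have : F.idx ⁻¹' s = ⋃ i ∈ s, (fun x : F.Sp => (x : ℝ)) ⁻¹' Icc (F.a i) (F.b i) := by
    ext x
    simp only [mem_preimage, mem_iUnion]
    constructor
    · exact fun h => ⟨_, h, F.idx_mem x⟩
    · rintro ⟨i, hi, h⟩
      rwa [F.idx_eq_of_mem h]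
  rw [this]
  exact s.toFinite.isClosed_biUnion fun i _ => isClosed_Icc.preimage continuous_subtype_val

theorem isLocallyConstant_idx : IsLocallyConstant F.idx := fun s => by
  rw [← isClosed_compl_iff]
  exact F.isClosed_idx_preimage sᶜ

theorem mem_connectedComponent_iff {x y : F.Sp} :
    y ∈ connectedComponent x ↔ F.idx y = F.idx x := by
  constructor
  · intro h
    exact F.isLocallyConstant_idx.apply_eq_of_isPreconnected isPreconnected_connectedComponent h
      mem_connectedComponent
  · intro h
    have hp : IsPreconnected ((fun t : F.Sp => (t : ℝ)) ⁻¹' Icc (F.a (F.idx x)) (F.b (F.idx x))) := by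
      have hi : IsInducing fun t : F.Sp => (t : ℝ) := IsEmbedding.subtypeVal.isInducing
      rw [← hi.isPreconnected_image, image_preimage_eq_of_subset]
      · exact isPreconnected_Icc
      · exact fun t ht => ⟨⟨t, _, ht⟩, rfl⟩
    exact hp.subset_connectedComponent (F.idx_mem x) (h ▸ F.idx_mem y)

theorem MonoInterval.idx_eq {F : PMMap} {x y : F.Sp} (h : F.MonoInterval x y) :
    F.idx x = F.idx y := by
  by_contra hne
  have hxb : x ≤ F.rightPt (F.idx x) := F.le_rightPt rfl
  have hby : F.leftPt (F.idx y) ≤ y := F.leftPt_le rfl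
  have hlt : F.idx x < F.idx y := by
    rcases lt_or_gt_of_ne hne with h1 | h1
    · exact h1
    · exact absurd h.1 (not_lt.2 (show (y : ℝ) ≤ x from
        (F.idx_mem y).2.trans ((F.b_lt_a _ _ h1).le.trans (F.idx_mem x).1)))
  have hgap : F.rightPt (F.idx x) < F.leftPt (F.idx y) := F.b_lt_a _ _ hlt
  -- a point of the gap to the right of `x` lies in a component that starts after `x`
  obtain ⟨t, ht1, ht2⟩ := exists_between (show F.b (F.idx x) < F.a (F.idx y) from hgap)
  obtain ⟨w, rfl⟩ := h.2 t ⟨lt_of_le_of_lt (F.idx_mem x).2 ht1, lt_of_lt_of_le ht2 (F.idx_mem y).1⟩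
  have hw := F.idx_mem (w : F.Sp)
  have h1 : F.idx x < F.idx (w : F.Sp) := by
    by_contra hle
    rcases (not_lt.1 hle).eq_or_lt with h2 | h2
    · exact absurd ht1 (not_lt.2 (h2 ▸ hw.2))
    · exact absurd (ht1.trans_le hw.2) (not_lt.2 ((F.b_lt_a _ _ h2).le.trans (F.a_lt_b _).le))
  have h3 : (x : ℝ) < F.a (F.idx (w : F.Sp)) :=
    lt_of_le_of_lt (F.idx_mem x).2 (F.b_lt_a _ _ h1)
  obtain ⟨w', hw'⟩ := h.2 (F.a (F.idx (w : F.Sp)))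
    ⟨h3, lt_of_le_of_lt hw.1 (ht2.trans_le (F.idx_mem y).1)⟩
  exact w'.2 ((Subtype.ext hw' : (w' : F.Sp) = F.leftPt (F.idx (w : F.Sp))) ▸ F.leftPt_mem _)

theorem leftVec_leftPt (i : Fin F.m) : F.leftVec (F.leftPt i) = 0 := by
  rw [leftVec, dif_neg]
  rintro ⟨p, hp, -⟩
  exact absurd hp.1 (not_lt.2 (F.leftPt_le (hp.idx_eq.trans (F.idx_leftPt i))))

theorem exists_right_interval {x : F.Sp} (hx : x ∉ F.C) : ∃ z, F.MonoInterval x z := by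
  have hlt : x < F.rightPt (F.idx x) :=
    lt_of_le_of_ne (F.le_rightPt rfl) fun h => hx (h ▸ F.rightPt_mem _)
  have hS : (F.C.filter (x < ·)).Nonempty := ⟨_, Finset.mem_filter.2 ⟨F.rightPt_mem _, hlt⟩⟩
  set z := (F.C.filter (x < ·)).min' hS with hz
  have hzm := Finset.mem_filter.1 ((F.C.filter (x < ·)).min'_mem hS)
  have hzb : z ≤ F.rightPt (F.idx x) :=
    Finset.min'_le _ _ (Finset.mem_filter.2 ⟨F.rightPt_mem _, hlt⟩)
  refine ⟨z, hzm.2, fun t ht => ?_⟩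
  let w : F.Sp := ⟨t, F.idx x, (F.idx_mem x).1.trans ht.1.le, ht.2.le.trans hzb⟩
  have hw : w ∉ F.C := by
    intro hw
    have : z ≤ w := Finset.min'_le _ _ (Finset.mem_filter.2 ⟨hw, ht.1⟩)
    exact absurd ht.2 (not_lt.2 (show (z : ℝ) ≤ t from this))
  exact ⟨⟨w, hw⟩, rfl⟩

theorem not_mono_of_anti {x y : F.Sp} (h : F.MonoInterval x y) {s : Set F.Dom}
    (hs : F.between x y ⊆ s) (hanti : StrictAntiOn F.toFun s) : ¬ StrictMonoOn F.toFun s := by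
  intro hmono
  obtain ⟨t, ht⟩ := exists_between (show (x : ℝ) < y from h.1)
  obtain ⟨t', ht'⟩ := exists_between ht.2
  obtain ⟨w, rfl⟩ := h.2 t ht
  obtain ⟨w', rfl⟩ := h.2 t' ⟨ht.1.trans ht'.1, ht'.2⟩
  have m1 : w ∈ s := hs ht
  have m2 : w' ∈ s := hs ⟨ht.1.trans ht'.1, ht'.2⟩
  have hlt : w < w' := ht'.1
  exact lt_asymm (hmono m1 m2 hlt) (hanti m1 m2 hlt)

theorem signOn_of_anti {x y : F.Sp} (h : F.MonoInterval x y)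
    (hanti : StrictAntiOn F.toFun (F.between x y)) : F.signOn x y = -1 :=
  if_neg (F.not_mono_of_anti h Subset.rfl hanti)

theorem signOn_of_mono {x y : F.Sp} (hmono : StrictMonoOn F.toFun (F.between x y)) :
    F.signOn x y = 1 := if_pos hmono

/-- A neighbourhood of `x` in `Ω \ C` contains an interval `]z', y'[` around `x`. -/
theorem exists_between_subset_nhds {x : F.Dom} {U : Set F.Dom} (hU : U ∈ 𝓝 x) {z y : F.Sp}
    (hz : F.MonoInterval z x) (hy : F.MonoInterval x y) :
    ∃ z' y' : F.Sp, z ≤ z' ∧ y' ≤ y ∧ F.MonoInterval z' x ∧ F.MonoInterval x y' ∧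
      F.between z' y' ⊆ U := by
  rw [F.isEmbedding_val.isInducing.nhds_eq_comap] at hU
  obtain ⟨T, hT, hTU⟩ := hU
  obtain ⟨l, u, hlu, hsub⟩ := mem_nhds_iff_exists_Ioo_subset.1 hT
  have hzx : ((z : F.Sp) : ℝ) < F.val x := hz.1
  have hxy : F.val x < ((y : F.Sp) : ℝ) := hy.1
  obtain ⟨s, hs1, hs2⟩ := exists_between (max_lt hlu.1 hzx)
  obtain ⟨s', hs1', hs2'⟩ := exists_between (lt_min hlu.2 hxy)
  obtain ⟨w, rfl⟩ := hz.2 s ⟨lt_of_le_of_lt (le_max_right _ _) hs1, hs2⟩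
  obtain ⟨w', rfl⟩ := hy.2 s' ⟨hs1', lt_of_lt_of_le hs2' (min_le_right _ _)⟩
  refine ⟨w, w', (lt_of_le_of_lt (le_max_right _ _) hs1).le,
    (lt_of_lt_of_le hs2' (min_le_right _ _)).le, hz.mono hs2 ?_ le_rfl, hy.mono hs1' le_rfl ?_, ?_⟩
  · exact (lt_of_le_of_lt (le_max_right _ _) hs1).le
  · exact (lt_of_lt_of_le hs2' (min_le_right _ _)).le
  · intro v hv
    exact hTU (hsub ⟨(lt_of_le_of_lt (le_max_left _ _) hs1).trans hv.1,
      hv.2.trans (lt_of_lt_of_le hs2' (min_le_left _ _))⟩)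

theorem signAt_eq_signOn {x : F.Dom} {z : F.Sp} (h : F.MonoInterval z x) :
    F.signAt x = F.signOn z x := by
  obtain ⟨y, hy⟩ := F.exists_right_interval x.2
  have hu := h.union hy x.2
  rw [F.signOn_eq_of_subset h hu (F.between_subset le_rfl hy.1.le)]
  have hn : F.between z y ∈ 𝓝 x := by
    rw [F.isEmbedding_val.isInducing.nhds_eq_comap]
    exact ⟨Ioo (z : ℝ) y, Ioo_mem_nhds h.1 hy.1, fun _ hw => hw⟩
  rcases F.mono_or_anti hu with hm | ha
  · rw [F.signOn_of_mono hm, signAt, if_pos ⟨_, hn, hm⟩]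
  · rw [F.signOn_of_anti hu ha, signAt, if_neg]
    rintro ⟨U, hU, hmU⟩
    obtain ⟨z', y', hz', hy', hl, hr, hsub⟩ := F.exists_between_subset_nhds hU h hy
    exact F.not_mono_of_anti (hl.union hr x.2) Subset.rfl
      (ha.mono (F.between_subset hz' hy')) (hmU.mono hsub)

/-- At a point outside `C` the one-sided limits are the value. -/
theorem limits_of_not_mem {x : F.Sp} (hx : x ∉ F.C) :
    F.IsLeftLimit x (F.toFun ⟨x, hx⟩) ∧ F.IsRightLimit x (F.toFun ⟨x, hx⟩) := by
  obtain ⟨z, hz⟩ := F.exists_left_interval hx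
  obtain ⟨y, hy⟩ := F.exists_right_interval hx
  have ht := F.tendsto_of_not_mem hz hy hx
  exact ⟨ht.mono_left (comap_mono nhdsWithin_le_nhds), ht.mono_left (comap_mono nhdsWithin_le_nhds)⟩

theorem leftVec_of_not_mem {x : F.Sp} (hx : x ∉ F.C) :
    F.leftVec x = F.signAt ⟨x, hx⟩ • Finsupp.single (F.toFun ⟨x, hx⟩) 1 := by
  obtain ⟨z, hz⟩ := F.exists_left_interval hx
  rw [F.leftVec_eq hz (F.limits_of_not_mem hx).1, F.signAt_eq_signOn (x := ⟨x, hx⟩) hz]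

/-- The extension of `εF_{#1}` to `S₀(Ω)` that kills the left end points of the components. -/
def signedOneExt : Module.End ℝ (F.Sp →₀ ℝ) :=
  Finsupp.linearCombination ℝ fun x => F.potential x - F.potential (F.leftPt (F.idx x))

theorem signedOneExt_single (x : F.Sp) : F.signedOneExt (Finsupp.single x 1) =
    F.potential x - F.potential (F.leftPt (F.idx x)) := by
  simp [signedOneExt]

theorem signedOneExt_mem (v : F.Sp →₀ ℝ) : F.signedOneExt v ∈ chainsOne F.Sp := by
  induction v using Finsupp.induction_linear with
  | zero => rw [map_zero]; exact Submodule.zero_mem _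
  | add v w hv hw => rw [map_add]; exact Submodule.add_mem _ hv hw
  | single x r =>
    rw [← mul_one r, ← smul_eq_mul, ← Finsupp.smul_single, map_smul, signedOneExt_single]
    refine Submodule.smul_mem _ _ (F.potential_sub_mem (F.mem_connectedComponent_iff.2 ?_))
    rw [idx_leftPt]

theorem signedOneExt_sub {x y : F.Sp} (h : F.idx x = F.idx y) :
    F.signedOneExt (Finsupp.single y 1 - Finsupp.single x 1) = F.potential y - F.potential x := by
  rw [map_sub, signedOneExt_single, signedOneExt_single, h, sub_sub_sub_cancel_right]

theorem signedOneExt_apply (v : chainsOne F.Sp) :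
    F.signedOneExt (v : F.Sp →₀ ℝ) = F.signedOne v := by
  have h : F.IsSignedOne (F.signedOneExt.restrict fun v _ => F.signedOneExt_mem v) := by
    intro x y hxy u v hu hv h
    change F.signedOneExt (Finsupp.single y 1 - Finsupp.single x 1) = _
    rw [F.signedOneExt_sub hxy.idx_eq, F.potential_sub hxy hu hv]
  rw [← F.isSignedOne_signedOne.unique h |>.symm]
  rfl

instance : FiniteDimensional ℝ ((F.Sp →₀ ℝ) ⧸ chainsOne F.Sp) := by
  let L : (Fin F.m →₀ ℝ) →ₗ[ℝ] ((F.Sp →₀ ℝ) ⧸ chainsOne F.Sp) :=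
    (chainsOne F.Sp).mkQ ∘ₗ Finsupp.lmapDomain ℝ ℝ F.leftPt
  refine Module.Finite.of_surjective L ?_
  rw [← LinearMap.range_eq_top, LinearMap.range_comp, eq_top_iff]
  rintro q -
  obtain ⟨v, rfl⟩ := (chainsOne F.Sp).mkQ_surjective q
  refine ⟨Finsupp.lmapDomain ℝ ℝ F.leftPt (Finsupp.lmapDomain ℝ ℝ F.idx v), ⟨_, rfl⟩, ?_⟩
  rw [← sub_eq_zero, ← map_sub, Submodule.mkQ_apply, Submodule.Quotient.mk_eq_zero]
  induction v using Finsupp.induction_linear with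
  | zero => simp
  | add v w hv hw =>
    have := Submodule.add_mem _ hv hw
    simp only [map_add]
    convert this using 1
    abel
  | single x r =>
    simp only [Finsupp.lmapDomain_apply, Finsupp.mapDomain_single]
    rw [← mul_one r, ← smul_eq_mul, ← Finsupp.smul_single, ← Finsupp.smul_single, ← smul_sub]
    refine Submodule.smul_mem _ _ (single_sub_mem (F.mem_connectedComponent_iff.2 ?_))
    rw [idx_leftPt]

open Classical in
/-- The functional on `S₀(Ω)` that sums the coefficients of the points `x ≥ c` in the component of
`c`. -/
def geFun (c : F.Sp) : (F.Sp →₀ ℝ) →ₗ[ℝ] ℝ :=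
  Finsupp.linearCombination ℝ fun x => if F.idx x = F.idx c ∧ c ≤ x then (1 : ℝ) else 0

open Classical in
/-- The functional on `S₀(Ω)` that sums the coefficients of the points `x > c` in the component of
`c`. -/
def gtFun (c : F.Sp) : (F.Sp →₀ ℝ) →ₗ[ℝ] ℝ :=
  Finsupp.linearCombination ℝ fun x => if F.idx x = F.idx c ∧ c < x then (1 : ℝ) else 0

open Classical in
theorem geFun_single (c x : F.Sp) :
    F.geFun c (Finsupp.single x 1) = if F.idx x = F.idx c ∧ c ≤ x then (1 : ℝ) else 0 := by
  simp [geFun]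

open Classical in
theorem gtFun_single (c x : F.Sp) :
    F.gtFun c (Finsupp.single x 1) = if F.idx x = F.idx c ∧ c < x then (1 : ℝ) else 0 := by
  simp [gtFun]

/-- The potential of `x` relative to the left end of its component, as `ε(x-) F(x-)` plus the jumps
at the points of `C` to the left of `x`. -/
theorem potential_sub_leftPt (x : F.Sp) :
    F.potential x - F.potential (F.leftPt (F.idx x)) =
      F.leftVec x + ∑ c ∈ F.C,
        F.gtFun c (Finsupp.single x 1) • (F.leftVec c - F.rightVec c) := by
  classical
  rw [potential, potential, leftVec_leftPt, zero_add, add_sub_assoc]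
  congr 1
  rw [Finset.sum_filter, Finset.sum_filter, ← Finset.sum_sub_distrib]
  refine Finset.sum_congr rfl fun c _ => ?_
  rw [gtFun_single]
  by_cases h1 : c < x
  · by_cases h2 : c < F.leftPt (F.idx x)
    · rw [if_pos h1, if_pos h2, if_neg, zero_smul, sub_self]
      exact fun h => absurd h2 (not_lt.2 (F.leftPt_le h.1.symm))
    · rw [if_pos h1, if_neg h2, if_pos, one_smul, sub_zero]
      refine ⟨?_, h1⟩
      have := F.idx_of_mem_Icc (x := F.leftPt (F.idx x)) (y := x) (z := c) (by simp)
        (not_lt.1 h2) h1.le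
      rw [this, idx_leftPt]
  · have h2 : ¬ c < F.leftPt (F.idx x) := fun h => h1 (h.trans_le (F.leftPt_le rfl))
    rw [if_neg h1, if_neg h2, if_neg (fun h => h1 h.2), zero_smul, sub_zero]

/-- The functionals `geFun c` and `gtFun c`, `c ∈ C`. -/
def jumpCoords : (F.Sp →₀ ℝ) →ₗ[ℝ] (F.C ⊕ F.C → ℝ) :=
  LinearMap.pi (Sum.elim (fun c => F.geFun c) fun c => F.gtFun c)

/-- The vectors `ε(c-)F(c-)` and `-ε(c+)F(c+)`, `c ∈ C`. -/
def jumpVec : F.C ⊕ F.C → (F.Sp →₀ ℝ) :=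
  Sum.elim (fun c => F.leftVec c) fun c => -F.rightVec c

/-- `εF_{#1}` and `εF_{#0}` differ by an operator of finite rank that is carried by the one-sided
values of `F` at the points of `C`. -/
theorem signedOneExt_sub_signedZero :
    F.signedOneExt - F.signedZero = Fintype.linearCombination ℝ F.jumpVec ∘ₗ F.jumpCoords := by
  classical
  refine Finsupp.lhom_ext' fun x => LinearMap.ext_ring ?_
  have hz : F.signedZero (Finsupp.single x 1) =
      if h : x ∉ F.C then F.signAt ⟨x, h⟩ • Finsupp.single (F.toFun ⟨x, h⟩) (1 : ℝ) else 0 := by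
    simp [signedZero]
  have hrhs : Fintype.linearCombination ℝ F.jumpVec (F.jumpCoords (Finsupp.single x 1)) =
      ∑ c ∈ F.C, (F.geFun c (Finsupp.single x 1) • F.leftVec c -
        F.gtFun c (Finsupp.single x 1) • F.rightVec c) := by
    rw [Fintype.linearCombination_apply, Fintype.sum_sum_type, ← Finset.sum_coe_sort F.C,
      ← Finset.sum_add_distrib]
    refine Finset.sum_congr rfl fun c _ => ?_
    simp [jumpVec, jumpCoords, sub_eq_add_neg]
  simp only [LinearMap.comp_apply, Finsupp.lsingle_apply, LinearMap.sub_apply]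
  rw [hrhs, signedOneExt_single, potential_sub_leftPt, hz]
  by_cases hx : x ∈ F.C
  · rw [dif_neg (not_not.2 hx), sub_zero, ← Finset.add_sum_erase _ _ hx,
      ← Finset.add_sum_erase _ _ hx, ← add_assoc]
    congr 1
    · rw [gtFun_single, geFun_single, if_neg (fun h => lt_irrefl _ h.2), if_pos ⟨rfl, le_rfl⟩]
      simp
    · refine Finset.sum_congr rfl fun c hc => ?_
      have hne := (Finset.mem_erase.1 hc).1
      have : F.geFun c (Finsupp.single x 1) = F.gtFun c (Finsupp.single x 1) := by
        rw [gtFun_single, geFun_single]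
        simp only [le_iff_lt_or_eq, hne, or_false]
      rw [this, smul_sub]
  · rw [dif_pos hx, F.leftVec_of_not_mem hx, add_sub_cancel_left]
    refine Finset.sum_congr rfl fun c hc => ?_
    have hne : c ≠ x := fun h => hx (h ▸ hc)
    have : F.geFun c (Finsupp.single x 1) = F.gtFun c (Finsupp.single x 1) := by
      rw [gtFun_single, geFun_single]
      simp only [le_iff_lt_or_eq, hne, or_false]
    rw [this, smul_sub]

theorem topEquiv_conj_pow {V : Type*} [AddCommGroup V] [Module ℝ V] (φ : Module.End ℝ V) (n : ℕ) :
    ((Submodule.topEquiv (R := ℝ) (M := V)).symm.conj φ) ^ n =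
      (Submodule.topEquiv (R := ℝ) (M := V)).symm.conj (φ ^ n) := by
  induction n with
  | zero => rfl
  | succ n ih => rw [pow_succ, pow_succ, ih]; rfl

/-- As `signedOneExt` maps everything into `S₁(Ω)` and `V₀` is the whole space, the two quotient
traces in the trace of the pair vanish. -/
theorem pairTrace_pow (n : ℕ) :
    pairTrace (V₀ := (⊤ : Submodule ℝ (F.Sp →₀ ℝ))) (V₁ := chainsOne F.Sp)
      (Submodule.topEquiv.symm.conj F.signedZero ^ (n + 1)) (F.signedOne ^ (n + 1)) =
      finiteRankTrace (F.signedOneExt ^ (n + 1) - F.signedZero ^ (n + 1)) := by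
  rw [topEquiv_conj_pow]
  refine pairTrace_eq_finiteRankTrace _ _ _ (fun x => ?_) (fun x => ?_)
    (finiteRankTrace_pow_sub F.signedOneExt_sub_signedZero n).1
  · induction n + 1 generalizing x with
    | zero => rfl
    | succ n ih =>
      rw [pow_succ, pow_succ, Module.End.mul_apply, Module.End.mul_apply, signedOneExt_apply, ih]
  · rw [pow_succ', Module.End.mul_apply]
    exact F.signedOneExt_mem _

/-- The trace of the pair `(εF_{#0}, εF_{#1})`. -/
theorem pairTrace_eq :
    pairTrace (V₀ := (⊤ : Submodule ℝ (F.Sp →₀ ℝ))) (V₁ := chainsOne F.Sp)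
      (Submodule.topEquiv.symm.conj F.signedZero) F.signedOne =
      ∑ c ∈ F.C, (F.geFun c (F.leftVec c) - F.gtFun c (F.rightVec c)) := by
  classical
  have h := F.pairTrace_pow 0
  rw [zero_add, pow_one, pow_one, pow_one, pow_one, signedOneExt_sub_signedZero,
    finiteRankTrace_comp, LinearMap.trace_eq_matrix_trace ℝ (Pi.basisFun ℝ _),
    LinearMap.toMatrix_eq_toMatrix', Matrix.trace, Fintype.sum_sum_type,
    ← Finset.sum_add_distrib] at h
  rw [h, ← Finset.sum_coe_sort F.C]
  refine Finset.sum_congr rfl fun c _ => ?_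
  simp [LinearMap.toMatrix'_apply, jumpVec, jumpCoords, Fintype.linearCombination_apply_single, sub_eq_add_neg]

/-- The lattice of the integral vectors of `S₀(Ω)`. -/
def integralVectors : AddSubgroup (F.Sp →₀ ℝ) :=
  AddSubgroup.closure (range fun x => Finsupp.single x (1 : ℝ))

theorem single_mem_integralVectors (x : F.Sp) : Finsupp.single x (1 : ℝ) ∈ F.integralVectors :=
  AddSubgroup.subset_closure ⟨x, rfl⟩

theorem signOn_smul_mem {x y : F.Sp} {v : F.Sp →₀ ℝ} (hv : v ∈ F.integralVectors) :
    F.signOn x y • v ∈ F.integralVectors := by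
  unfold signOn
  split_ifs
  · rwa [one_smul]
  · rw [neg_one_smul]
    exact neg_mem hv

theorem leftVec_mem_integralVectors (x : F.Sp) : F.leftVec x ∈ F.integralVectors := by
  unfold leftVec
  split_ifs
  · exact F.signOn_smul_mem (F.single_mem_integralVectors _)
  · exact zero_mem _

theorem rightVec_mem_integralVectors (x : F.Sp) : F.rightVec x ∈ F.integralVectors := by
  unfold rightVec
  split_ifs
  · exact F.signOn_smul_mem (F.single_mem_integralVectors _)
  · exact zero_mem _

theorem signedZero_mem_integralVectors {v : F.Sp →₀ ℝ} (hv : v ∈ F.integralVectors) :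
    F.signedZero v ∈ F.integralVectors := by
  induction hv using AddSubgroup.closure_induction with
  | mem v hv =>
    obtain ⟨x, rfl⟩ := hv
    by_cases hx : x ∈ F.C
    · simp [signedZero, hx, zero_mem]
    · have : F.signedZero (Finsupp.single x 1) = F.leftVec x := by
        rw [F.leftVec_of_not_mem hx]
        simp [signedZero, hx]
      rw [this]
      exact F.leftVec_mem_integralVectors x
  | zero => rw [map_zero]; exact zero_mem _
  | add v w _ _ hv hw => rw [map_add]; exact add_mem hv hw
  | neg v _ hv => rw [map_neg]; exact neg_mem hv

theorem signedZero_pow_mem_integralVectors (n : ℕ) {v : F.Sp →₀ ℝ} (hv : v ∈ F.integralVectors) :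
    (F.signedZero ^ n) v ∈ F.integralVectors := by
  induction n with
  | zero => exact hv
  | succ n ih =>
    rw [pow_succ', Module.End.mul_apply]
    exact F.signedZero_mem_integralVectors ih

theorem exists_int_of_mem_integralVectors {L : (F.Sp →₀ ℝ) →ₗ[ℝ] ℝ}
    (hL : ∀ x, ∃ k : ℤ, L (Finsupp.single x 1) = k) {v : F.Sp →₀ ℝ}
    (hv : v ∈ F.integralVectors) : ∃ k : ℤ, L v = k := by
  induction hv using AddSubgroup.closure_induction with
  | mem v hv =>
    obtain ⟨x, rfl⟩ := hv
    exact hL x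
  | zero => exact ⟨0, by simp⟩
  | add v w _ _ hv hw =>
    obtain ⟨k, hk⟩ := hv
    obtain ⟨l, hl⟩ := hw
    exact ⟨k + l, by rw [map_add, hk, hl]; push_cast; rfl⟩
  | neg v _ hv =>
    obtain ⟨k, hk⟩ := hv
    exact ⟨-k, by rw [map_neg, hk]; push_cast; rfl⟩

theorem kneadingDet_eq_zetaSeries :
    F.kneadingDet = zetaSeries fun n => -finiteRankTrace (F.signedOneExt ^ n - F.signedZero ^ n) :=
  zetaSeries_congr fun n => congrArg Neg.neg (F.pairTrace_pow n)

/-- The kneading determinant is the determinant of a matrix of power series with integer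
coefficients. -/
theorem exists_int_kneadingDet : ∃ D : PowerSeries ℤ, PowerSeries.constantCoeff D = 1 ∧
    PowerSeries.map (algebraMap ℤ ℝ) D = F.kneadingDet := by
  classical
  rw [kneadingDet_eq_zetaSeries, ← det_eq_zetaSeries_finiteRankTrace F.signedOneExt_sub_signedZero]
  refine exists_int_det_one_sub_matrixSeries fun n i j => ?_
  rw [LinearMap.toMatrix'_apply]
  simp only [LinearMap.comp_apply]
  have hB : Fintype.linearCombination ℝ F.jumpVec (Pi.single j 1) ∈ F.integralVectors := by
    rw [Fintype.linearCombination_apply_single, one_smul]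
    rcases j with c | c
    · exact F.leftVec_mem_integralVectors c
    · exact neg_mem (F.rightVec_mem_integralVectors c)
  have hv := F.signedZero_pow_mem_integralVectors n hB
  rcases i with c | c
  · refine F.exists_int_of_mem_integralVectors (L := F.geFun c) (fun x => ?_) hv
    rw [geFun_single]
    split_ifs
    exacts [⟨1, by simp⟩, ⟨0, by simp⟩]
  · refine F.exists_int_of_mem_integralVectors (L := F.gtFun c) (fun x => ?_) hv
    rw [gtFun_single]
    split_ifs
    exacts [⟨1, by simp⟩, ⟨0, by simp⟩]

end PMMap

namespace PMMap

variable (F : PMMap)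

/-! ### Laps -/

/-- `]c, d[` is a lap of `F`: a component of `Ω \ C`, with end points `c`, `d` in `C`. -/
def IsLap (c d : F.Sp) : Prop := c ∈ F.C ∧ d ∈ F.C ∧ F.MonoInterval c d

theorem exists_lap_right {x : F.Sp} (hx : x < F.rightPt (F.idx x)) :
    ∃ d ∈ F.C, F.MonoInterval x d := by
  have hS : (F.C.filter (x < ·)).Nonempty := ⟨_, Finset.mem_filter.2 ⟨F.rightPt_mem _, hx⟩⟩
  set z := (F.C.filter (x < ·)).min' hS with hz
  have hzm := Finset.mem_filter.1 ((F.C.filter (x < ·)).min'_mem hS)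
  have hzb : z ≤ F.rightPt (F.idx x) :=
    Finset.min'_le _ _ (Finset.mem_filter.2 ⟨F.rightPt_mem _, hx⟩)
  refine ⟨z, hzm.1, hzm.2, fun t ht => ?_⟩
  let w : F.Sp := ⟨t, F.idx x, (F.idx_mem x).1.trans ht.1.le, ht.2.le.trans hzb⟩
  have hw : w ∉ F.C := by
    intro hw
    have : z ≤ w := Finset.min'_le _ _ (Finset.mem_filter.2 ⟨hw, ht.1⟩)
    exact absurd ht.2 (not_lt.2 (show (z : ℝ) ≤ t from this))
  exact ⟨⟨w, hw⟩, rfl⟩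

theorem exists_lap_left {x : F.Sp} (hx : F.leftPt (F.idx x) < x) :
    ∃ c ∈ F.C, F.MonoInterval c x := by
  have hS : (F.C.filter (· < x)).Nonempty := ⟨_, Finset.mem_filter.2 ⟨F.leftPt_mem _, hx⟩⟩
  set z := (F.C.filter (· < x)).max' hS with hz
  have hzm := Finset.mem_filter.1 ((F.C.filter (· < x)).max'_mem hS)
  have hzb : F.leftPt (F.idx x) ≤ z :=
    Finset.le_max' _ _ (Finset.mem_filter.2 ⟨F.leftPt_mem _, hx⟩)
  refine ⟨z, hzm.1, hzm.2, fun t ht => ?_⟩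
  let w : F.Sp := ⟨t, F.idx x, (show F.a (F.idx x) ≤ z from hzb).trans ht.1.le,
    ht.2.le.trans (F.idx_mem x).2⟩
  have hw : w ∉ F.C := by
    intro hw
    have : w ≤ z := Finset.le_max' _ _ (Finset.mem_filter.2 ⟨hw, ht.2⟩)
    exact absurd ht.1 (not_lt.2 (show t ≤ z from this))
  exact ⟨⟨w, hw⟩, rfl⟩

theorem leftPt_lt {x : F.Sp} (hx : x ≠ F.leftPt (F.idx x)) : F.leftPt (F.idx x) < x :=
  lt_of_le_of_ne (F.leftPt_le rfl) hx.symm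

theorem lt_rightPt {x : F.Sp} (hx : x ≠ F.rightPt (F.idx x)) : x < F.rightPt (F.idx x) :=
  lt_of_le_of_ne (F.le_rightPt rfl) hx

theorem exists_isLap (x : F.Dom) : ∃ c d : F.Sp, F.IsLap c d ∧ x ∈ F.between c d := by
  obtain ⟨c, hc, h1⟩ := F.exists_lap_left (F.leftPt_lt (x := (x : F.Sp)) fun h => x.2 (h ▸ F.leftPt_mem _))
  obtain ⟨d, hd, h2⟩ := F.exists_lap_right (F.lt_rightPt (x := (x : F.Sp)) fun h => x.2 (h ▸ F.rightPt_mem _))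
  exact ⟨c, d, ⟨hc, hd, h1.union h2 x.2⟩, h1.1, h2.1⟩

variable {F} in
/-- No point of `C` lies inside an interval of monotonicity. -/
theorem MonoInterval.not_mem {x y c : F.Sp} (h : F.MonoInterval x y) (hx : x < c) (hy : c < y) :
    c ∉ F.C := by
  obtain ⟨w, hw⟩ := h.2 c ⟨hx, hy⟩
  exact (Subtype.ext hw : (w : F.Sp) = c) ▸ w.2

variable {F} in
theorem IsLap.right_unique {c d d' : F.Sp} (h : F.IsLap c d) (h' : F.IsLap c d') : d = d' := by
  rcases lt_trichotomy d d' with h1 | h1 | h1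
  · exact absurd h.2.1 (h'.2.2.not_mem h.2.2.1 h1)
  · exact h1
  · exact absurd h'.2.1 (h.2.2.not_mem h'.2.2.1 h1)

variable {F} in
theorem IsLap.left_unique {c c' d : F.Sp} (h : F.IsLap c d) (h' : F.IsLap c' d) : c = c' := by
  rcases lt_trichotomy c c' with h1 | h1 | h1
  · exact absurd h'.1 (h.2.2.not_mem h1 h'.2.2.1)
  · exact h1
  · exact absurd h.1 (h'.2.2.not_mem h1 h.2.2.1)

theorem injOn_between {x y : F.Sp} (h : F.MonoInterval x y) :
    InjOn F.toFun (F.between x y) := by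
  rcases F.mono_or_anti h with H | H
  exacts [H.injOn, H.injOn]

/-- The left end point of the lap of `x`. -/
def lapLeft (x : F.Dom) : F.Sp := (F.exists_isLap x).choose

theorem exists_isLap_lapLeft (x : F.Dom) :
    ∃ d, F.IsLap (F.lapLeft x) d ∧ x ∈ F.between (F.lapLeft x) d :=
  (F.exists_isLap x).choose_spec

theorem finite_fiber (y : F.Sp) : {x : F.Dom | F.toFun x = y}.Finite := by
  refine Set.Finite.of_injOn (f := F.lapLeft) (t := F.C) (fun x _ => ?_) (fun x hx x' hx' he => ?_)
    F.C.finite_toSet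
  · obtain ⟨d, h, -⟩ := F.exists_isLap_lapLeft x
    exact h.1
  · obtain ⟨d, h1, h2⟩ := F.exists_isLap_lapLeft x
    obtain ⟨d', h1', h2'⟩ := F.exists_isLap_lapLeft x'
    rw [← he] at h1' h2'
    rw [h1'.right_unique h1] at h2'
    exact F.injOn_between h1.2.2 h2 h2' (Eq.trans hx (Eq.symm hx'))

/-! ### Iterates of a piecewise monotone map -/

open Classical in
/-- The extension of `F` to a self-map of `Ω` that is the identity on `C`; an orbit that meets `C`
stays there. -/
def hat (x : F.Sp) : F.Sp := if h : x ∉ F.C then F.toFun ⟨x, h⟩ else x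

theorem hat_of_mem {x : F.Sp} (h : x ∈ F.C) : F.hat x = x := dif_neg (not_not.2 h)

theorem hat_of_not_mem {x : F.Sp} (h : x ∉ F.C) : F.hat x = F.toFun ⟨x, h⟩ := dif_pos h

theorem hat_coe (w : F.Dom) : F.hat w = F.toFun w := F.hat_of_not_mem w.2

theorem hat_iterate_of_mem {x : F.Sp} (h : x ∈ F.C) (n : ℕ) : F.hat^[n] x = x :=
  Function.iterate_fixed (F.hat_of_mem h) n

/-- The points at which the `(n + 1)`-st iterate of `F` is not defined. -/
def iterCritical (n : ℕ) : Set F.Sp := {x | F.hat^[n] x ∈ F.C}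

theorem C_subset_iterCritical (n : ℕ) : (F.C : Set F.Sp) ⊆ F.iterCritical n := fun x hx => by
  change F.hat^[n] x ∈ F.C
  rwa [F.hat_iterate_of_mem hx]

theorem mem_iterCritical_succ {n : ℕ} {x : F.Sp} :
    x ∈ F.iterCritical (n + 1) ↔ F.hat x ∈ F.iterCritical n := by
  change F.hat^[n + 1] x ∈ F.C ↔ F.hat^[n] (F.hat x) ∈ F.C
  rw [Function.iterate_succ_apply]

theorem not_mem_of_not_mem_iterCritical {n : ℕ} {x : F.Sp} (h : x ∉ F.iterCritical n) :
    x ∉ F.C := fun hx => h (F.C_subset_iterCritical n hx)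

theorem finite_iterCritical (n : ℕ) : (F.iterCritical n).Finite := by
  induction n with
  | zero => exact F.C.finite_toSet
  | succ n ih =>
    have : F.iterCritical (n + 1) ⊆ (F.C : Set F.Sp) ∪
        ⋃ y ∈ F.iterCritical n, Subtype.val '' {x : F.Dom | F.toFun x = y} := by
      intro x hx
      by_cases hC : x ∈ F.C
      · exact Or.inl hC
      · refine Or.inr (mem_biUnion (F.mem_iterCritical_succ.1 hx) ⟨⟨x, hC⟩, ?_, rfl⟩)
        exact (F.hat_of_not_mem hC).symm
    exact (F.C.finite_toSet.union (ih.biUnion fun y _ => (F.finite_fiber y).image _)).subset this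

theorem continuousAt_toFun (w : F.Dom) : ContinuousAt F.toFun w := by
  obtain ⟨z, hz⟩ := F.exists_left_interval w.2
  obtain ⟨y, hy⟩ := F.exists_right_interval w.2
  have := F.tendsto_of_not_mem hz hy w.2
  rw [ContinuousAt, F.isEmbedding_val.isInducing.nhds_eq_comap]
  exact this

theorem continuous_toFun : Continuous F.toFun :=
  continuous_iff_continuousAt.2 F.continuousAt_toFun

theorem continuousAt_hat {x : F.Sp} (h : x ∉ F.C) : ContinuousAt F.hat x := by
  have ho : IsOpen {x : F.Sp | x ∉ F.C} := F.C.finite_toSet.isClosed.isOpen_compl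
  have h1 : ContinuousAt (F.hat ∘ Subtype.val) (⟨x, h⟩ : F.Dom) := by
    have : F.hat ∘ Subtype.val = F.toFun := funext F.hat_coe
    rw [this]
    exact F.continuousAt_toFun _
  exact (ho.isOpenEmbedding_subtypeVal.continuousAt_iff (x := (⟨x, h⟩ : F.Dom))).1 h1

theorem continuousAt_hat_iterate (n : ℕ) {x : F.Sp} (h : x ∉ F.iterCritical n) :
    ContinuousAt F.hat^[n + 1] x := by
  induction n generalizing x with
  | zero => exact F.continuousAt_hat h
  | succ n ih =>
    rw [Function.iterate_succ]
    exact ContinuousAt.comp (ih fun hh => h (F.mem_iterCritical_succ.2 hh))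
      (F.continuousAt_hat (F.not_mem_of_not_mem_iterCritical h))

theorem strictMonoOn_or_strictAntiOn_hat {S : Set F.Sp} (hS : IsPreconnected S)
    (hC : ∀ x ∈ S, x ∉ F.C) : StrictMonoOn F.hat S ∨ StrictAntiOn F.hat S := by
  rcases S.eq_empty_or_nonempty with rfl | ⟨x, hx⟩
  · exact Or.inl (by simp [StrictMonoOn])
  have hp : IsPreconnected ((Subtype.val : F.Dom → F.Sp) ⁻¹' S) := by
    rw [← IsEmbedding.subtypeVal.isInducing.isPreconnected_image, image_preimage_eq_of_subset]
    · exact hS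
    · exact fun y hy => ⟨⟨y, hC y hy⟩, rfl⟩
  have hsub := hp.subset_connectedComponent (x := ⟨x, hC x hx⟩) hx
  refine (F.strictMonotone ⟨x, hC x hx⟩).imp (fun H y hy z hz hyz => ?_) fun H y hy z hz hyz => ?_
  all_goals
    rw [F.hat_of_not_mem (hC y hy), F.hat_of_not_mem (hC z hz)]
    exact H (hsub hy) (hsub hz) hyz

theorem strictMonoOn_or_strictAntiOn_hat_iterate (n : ℕ) {S : Set F.Sp} (hS : IsPreconnected S)
    (hC : ∀ x ∈ S, x ∉ F.iterCritical n) :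
    StrictMonoOn F.hat^[n + 1] S ∨ StrictAntiOn F.hat^[n + 1] S := by
  induction n generalizing S with
  | zero => exact F.strictMonoOn_or_strictAntiOn_hat hS hC
  | succ n ih =>
    have hC' : ∀ x ∈ S, x ∉ F.C := fun x hx => F.not_mem_of_not_mem_iterCritical (hC x hx)
    have h1 := F.strictMonoOn_or_strictAntiOn_hat hS hC'
    have h2 := ih (S := F.hat '' S)
      (hS.image _ fun x hx => (F.continuousAt_hat (hC' x hx)).continuousWithinAt) (by
        rintro _ ⟨x, hx, rfl⟩ h
        exact hC x hx (F.mem_iterCritical_succ.2 h))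
    have hm : MapsTo F.hat S (F.hat '' S) := mapsTo_image _ _
    rw [Function.iterate_succ]
    rcases h1 with h1 | h1 <;> rcases h2 with h2 | h2
    · exact Or.inl (h2.comp h1 hm)
    · exact Or.inr (h2.comp_strictMonoOn h1 hm)
    · exact Or.inr (h2.comp_strictAntiOn h1 hm)
    · exact Or.inl (h2.comp h1 hm)

/-- The `(n + 1)`-st iterate of the piecewise monotone map `F`. -/
abbrev iter (n : ℕ) : PMMap where
  m := F.m
  a := F.a
  b := F.b
  a_lt_b := F.a_lt_b
  b_lt_a := F.b_lt_a
  C := (F.finite_iterCritical n).toFinset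
  boundary_subset x hx :=
    (F.finite_iterCritical n).mem_toFinset.2 (F.C_subset_iterCritical n (F.boundary_subset x hx))
  toFun w := F.hat^[n + 1] w
  continuousOn x := by
    refine Continuous.continuousOn (continuous_iff_continuousAt.2 fun w => ?_)
    refine ContinuousAt.comp (f := Subtype.val) (g := F.hat^[n + 1]) ?_ continuousAt_subtype_val
    exact F.continuousAt_hat_iterate n fun h => w.2 ((F.finite_iterCritical n).mem_toFinset.2 h)
  strictMonotone x := by
    have h := F.strictMonoOn_or_strictAntiOn_hat_iterate n
      (isPreconnected_connectedComponent.image (Subtype.val) continuous_subtype_val.continuousOn)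
      (S := Subtype.val '' connectedComponent x) (by
        rintro _ ⟨w, -, rfl⟩ hw
        exact w.2 ((F.finite_iterCritical n).mem_toFinset.2 hw))
    exact h.imp (fun H y hy z hz hyz => H ⟨y, hy, rfl⟩ ⟨z, hz, rfl⟩ hyz)
      fun H y hy z hz hyz => H ⟨y, hy, rfl⟩ ⟨z, hz, rfl⟩ hyz

theorem mem_iter_C {n : ℕ} {x : F.Sp} : x ∈ (F.iter n).C ↔ x ∈ F.iterCritical n :=
  (F.finite_iterCritical n).mem_toFinset

/-- A point of the domain of an iterate, as a point of the domain of `F`. -/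
def iterDom {n : ℕ} (w : (F.iter n).Dom) : F.Dom :=
  ⟨w.1, F.not_mem_of_not_mem_iterCritical fun h => w.2 (F.mem_iter_C.2 h)⟩

/-- The image under `F` of a point of the domain of `F^{n + 2}`. -/
def iterImage {n : ℕ} (w : (F.iter (n + 1)).Dom) : (F.iter n).Dom :=
  ⟨F.toFun (F.iterDom w), fun h => w.2 (F.mem_iter_C.2 (F.mem_iterCritical_succ.2 (by
    rw [← F.mem_iter_C]
    exact (F.hat_coe (F.iterDom w)).symm ▸ h)))⟩

theorem iter_succ_toFun {n : ℕ} (w : (F.iter (n + 1)).Dom) :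
    (F.iter (n + 1)).toFun w = (F.iter n).toFun (F.iterImage w) := by
  change F.hat^[n + 1 + 1] w = F.hat^[n + 1] (F.toFun (F.iterDom w))
  rw [Function.iterate_succ_apply]
  congr 1
  exact F.hat_of_not_mem (F.iterDom w).2

theorem iter_zero_toFun (w : (F.iter 0).Dom) : (F.iter 0).toFun w = F.toFun (F.iterDom w) :=
  F.hat_of_not_mem (F.iterDom w).2

theorem continuous_iterDom (n : ℕ) : Continuous (F.iterDom (n := n)) :=
  Continuous.subtype_mk continuous_subtype_val _

theorem continuous_iterImage (n : ℕ) : Continuous (F.iterImage (n := n)) :=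
  Continuous.subtype_mk (F.continuous_toFun.comp (F.continuous_iterDom _)) _

/-! #### The sign of an iterate -/

theorem signAt_of_mono {x : F.Dom} {U : Set F.Dom} (hU : U ∈ 𝓝 x) (h : StrictMonoOn F.toFun U) :
    F.signAt x = 1 := if_pos ⟨U, hU, h⟩

theorem signAt_of_anti {x : F.Dom} {U : Set F.Dom} (hU : U ∈ 𝓝 x) (h : StrictAntiOn F.toFun U) :
    F.signAt x = -1 := by
  refine if_neg ?_
  rintro ⟨U', hU', h'⟩
  obtain ⟨z, hz⟩ := F.exists_left_interval x.2
  obtain ⟨y, hy⟩ := F.exists_right_interval x.2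
  obtain ⟨z', y', -, -, hl, hr, hsub⟩ := F.exists_between_subset_nhds (inter_mem hU hU') hz hy
  exact F.not_mono_of_anti (hl.union hr x.2) Subset.rfl
    (h.mono (hsub.trans inter_subset_left)) (h'.mono (hsub.trans inter_subset_right))

theorem between_mem_nhds {x y : F.Sp} {w : F.Dom} (hw : w ∈ F.between x y) :
    F.between x y ∈ 𝓝 w := by
  rw [F.isEmbedding_val.isInducing.nhds_eq_comap]
  exact ⟨Ioo (x : ℝ) y, Ioo_mem_nhds hw.1 hw.2, fun _ hw => hw⟩

theorem exists_nhds_mono_or_anti (x : F.Dom) :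
    (∃ U ∈ 𝓝 x, StrictMonoOn F.toFun U ∧ F.signAt x = 1) ∨
      ∃ U ∈ 𝓝 x, StrictAntiOn F.toFun U ∧ F.signAt x = -1 := by
  obtain ⟨c, d, h, hx⟩ := F.exists_isLap x
  have hn := F.between_mem_nhds hx
  exact (F.mono_or_anti h.2.2).imp (fun H => ⟨_, hn, H, F.signAt_of_mono hn H⟩)
    fun H => ⟨_, hn, H, F.signAt_of_anti hn H⟩

theorem signAt_iter_succ {n : ℕ} (w : (F.iter (n + 1)).Dom) :
    (F.iter (n + 1)).signAt w = F.signAt (F.iterDom w) * (F.iter n).signAt (F.iterImage w) := by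
  have hf : (F.iter (n + 1)).toFun = (F.iter n).toFun ∘ F.iterImage :=
    funext F.iter_succ_toFun
  rcases F.exists_nhds_mono_or_anti (F.iterDom w) with ⟨U, hU, h1, e1⟩ | ⟨U, hU, h1, e1⟩ <;>
  rcases (F.iter n).exists_nhds_mono_or_anti (F.iterImage w) with ⟨W, hW, h2, e2⟩ | ⟨W, hW, h2, e2⟩
  all_goals
    have hn := inter_mem ((F.continuous_iterDom _).continuousAt.preimage_mem_nhds hU)
      ((F.continuous_iterImage _).continuousAt.preimage_mem_nhds hW)
    rw [e1, e2]
  · rw [one_mul]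
    refine (F.iter (n + 1)).signAt_of_mono hn ?_
    rw [hf]
    exact fun y hy z hz hyz => h2 hy.2 hz.2 (h1 hy.1 hz.1 hyz)
  · rw [one_mul]
    refine (F.iter (n + 1)).signAt_of_anti hn ?_
    rw [hf]
    exact fun y hy z hz hyz => h2 hy.2 hz.2 (h1 hy.1 hz.1 hyz)
  · rw [mul_one]
    refine (F.iter (n + 1)).signAt_of_anti hn ?_
    rw [hf]
    exact fun y hy z hz hyz => h2 hz.2 hy.2 (h1 hy.1 hz.1 hyz)
  · rw [neg_mul_neg, one_mul]
    refine (F.iter (n + 1)).signAt_of_mono hn ?_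
    rw [hf]
    exact fun y hy z hz hyz => h2 hz.2 hy.2 (h1 hy.1 hz.1 hyz)

theorem signedZero_of_mem {x : F.Sp} (h : x ∈ F.C) : F.signedZero (Finsupp.single x 1) = 0 := by
  simp [signedZero, h]

theorem signedZero_coe (w : F.Dom) : F.signedZero (Finsupp.single (w : F.Sp) 1) =
    F.signAt w • Finsupp.single (F.toFun w) 1 := by
  have := w.2
  simp [signedZero, this]

theorem signAt_iter_zero (w : (F.iter 0).Dom) : (F.iter 0).signAt w = F.signAt (F.iterDom w) := by
  have hf : (F.iter 0).toFun = F.toFun ∘ F.iterDom := funext F.iter_zero_toFun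
  rcases F.exists_nhds_mono_or_anti (F.iterDom w) with ⟨U, hU, h1, e1⟩ | ⟨U, hU, h1, e1⟩
  · rw [e1]
    refine (F.iter 0).signAt_of_mono ((F.continuous_iterDom _).continuousAt hU) ?_
    rw [hf]
    exact fun y hy z hz hyz => h1 hy hz hyz
  · rw [e1]
    refine (F.iter 0).signAt_of_anti ((F.continuous_iterDom _).continuousAt hU) ?_
    rw [hf]
    exact fun y hy z hz hyz => h1 hy hz hyz

theorem signedZero_iter (n : ℕ) : (F.iter n).signedZero = F.signedZero ^ (n + 1) := by
  induction n with
  | zero =>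
    refine Finsupp.lhom_ext' fun x => LinearMap.ext_ring ?_
    simp only [LinearMap.comp_apply, Finsupp.lsingle_apply, zero_add, pow_one]
    by_cases hx : x ∈ (F.iter 0).C
    · rw [(F.iter 0).signedZero_of_mem hx, F.signedZero_of_mem (x := x) (F.mem_iter_C.1 hx)]
    · have h1 := (F.iter 0).signedZero_coe ⟨x, hx⟩
      have h2 := F.signedZero_coe (F.iterDom (n := 0) ⟨x, hx⟩)
      rw [signAt_iter_zero, iter_zero_toFun] at h1
      exact h1.trans h2.symm
  | succ n ih =>
    refine Finsupp.lhom_ext' fun x => LinearMap.ext_ring ?_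
    simp only [LinearMap.comp_apply, Finsupp.lsingle_apply]
    rw [pow_succ, Module.End.mul_apply, ← ih]
    by_cases hxC : x ∈ F.C
    · rw [F.signedZero_of_mem hxC, map_zero,
        (F.iter (n + 1)).signedZero_of_mem (F.mem_iter_C.2 (F.C_subset_iterCritical _ hxC))]
    have h0 := F.signedZero_coe ⟨x, hxC⟩
    by_cases hx : x ∈ (F.iter (n + 1)).C
    · have h1 : F.toFun ⟨x, hxC⟩ ∈ (F.iter n).C := by
        rw [F.mem_iter_C, ← F.hat_of_not_mem hxC]
        exact F.mem_iterCritical_succ.1 (F.mem_iter_C.1 hx)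
      rw [(F.iter (n + 1)).signedZero_of_mem hx]
      refine Eq.symm ((congrArg _ h0).trans ?_)
      rw [map_smul, (F.iter n).signedZero_of_mem h1, smul_zero]
    · have h1 := (F.iter (n + 1)).signedZero_coe ⟨x, hx⟩
      have h2 := (F.iter n).signedZero_coe (F.iterImage ⟨x, hx⟩)
      rw [signAt_iter_succ, iter_succ_toFun, mul_smul, ← h2] at h1
      refine h1.trans (Eq.symm ((congrArg _ h0).trans ?_))
      rw [map_smul]
      rfl

end PMMap

namespace PMMap

variable (F : PMMap)

/-! #### One-sided limits and images of intervals of monotonicity -/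

/-- A continuous strictly monotone function on an interval `]x, y[` maps it onto the interval
between its one-sided limits. -/
theorem image_between_of_strictMonoOn {x y : F.Sp} (h : F.MonoInterval x y) {g : F.Dom → ℝ}
    (hm : StrictMonoOn g (F.between x y)) (hc : ContinuousOn g (F.between x y)) {u v : ℝ}
    (hu : Tendsto g (comap F.val (𝓝[>] (x : ℝ))) (𝓝 u))
    (hv : Tendsto g (comap F.val (𝓝[<] (y : ℝ))) (𝓝 v)) :
    (∀ w ∈ F.between x y, u < g w ∧ g w < v) ∧
      ∀ t, u < t → t < v → ∃ w ∈ F.between x y, g w = t := by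
  have := F.neBot_right h
  have := F.neBot_left h
  refine ⟨fun w hw => ⟨?_, ?_⟩, fun t hut htv => ?_⟩
  · obtain ⟨s, hs1, hs2⟩ := exists_between hw.1
    obtain ⟨w', rfl⟩ := h.2 s ⟨hs1, hs2.trans hw.2⟩
    have hw' : w' ∈ F.between x y := ⟨hs1, hs2.trans hw.2⟩
    refine lt_of_le_of_lt ?_ (hm hw' hw hs2)
    refine le_of_tendsto hu ?_
    have hmem : {v : F.Dom | (x : ℝ) < F.val v ∧ F.val v < F.val w'} ∈
        comap F.val (𝓝[>] (x : ℝ)) := ⟨Ioo (x : ℝ) (F.val w'), Ioo_mem_nhdsGT hs1, fun _ h => h⟩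
    filter_upwards [hmem] with v hv
    exact (hm ⟨hv.1, hv.2.trans hw'.2⟩ hw' hv.2).le
  · obtain ⟨s, hs1, hs2⟩ := exists_between hw.2
    obtain ⟨w', rfl⟩ := h.2 s ⟨hw.1.trans hs1, hs2⟩
    have hw' : w' ∈ F.between x y := ⟨hw.1.trans hs1, hs2⟩
    refine lt_of_lt_of_le (hm hw hw' hs1) ?_
    refine ge_of_tendsto hv ?_
    have hmem : {v : F.Dom | F.val w' < F.val v ∧ F.val v < y} ∈
        comap F.val (𝓝[<] (y : ℝ)) := ⟨Ioo (F.val w') (y : ℝ), Ioo_mem_nhdsLT hs2, fun _ h => h⟩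
    filter_upwards [hmem] with v hv
    exact (hm hw' ⟨hw'.1.trans hv.1, hv.2⟩ hv.1).le
  · obtain ⟨w, hw1, hw2⟩ := ((hu.eventually (gt_mem_nhds hut)).and (F.mem_right h)).exists
    obtain ⟨w', hw1', hw2'⟩ := ((hv.eventually (lt_mem_nhds htv)).and (F.mem_left h)).exists
    exact (F.isPreconnected_between h).intermediate_value hw2 hw2' hc ⟨hw1.le, hw1'.le⟩

theorem tendsto_coe_of_isRightLimit {x u : F.Sp} (h : F.IsRightLimit x u) :
    Tendsto (fun w => (F.toFun w : ℝ)) (comap F.val (𝓝[>] (x : ℝ))) (𝓝 (u : ℝ)) :=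
  (continuous_subtype_val.tendsto u).comp h

theorem tendsto_coe_of_isLeftLimit {x u : F.Sp} (h : F.IsLeftLimit x u) :
    Tendsto (fun w => (F.toFun w : ℝ)) (comap F.val (𝓝[<] (x : ℝ))) (𝓝 (u : ℝ)) :=
  (continuous_subtype_val.tendsto u).comp h

theorem image_between_of_mono {x y u v : F.Sp} (h : F.MonoInterval x y)
    (hm : StrictMonoOn F.toFun (F.between x y)) (hu : F.IsRightLimit x u)
    (hv : F.IsLeftLimit y v) :
    (∀ w ∈ F.between x y, u < F.toFun w ∧ F.toFun w < v) ∧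
      ∀ t : ℝ, (u : ℝ) < t → t < v → ∃ w ∈ F.between x y, (F.toFun w : ℝ) = t :=
  F.image_between_of_strictMonoOn h (g := fun w => (F.toFun w : ℝ))
    (fun _ ha _ hb hab => hm ha hb hab)
    (continuous_subtype_val.comp F.continuous_toFun).continuousOn
    (F.tendsto_coe_of_isRightLimit hu) (F.tendsto_coe_of_isLeftLimit hv)

theorem image_between_of_anti {x y u v : F.Sp} (h : F.MonoInterval x y)
    (hm : StrictAntiOn F.toFun (F.between x y)) (hu : F.IsRightLimit x u)
    (hv : F.IsLeftLimit y v) :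
    (∀ w ∈ F.between x y, v < F.toFun w ∧ F.toFun w < u) ∧
      ∀ t : ℝ, (v : ℝ) < t → t < u → ∃ w ∈ F.between x y, (F.toFun w : ℝ) = t := by
  have key := F.image_between_of_strictMonoOn h (g := fun w => -(F.toFun w : ℝ))
    (fun _ ha _ hb hab => neg_lt_neg (hm ha hb hab))
    (continuous_subtype_val.comp F.continuous_toFun).neg.continuousOn
    (F.tendsto_coe_of_isRightLimit hu).neg (F.tendsto_coe_of_isLeftLimit hv).neg
  refine ⟨fun w hw => ?_, fun t h1 h2 => ?_⟩
  · have := key.1 w hw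
    exact ⟨(neg_lt_neg_iff (α := ℝ)).1 this.2, (neg_lt_neg_iff (α := ℝ)).1 this.1⟩
  · obtain ⟨w, hw, he⟩ := key.2 (-t) (neg_lt_neg h2) (neg_lt_neg h1)
    exact ⟨w, hw, neg_injective he⟩

theorem lt_of_image {x y : F.Sp} (h : F.MonoInterval x y) {u v : F.Sp}
    (hw : ∀ w ∈ F.between x y, u < F.toFun w ∧ F.toFun w < v) : u < v := by
  obtain ⟨w, hm⟩ := F.between_nonempty h
  exact (hw w hm).1.trans (hw w hm).2

/-! #### The endomorphism `εF_{#1}` of an iterate -/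

section Iter

variable {F} {n : ℕ}

theorem monoInterval_of_iter {x y : F.Sp} (h : (F.iter n).MonoInterval x y) :
    F.MonoInterval x y := by
  refine ⟨h.1, fun t ht => ?_⟩
  obtain ⟨w, rfl⟩ := h.2 t ht
  exact ⟨F.iterDom w, rfl⟩

theorem exists_iter_between {x y : F.Sp} (h : (F.iter n).MonoInterval x y) {w : F.Dom}
    (hw : w ∈ F.between x y) : ∃ w' : (F.iter n).Dom, F.iterDom w' = w := by
  obtain ⟨w', hw'⟩ := h.2 _ hw
  exact ⟨w', Subtype.ext (Subtype.ext hw')⟩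

theorem tendsto_iterDom (l : Filter ℝ) :
    Tendsto (F.iterDom (n := n)) (comap (F.iter n).val l) (comap F.val l) :=
  tendsto_comap_iff.2 tendsto_comap

/-- If `w ↦ F(w)` tends to the one-sided filter `r` along `l`, then `F^{n + 2}` has along `l` the
limit that `F^{n + 1}` has along `r`. -/
theorem tendsto_iter_succ {l r : Filter ℝ} {u : F.Sp}
    (h1 : Tendsto (fun w : (F.iter (n + 1)).Dom => (F.toFun (F.iterDom w) : ℝ))
      (comap (F.iter (n + 1)).val l) r)
    (h2 : Tendsto (F.iter n).toFun (comap (F.iter n).val r) (𝓝 u)) :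
    Tendsto (F.iter (n + 1)).toFun (comap (F.iter (n + 1)).val l) (𝓝 u) := by
  have hf : (F.iter (n + 1)).toFun = (F.iter n).toFun ∘ F.iterImage := funext F.iter_succ_toFun
  rw [hf]
  exact h2.comp (tendsto_comap_iff.2 h1)

/-- The image under `F` of an interval of monotonicity of `F^{n + 2}` is one of `F^{n + 1}`. -/
theorem monoInterval_image {x y p q : F.Sp} (h : (F.iter (n + 1)).MonoInterval x y) (hpq : p < q)
    (hs : ∀ t : ℝ, (p : ℝ) < t → t < q → ∃ w ∈ F.between x y, (F.toFun w : ℝ) = t) :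
    (F.iter n).MonoInterval p q := by
  refine ⟨hpq, fun t ht => ?_⟩
  obtain ⟨w, hw, rfl⟩ := hs t ht.1 ht.2
  obtain ⟨w', rfl⟩ := exists_iter_between h hw
  exact ⟨F.iterImage w', rfl⟩

end Iter

theorem isSignedOne_iter_zero : (F.iter 0).IsSignedOne F.signedOne := by
  intro x y hxy u v hu hv h
  have hxy' : F.MonoInterval x y := monoInterval_of_iter hxy
  let j : F.Dom → (F.iter 0).Dom := fun w => ⟨w.1, fun hw => w.2 (F.mem_iter_C.1 hw)⟩
  have hj : F.toFun = (F.iter 0).toFun ∘ j := funext fun w => (F.iter_zero_toFun (j w)).symm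
  have hu' : F.IsRightLimit x u := by
    rw [IsRightLimit, hj]
    exact Tendsto.comp hu (tendsto_comap_iff.2 tendsto_comap)
  have hv' : F.IsLeftLimit y v := by
    rw [IsLeftLimit, hj]
    exact Tendsto.comp hv (tendsto_comap_iff.2 tendsto_comap)
  have hs : (F.iter 0).signOn x y = F.signOn x y := by
    have hf : (F.iter 0).toFun = F.toFun ∘ F.iterDom := funext F.iter_zero_toFun
    rcases F.mono_or_anti hxy' with H | H
    · rw [F.signOn_of_mono H, (F.iter 0).signOn_of_mono]
      rw [hf]
      exact fun a ha b hb hab => H ha hb hab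
    · rw [F.signOn_of_anti hxy' H, (F.iter 0).signOn_of_anti hxy]
      rw [hf]
      exact fun a ha b hb hab => H ha hb hab
  rw [hs]
  exact F.isSignedOne_signedOne x y hxy' u v hu' hv' h

/-- On a decreasing lap `F` exchanges the two ends of the interval, which reverses the order of the
one-sided limits of the next iterate; the sign of the
lap compensates for this. -/
theorem isSignedOne_iter_succ {n : ℕ} {φ : Module.End ℝ (chainsOne F.Sp)}
    (hφ : (F.iter n).IsSignedOne φ) : (F.iter (n + 1)).IsSignedOne (φ * F.signedOne) := by
  intro x y hxy u v hu hv h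
  have hxy' : F.MonoInterval x y := monoInterval_of_iter hxy
  obtain ⟨u₀, hu₀⟩ := F.exists_rightLimit hxy'
  obtain ⟨v₀, hv₀⟩ := F.exists_leftLimit hxy'
  have hmem : Finsupp.single v₀ (1 : ℝ) - Finsupp.single u₀ 1 ∈ chainsOne F.Sp :=
    single_sub_mem (F.limits_mem_component hxy' hu₀ hv₀)
  have h1 : F.signedOne ⟨_, h⟩ = F.signOn x y • ⟨_, hmem⟩ :=
    Subtype.ext (F.isSignedOne_signedOne x y hxy' u₀ v₀ hu₀ hv₀ h)
  have hf : (F.iter (n + 1)).toFun = (F.iter n).toFun ∘ F.iterImage := funext F.iter_succ_toFun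
  have := (F.iter (n + 1)).neBot_left hxy
  have := (F.iter (n + 1)).neBot_right hxy
  have hr : Tendsto (fun w : (F.iter (n + 1)).Dom => (F.toFun (F.iterDom w) : ℝ))
      (comap (F.iter (n + 1)).val (𝓝[>] (x : ℝ))) (𝓝 (u₀ : ℝ)) :=
    (F.tendsto_coe_of_isRightLimit hu₀).comp (tendsto_iterDom _)
  have hl : Tendsto (fun w : (F.iter (n + 1)).Dom => (F.toFun (F.iterDom w) : ℝ))
      (comap (F.iter (n + 1)).val (𝓝[<] (y : ℝ))) (𝓝 (v₀ : ℝ)) :=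
    (F.tendsto_coe_of_isLeftLimit hv₀).comp (tendsto_iterDom _)
  rw [Module.End.mul_apply, h1, map_smul, Submodule.coe_smul]
  rcases F.mono_or_anti hxy' with H | H
  · obtain ⟨hw, hs⟩ := F.image_between_of_mono hxy' H hu₀ hv₀
    have hI := monoInterval_image hxy (F.lt_of_image hxy' hw) hs
    have hr' := (tendsto_nhdsWithin_iff (s := Ioi (u₀ : ℝ))).2 ⟨hr, mem_of_superset ((F.iter (n + 1)).mem_right hxy)
      fun w hm => (hw (F.iterDom w) hm).1⟩
    have hl' := (tendsto_nhdsWithin_iff (s := Iio (v₀ : ℝ))).2 ⟨hl, mem_of_superset ((F.iter (n + 1)).mem_left hxy)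
      fun w hm => (hw (F.iterDom w) hm).2⟩
    obtain ⟨u', hu'⟩ := (F.iter n).exists_rightLimit hI
    obtain ⟨v', hv'⟩ := (F.iter n).exists_leftLimit hI
    have eu : u = u' := tendsto_nhds_unique hu (tendsto_iter_succ hr' hu')
    have ev : v = v' := tendsto_nhds_unique hv (tendsto_iter_succ hl' hv')
    subst eu ev
    rw [hφ u₀ v₀ hI u v hu' hv' hmem, F.signOn_of_mono H, one_smul]
    congr 1
    rcases (F.iter n).mono_or_anti hI with H2 | H2
    · rw [(F.iter n).signOn_of_mono H2, (F.iter (n + 1)).signOn_of_mono]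
      rw [hf]
      exact fun a ha b hb hab => H2 (hw _ ha) (hw _ hb) (H ha hb hab)
    · rw [(F.iter n).signOn_of_anti hI H2, (F.iter (n + 1)).signOn_of_anti hxy]
      rw [hf]
      exact fun a ha b hb hab => H2 (hw _ ha) (hw _ hb) (H ha hb hab)
  · obtain ⟨hw, hs⟩ := F.image_between_of_anti hxy' H hu₀ hv₀
    have hI := monoInterval_image hxy (F.lt_of_image hxy' hw) hs
    have hr' := (tendsto_nhdsWithin_iff (s := Iio (u₀ : ℝ))).2 ⟨hr, mem_of_superset ((F.iter (n + 1)).mem_right hxy)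
      fun w hm => (hw (F.iterDom w) hm).2⟩
    have hl' := (tendsto_nhdsWithin_iff (s := Ioi (v₀ : ℝ))).2 ⟨hl, mem_of_superset ((F.iter (n + 1)).mem_left hxy)
      fun w hm => (hw (F.iterDom w) hm).1⟩
    obtain ⟨v', hv'⟩ := (F.iter n).exists_rightLimit hI
    obtain ⟨u', hu'⟩ := (F.iter n).exists_leftLimit hI
    have eu : u = u' := tendsto_nhds_unique hu (tendsto_iter_succ hr' hu')
    have ev : v = v' := tendsto_nhds_unique hv (tendsto_iter_succ hl' hv')
    subst eu ev
    have hmem' : Finsupp.single u₀ (1 : ℝ) - Finsupp.single v₀ 1 ∈ chainsOne F.Sp := by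
      rw [← neg_sub]
      exact neg_mem hmem
    have hneg : (⟨_, hmem⟩ : chainsOne F.Sp) = -⟨_, hmem'⟩ := Subtype.ext (neg_sub _ _).symm
    have e := hφ v₀ u₀ hI v u hv' hu' hmem'
    have e' : ((φ ⟨_, hmem⟩ : chainsOne F.Sp) : F.Sp →₀ ℝ) =
        -((F.iter n).signOn v₀ u₀ • (Finsupp.single u 1 - Finsupp.single v 1)) := by
      rw [hneg, ← e]
      exact congrArg Subtype.val (map_neg φ _)
    rw [e', F.signOn_of_anti hxy' H, neg_one_smul, neg_neg]
    have hsign : (F.iter (n + 1)).signOn x y = -(F.iter n).signOn v₀ u₀ := by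
      rcases (F.iter n).mono_or_anti hI with H2 | H2
      · rw [(F.iter n).signOn_of_mono H2, (F.iter (n + 1)).signOn_of_anti hxy]
        rw [hf]
        exact fun a ha b hb hab => H2 (hw _ hb) (hw _ ha) (H ha hb hab)
      · rw [(F.iter n).signOn_of_anti hI H2, (F.iter (n + 1)).signOn_of_mono, neg_neg]
        rw [hf]
        exact fun a ha b hb hab => H2 (hw _ hb) (hw _ ha) (H ha hb hab)
    rw [hsign, neg_smul, ← smul_neg, neg_sub]

theorem signedOne_iter (n : ℕ) : (F.iter n).signedOne = F.signedOne ^ (n + 1) := by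
  suffices h : (F.iter n).IsSignedOne (F.signedOne ^ (n + 1)) from
    (F.iter n).isSignedOne_signedOne.unique h
  induction n with
  | zero =>
    rw [zero_add, pow_one]
    exact F.isSignedOne_iter_zero
  | succ n ih =>
    rw [pow_succ]
    exact F.isSignedOne_iter_succ ih

end PMMap

/-! ### Singular chains in degrees zero and one -/

section SingularChains

open CategoryTheory Limits Simplicial

variable (G : Type u) [TopologicalSpace G]

/-- The coefficients, in the universe of `G`. -/
abbrev coeffs : ModuleCat.{u} ℝ := ModuleCat.of ℝ (ULift.{u} ℝ)

/-- The singular chain complex of `G` with real coefficients. -/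
abbrev singularComplex : ChainComplex (ModuleCat.{u} ℝ) ℕ :=
  ((AlgebraicTopology.singularChainComplexFunctor (ModuleCat.{u} ℝ)).obj coeffs.{u}).obj
    (TopCat.of G)

variable {G}

/-- A singular simplex as a simplex of the singular simplicial set. -/
def toSimplex {n : ℕ} (g : C(stdSimplex ℝ (Fin (n + 1)), G)) :
    (TopCat.toSSet.obj (TopCat.of G)) _⦋n⦌ :=
  (TopCat.toSSetObjEquiv (TopCat.of G) (Opposite.op ⦋n⦌)).symm g

/-- The generator of the singular chain complex given by a singular simplex. -/
def singularChain {n : ℕ} (g : C(stdSimplex ℝ (Fin (n + 1)), G)) : (singularComplex G).X n :=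
  (SSet.ιChainComplex (R := coeffs.{u}) _ (toSimplex g)).hom (ULift.up 1)

/-- The map of standard simplices induced by a map of vertices. -/
def simplexMap {m n : ℕ} (s : Fin m → Fin n) : C(stdSimplex ℝ (Fin m), stdSimplex ℝ (Fin n)) :=
  ⟨stdSimplex.map s, stdSimplex.continuous_map s⟩

theorem d_singularChain {n : ℕ} (g : C(stdSimplex ℝ (Fin (n + 2)), G)) :
    ((singularComplex G).d (n + 1) n).hom (singularChain g) =
      ∑ i : Fin (n + 2), (-1 : ℝ) ^ (i : ℕ) • singularChain (g.comp (simplexMap i.succAbove)) := by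
  have h := SSet.ιChainComplex_d (X := TopCat.toSSet.obj (TopCat.of G)) (R := coeffs.{u})
    (toSimplex g)
  have h2 := congrArg (fun φ => φ.hom (ULift.up 1)) h
  refine h2.trans ?_
  simp only [ModuleCat.hom_sum, LinearMap.sum_apply]
  refine Finset.sum_congr rfl fun i _ => ?_
  rcases Nat.even_or_odd (i : ℕ) with hi | hi
  · rw [hi.neg_one_pow, hi.neg_one_pow, one_smul, one_smul]
    rfl
  · rw [hi.neg_one_pow, hi.neg_one_pow, neg_one_smul, neg_one_smul]
    rfl

theorem map_singularChain (f : C(G, G)) {n : ℕ} (g : C(stdSimplex ℝ (Fin (n + 1)), G)) :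
    ((((AlgebraicTopology.singularChainComplexFunctor (ModuleCat.{u} ℝ)).obj coeffs.{u}).map
      (TopCat.ofHom f)).f n).hom (singularChain g) = singularChain (f.comp g) := by
  have h := SSet.ι_chainComplexMap_f _ _ (TopCat.toSSet.map (TopCat.ofHom f)) coeffs.{u}
    (toSimplex g)
  exact congrArg (fun φ => φ.hom (ULift.up 1)) h

theorem eq_of_singularChain {n : ℕ} {M : ModuleCat.{u} ℝ} {φ ψ : (singularComplex G).X n ⟶ M}
    (h : ∀ g : C(stdSimplex ℝ (Fin (n + 1)), G), φ.hom (singularChain g) = ψ.hom (singularChain g)) :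
    φ = ψ := by
  refine SSet.chainComplex_hom_ext fun x => ?_
  obtain ⟨g, rfl⟩ := (TopCat.toSSetObjEquiv (TopCat.of G) (Opposite.op ⦋n⦌)).symm.surjective x
  refine ModuleCat.hom_ext (LinearMap.ext fun t => ?_)
  have ht : t = (t : ULift.{u} ℝ).down • (ULift.up 1 : ULift.{u} ℝ) :=
    ULift.ext _ _ (mul_one _).symm
  rw [ht, map_smul, map_smul]
  exact congrArg _ (h g)

theorem exists_functional {n : ℕ} (w : C(stdSimplex ℝ (Fin (n + 1)), G) → ℝ) :
    ∃ φ : (singularComplex G).X n ⟶ coeffs.{u}, ∀ g, φ.hom (singularChain g) = ULift.up (w g) := by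
  let c := SSet.isColimitChainComplexXCofan (TopCat.toSSet.obj (TopCat.of G)) coeffs.{u} n
  refine ⟨c.desc (Cofan.mk _ fun x => w (TopCat.toSSetObjEquiv (TopCat.of G) _ x) • 𝟙 coeffs.{u}),
    fun g => ?_⟩
  have := c.fac (Cofan.mk _ fun x => w (TopCat.toSSetObjEquiv (TopCat.of G) _ x) • 𝟙 coeffs.{u})
    ⟨toSimplex g⟩
  refine (congrArg (fun φ => φ.hom (ULift.up 1)) this).trans ?_
  refine ULift.ext _ _ ?_
  exact mul_one (w g)

theorem span_singularChain (n : ℕ) :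
    Submodule.span ℝ (range fun g : C(stdSimplex ℝ (Fin (n + 1)), G) => singularChain g) = ⊤ := by
  set S := Submodule.span ℝ (range fun g : C(stdSimplex ℝ (Fin (n + 1)), G) => singularChain g)
  have h : ModuleCat.ofHom S.mkQ = (0 : (singularComplex G).X n ⟶ ModuleCat.of ℝ (_ ⧸ S)) :=
    eq_of_singularChain fun g =>
      (Submodule.Quotient.mk_eq_zero S).2 (Submodule.subset_span ⟨g, rfl⟩)
  rw [← S.ker_mkQ, ← ModuleCat.hom_ofHom S.mkQ, h]
  exact LinearMap.ker_zero

variable (G) in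
/-- The singular `1`-chains of `G` modulo boundaries. -/
abbrev OneChains : Type u := ((singularComplex G).opcycles 1 : ModuleCat.{u} ℝ)

variable (G) in
/-- The singular `0`-chains of `G`. -/
abbrev ZeroChains : Type u := ((singularComplex G).X 0 : ModuleCat.{u} ℝ)

/-- The class of a singular `1`-simplex modulo boundaries. -/
def pathClass (g : C(stdSimplex ℝ (Fin 2), G)) : OneChains G :=
  ((singularComplex G).pOpcycles 1).hom (singularChain g)

/-- The `0`-chain given by a point. -/
def pointChain (x : G) : ZeroChains G :=
  singularChain (ContinuousMap.const (stdSimplex ℝ (Fin 1)) x)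

variable (G) in
/-- The boundary map. -/
def boundaryMap : OneChains G →ₗ[ℝ] ZeroChains G := ((singularComplex G).fromOpcycles 1 0).hom

/-- The map on singular chains induced by `f`. -/
def chainMap (f : C(G, G)) : singularComplex G ⟶ singularComplex G :=
  ((AlgebraicTopology.singularChainComplexFunctor (ModuleCat.{u} ℝ)).obj coeffs.{u}).map
      (TopCat.ofHom f)

/-- The map on `1`-chains modulo boundaries induced by `f`. -/
def oneMap (f : C(G, G)) : Module.End ℝ (OneChains G) :=
  (HomologicalComplex.opcyclesMap (chainMap f) 1).hom

/-- The map on `0`-chains induced by `f`. -/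
def zeroMap (f : C(G, G)) : Module.End ℝ (ZeroChains G) := ((chainMap f).f 0).hom

theorem singularChain_zero (g : C(stdSimplex ℝ (Fin 1), G)) (v : stdSimplex ℝ (Fin 1)) :
    singularChain g = pointChain (g v) := by
  have : g = ContinuousMap.const _ (g v) := by
    ext w
    rw [Subsingleton.elim w v]
    rfl
  conv_lhs => rw [this]
  rfl

theorem boundaryMap_pathClass (g : C(stdSimplex ℝ (Fin 2), G)) :
    boundaryMap G (pathClass g) =
      pointChain (g (stdSimplex.vertex 1)) - pointChain (g (stdSimplex.vertex 0)) := by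
  have h : boundaryMap G (pathClass g) = ((singularComplex G).d 1 0).hom (singularChain g) := by
    rw [← (singularComplex G).p_fromOpcycles 1 0]
    rfl
  rw [h, d_singularChain, Fin.sum_univ_two]
  have hv : ∀ i : Fin 2, singularChain (g.comp (simplexMap i.succAbove)) =
      pointChain (g (stdSimplex.vertex (i.succAbove 0))) := by
    intro i
    rw [singularChain_zero _ (stdSimplex.vertex 0)]
    change pointChain (g (stdSimplex.map i.succAbove (stdSimplex.vertex 0))) = _
    rw [stdSimplex.map_vertex]
  rw [hv, hv]
  simp [sub_eq_add_neg]

theorem pathClass_triangle (g : C(stdSimplex ℝ (Fin 3), G)) :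
    pathClass (g.comp (simplexMap (Fin.succAbove 0))) -
      pathClass (g.comp (simplexMap (Fin.succAbove 1))) +
      pathClass (g.comp (simplexMap (Fin.succAbove 2))) = 0 := by
  have h : ((singularComplex G).pOpcycles 1).hom (((singularComplex G).d 2 1).hom (singularChain g))
      = 0 := congrArg (fun φ => φ.hom (singularChain g)) ((singularComplex G).d_pOpcycles 2 1)
  rw [d_singularChain, Fin.sum_univ_three, map_add, map_add, map_smul, map_smul, map_smul] at h
  rw [← h]
  simp [pathClass, sub_eq_add_neg]

theorem oneMap_pathClass (f : C(G, G)) (g : C(stdSimplex ℝ (Fin 2), G)) :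
    oneMap f (pathClass g) = pathClass (f.comp g) := by
  have h := congrArg (fun φ => φ.hom (singularChain g))
    (HomologicalComplex.p_opcyclesMap (chainMap f) 1)
  refine h.trans ?_
  exact congrArg ((singularComplex G).pOpcycles 1).hom (map_singularChain f g)

theorem zeroMap_pointChain (f : C(G, G)) (x : G) : zeroMap f (pointChain x) = pointChain (f x) :=
  map_singularChain f _

theorem pOpcycles_surjective :
    Function.Surjective ((singularComplex G).pOpcycles 1).hom :=
  (ModuleCat.epi_iff_surjective _).1 inferInstance

theorem span_pathClass : Submodule.span ℝ (range (pathClass (G := G))) = ⊤ := by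
  have : range (pathClass (G := G)) = ((singularComplex G).pOpcycles 1).hom ''
      (range fun g : C(stdSimplex ℝ (Fin 2), G) => singularChain g) := by
    rw [← range_comp]
    rfl
  rw [this, Submodule.span_image, span_singularChain, Submodule.map_top]
  exact LinearMap.range_eq_top.2 pOpcycles_surjective

theorem span_pointChain : Submodule.span ℝ (range (pointChain (G := G))) = ⊤ := by
  rw [eq_top_iff, ← span_singularChain]
  refine Submodule.span_mono ?_
  rintro _ ⟨g, rfl⟩
  exact ⟨g (stdSimplex.vertex 0), (singularChain_zero g _).symm⟩

/-- A cochain that vanishes on boundaries defines a functional on `1`-chains modulo boundaries. -/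
theorem exists_oneCocycle (w : C(stdSimplex ℝ (Fin 2), G) → ℝ)
    (hw : ∀ g : C(stdSimplex ℝ (Fin 3), G), w (g.comp (simplexMap (Fin.succAbove 0))) -
      w (g.comp (simplexMap (Fin.succAbove 1))) + w (g.comp (simplexMap (Fin.succAbove 2))) = 0) :
    ∃ φ : OneChains G →ₗ[ℝ] ℝ, ∀ g, φ (pathClass g) = w g := by
  obtain ⟨ψ, hψ⟩ := exists_functional w
  have hd : (singularComplex G).d 2 1 ≫ ψ = 0 := by
    refine eq_of_singularChain fun g => ?_
    change ψ.hom (((singularComplex G).d 2 1).hom (singularChain g)) = 0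
    rw [d_singularChain, Fin.sum_univ_three, map_add, map_add, map_smul, map_smul, map_smul,
      hψ, hψ, hψ]
    refine ULift.ext _ _ (Eq.trans ?_ (hw g))
    simp [sub_eq_add_neg]
  refine ⟨ULift.moduleEquiv.toLinearMap ∘ₗ
    ((singularComplex G).descOpcycles ψ 2 (by simp) hd).hom, fun g => ?_⟩
  have h := congrArg (fun φ => φ.hom (singularChain g))
    ((singularComplex G).p_descOpcycles ψ 2 (by simp) hd)
  exact congrArg ULift.down (h.trans (hψ g))

theorem exists_zeroCochain (h : G → ℝ) :
    ∃ φ : ZeroChains G →ₗ[ℝ] ℝ, ∀ x, φ (pointChain x) = h x := by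
  obtain ⟨ψ, hψ⟩ := exists_functional fun g : C(stdSimplex ℝ (Fin 1), G) =>
    h (g (stdSimplex.vertex 0))
  exact ⟨ULift.moduleEquiv.toLinearMap ∘ₗ ψ.hom, fun x => congrArg ULift.down (hψ _)⟩

variable (G) in
/-- The inclusion of the first homology group into the `1`-chains modulo boundaries. -/
def homologyInclusion :
    ((((AlgebraicTopology.singularHomologyFunctor (ModuleCat.{u} ℝ) 1).obj
      (ModuleCat.of ℝ (ULift.{u} ℝ))).obj (TopCat.of G)) : ModuleCat.{u} ℝ) →ₗ[ℝ] OneChains G :=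
  ((singularComplex G).homologyι 1).hom

theorem homologyInclusion_injective : Function.Injective (homologyInclusion G) :=
  (ModuleCat.mono_iff_injective ((singularComplex G).homologyι 1)).1 inferInstance

theorem range_homologyInclusion :
    LinearMap.range (homologyInclusion G) = LinearMap.ker (boundaryMap G) :=
  (ShortComplex.exact_of_f_is_kernel
    (ShortComplex.mk _ _ ((singularComplex G).homologyι_comp_fromOpcycles 1 0))
    ((singularComplex G).homologyIsKernel 1 0 (by simp))).moduleCat_range_eq_ker

theorem homologyInclusion_homologyMap (f : C(G, G)) (x) :
    homologyInclusion G (homologyMap f 1 x) = oneMap f (homologyInclusion G x) :=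
  congrArg (fun φ => φ.hom x) (HomologicalComplex.homologyι_naturality (chainMap f) 1)

variable (G) in
/-- The projection of the `0`-chains onto the homology group of degree zero. -/
def homologyProjection : ZeroChains G →ₗ[ℝ]
    ((((AlgebraicTopology.singularHomologyFunctor (ModuleCat.{u} ℝ) 0).obj
      (ModuleCat.of ℝ (ULift.{u} ℝ))).obj (TopCat.of G)) : ModuleCat.{u} ℝ) :=
  ((singularComplex G).pOpcycles 0 ≫ inv ((singularComplex G).homologyι 0)).hom

theorem homologyProjection_surjective : Function.Surjective (homologyProjection G) := by
  refine (ModuleCat.epi_iff_surjective _).1 ?_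
  infer_instance

theorem ker_homologyProjection :
    LinearMap.ker (homologyProjection G) = LinearMap.range (boundaryMap G) := by
  have h1 : LinearMap.range ((singularComplex G).d 1 0).hom =
      LinearMap.ker ((singularComplex G).pOpcycles 0).hom :=
    (ShortComplex.exact_of_g_is_cokernel
      (ShortComplex.mk _ _ ((singularComplex G).d_pOpcycles 1 0))
      ((singularComplex G).opcyclesIsCokernel 1 0 (by simp))).moduleCat_range_eq_ker
  have h2 : LinearMap.range ((singularComplex G).d 1 0).hom = LinearMap.range (boundaryMap G) := by
    rw [← (singularComplex G).p_fromOpcycles 1 0, ModuleCat.hom_comp]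
    exact LinearMap.range_comp_of_range_eq_top _ (LinearMap.range_eq_top.2 pOpcycles_surjective)
  have h3 : LinearMap.ker (inv ((singularComplex G).homologyι 0)).hom = ⊥ :=
    LinearMap.ker_eq_bot.2 ((ModuleCat.mono_iff_injective _).1 inferInstance)
  rw [← h2, h1]
  exact LinearMap.ker_comp_of_ker_eq_bot _ h3

theorem homologyMap_homologyProjection (f : C(G, G)) (x) :
    homologyMap f 0 (homologyProjection G x) = homologyProjection G (zeroMap f x) := by
  have : ((singularComplex G).pOpcycles 0 ≫ inv ((singularComplex G).homologyι 0)) ≫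
      HomologicalComplex.homologyMap (chainMap f) 0 =
      (chainMap f).f 0 ≫ (singularComplex G).pOpcycles 0 ≫
        inv ((singularComplex G).homologyι 0) := by
    rw [← cancel_mono ((singularComplex G).homologyι 0)]
    simp only [Category.assoc, HomologicalComplex.homologyι_naturality, IsIso.inv_hom_id_assoc,
      IsIso.inv_hom_id, Category.comp_id, HomologicalComplex.p_opcyclesMap]
  exact congrArg (fun φ => φ.hom x) this

end SingularChains

/-! ### Chains given by paths, homotopy and winding numbers -/

section Segments

variable {G : Type u} [TopologicalSpace G]
variable {E : Type*} [AddCommGroup E] [Module ℝ E] [TopologicalSpace E] [IsTopologicalAddGroup E]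
  [ContinuousSMul ℝ E]

/-- The affine simplex with given vertices. -/
def affineSimplex {n : ℕ} (v : Fin n → E) : C(stdSimplex ℝ (Fin n), E) where
  toFun s := ∑ i, s i • v i
  continuous_toFun := by
    refine continuous_finsetSum _ fun i _ => Continuous.smul ?_ continuous_const
    exact (continuous_apply i).comp continuous_subtype_val

theorem affineSimplex_apply {n : ℕ} (v : Fin n → E) (s : stdSimplex ℝ (Fin n)) :
    affineSimplex v s = ∑ i, s i • v i := rfl

theorem affineSimplex_comp_simplexMap {m n : ℕ} (v : Fin n → E) (σ : Fin m → Fin n) :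
    (affineSimplex v).comp (simplexMap σ) = affineSimplex (v ∘ σ) := by
  ext s
  change ∑ i, (stdSimplex.map σ s) i • v i = ∑ j, s j • v (σ j)
  have h : ∀ i, (stdSimplex.map σ s) i = ∑ j with σ j = i, s j := fun i => by
    rw [stdSimplex.map_coe, FunOnFinite.linearMap_apply_apply]
  simp only [h, Finset.sum_smul]
  rw [← Finset.sum_fiberwise_of_maps_to (g := σ) (t := Finset.univ) (fun _ _ => Finset.mem_univ _)]
  refine Finset.sum_congr rfl fun i _ => Finset.sum_congr rfl fun j hj => ?_
  rw [(Finset.mem_filter.1 hj).2]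

theorem affineSimplex_vertex {n : ℕ} (v : Fin n → E) (i : Fin n) :
    affineSimplex v (stdSimplex.vertex i) = v i := by
  rw [affineSimplex_apply, Finset.sum_eq_single i]
  · simp
  · intro j _ hj
    simp [hj]
  · simp

/-- The class of the singular `1`-simplex `s ↦ g((1 - s) x + s y)`. -/
def segClass (g : C(E, G)) (x y : E) : OneChains G :=
  pathClass (g.comp (affineSimplex ![x, y]))

theorem boundaryMap_segClass (g : C(E, G)) (x y : E) :
    boundaryMap G (segClass g x y) = pointChain (g y) - pointChain (g x) := by
  rw [segClass, boundaryMap_pathClass]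
  simp [affineSimplex_vertex]

theorem oneMap_segClass (f : C(G, G)) (g : C(E, G)) (x y : E) :
    oneMap f (segClass g x y) = segClass (f.comp g) x y :=
  oneMap_pathClass f _

theorem segClass_add (g : C(E, G)) (x y z : E) :
    segClass g x y + segClass g y z = segClass g x z := by
  have h := pathClass_triangle (g.comp (affineSimplex ![x, y, z]))
  simp only [ContinuousMap.comp_assoc, affineSimplex_comp_simplexMap] at h
  have h0 : (![x, y, z] ∘ Fin.succAbove 0 : Fin 2 → E) = ![y, z] := by
    ext i; fin_cases i <;> rfl
  have h1 : (![x, y, z] ∘ Fin.succAbove 1 : Fin 2 → E) = ![x, z] := by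
    ext i; fin_cases i <;> rfl
  have h2 : (![x, y, z] ∘ Fin.succAbove 2 : Fin 2 → E) = ![x, y] := by
    ext i; fin_cases i <;> rfl
  rw [h0, h1, h2] at h
  have h3 : segClass g y z - segClass g x z + segClass g x y = 0 := h
  rw [← sub_eq_zero, ← h3]
  abel

theorem segClass_self (g : C(E, G)) (x : E) : segClass g x x = 0 := by
  simpa using segClass_add g x x x

theorem affineSimplex_pair (x y : E) (s : stdSimplex ℝ (Fin 2)) :
    affineSimplex ![x, y] s = AffineMap.lineMap x y (s 1) := by
  rw [affineSimplex_apply, Fin.sum_univ_two, AffineMap.lineMap_apply_module]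
  have := stdSimplex.add_eq_one s
  simp [← this]

/-- Segments are determined by the paths that they run along. -/
theorem segClass_congr {E' : Type*} [AddCommGroup E'] [Module ℝ E'] [TopologicalSpace E']
    [IsTopologicalAddGroup E'] [ContinuousSMul ℝ E'] {g : C(E, G)} {g' : C(E', G)} {x y : E}
    {x' y' : E'} (h : ∀ s ∈ Icc (0 : ℝ) 1, g (AffineMap.lineMap x y s) =
      g' (AffineMap.lineMap x' y' s)) : segClass g x y = segClass g' x' y' := by
  unfold segClass
  congr 1
  ext s
  simp only [ContinuousMap.comp_apply, affineSimplex_pair]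
  exact h _ ⟨stdSimplex.zero_le s 1, stdSimplex.le_one s 1⟩

theorem segClass_eq_zero {g : C(E, G)} {x y : E}
    (h : ∀ s ∈ Icc (0 : ℝ) 1, g (AffineMap.lineMap x y s) = g x) : segClass g x y = 0 := by
  rw [← segClass_self g x]
  refine segClass_congr fun s hs => ?_
  rw [h s hs, AffineMap.lineMap_same_apply]

theorem segClass_slice_left (H : C(ℝ × ℝ, G)) (x y τ : ℝ) :
    segClass H (x, τ) (y, τ) = segClass (H.comp ⟨fun t => (t, τ), by fun_prop⟩) x y :=
  segClass_congr fun s _ => by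
    simp [AffineMap.lineMap_apply]

theorem segClass_slice_right (H : C(ℝ × ℝ, G)) (t x y : ℝ) :
    segClass H (t, x) (t, y) = segClass (H.comp ⟨fun τ => (t, τ), by fun_prop⟩) x y :=
  segClass_congr fun s _ => by
    simp [AffineMap.lineMap_apply]

/-- The difference of the ends of a homotopy is the difference of its sides. -/
theorem segClass_homotopy (H : C(ℝ × ℝ, G)) (x y : ℝ) :
    segClass (H.comp ⟨fun t => (t, 0), by fun_prop⟩) x y +
        segClass (H.comp ⟨fun τ => (y, τ), by fun_prop⟩) 0 1 =
      segClass (H.comp ⟨fun τ => (x, τ), by fun_prop⟩) 0 1 +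
        segClass (H.comp ⟨fun t => (t, 1), by fun_prop⟩) x y := by
  rw [← segClass_slice_left, ← segClass_slice_left, ← segClass_slice_right,
    ← segClass_slice_right, segClass_add, segClass_add]

/-- Any two paths with the same ends in a vector space are homotopic, so the class of a path that
factors through a vector space only depends on its ends there. -/
theorem segClass_comp (g : C(E, G)) (k : C(ℝ, E)) (x y : ℝ) :
    segClass (g.comp k) x y = segClass g (k x) (k y) := by
  rcases eq_or_ne x y with rfl | hxy
  · rw [segClass_self, segClass_self]
  have hne : y - x ≠ 0 := sub_ne_zero.2 hxy.symm
  let l : ℝ → E := fun t => AffineMap.lineMap (k x) (k y) ((t - x) / (y - x))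
  have hl : Continuous l := by
    simp only [l, AffineMap.lineMap_apply_module]
    fun_prop
  let L : C(ℝ × ℝ, E) := ⟨fun q => (1 - q.2) • k q.1 + q.2 • l q.1, by fun_prop⟩
  have h := segClass_homotopy (g.comp L) x y
  have hside : ∀ t, l t = k t → segClass ((g.comp L).comp ⟨fun τ => (t, τ), by fun_prop⟩) 0 1 = 0 := by
    intro t ht
    have hc : ∀ τ : ℝ, L (t, τ) = k t := fun τ => by
      change (1 - τ) • k t + τ • l t = k t
      rw [ht, ← add_smul]
      simp
    refine segClass_eq_zero fun s _ => ?_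
    simp [hc]
  rw [hside y (by simp [l, hne]), hside x (by simp [l]), add_zero, zero_add] at h
  have h0 : (g.comp L).comp ⟨fun t => (t, 0), by fun_prop⟩ = g.comp k := by
    ext t
    simp [L]
  rw [h0] at h
  rw [h]
  refine segClass_congr fun s _ => ?_
  have h1 : ∀ t, L (t, 1) = l t := fun t => by simp [L]
  simp only [ContinuousMap.comp_apply, ContinuousMap.coe_mk, h1, l]
  congr 2
  rw [AffineMap.lineMap_apply_ring']
  field_simp
  ring

/-- Every singular `1`-simplex is a segment along a path on the line. -/
theorem pathClass_eq_segClass (γ : C(stdSimplex ℝ (Fin 2), G)) :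
    ∃ g : C(ℝ, G), pathClass γ = segClass g 0 1 := by
  let r : C(ℝ, stdSimplex ℝ (Fin 2)) :=
    ⟨fun t => stdSimplexHomeomorphUnitInterval.symm (projIcc 0 1 zero_le_one t), by fun_prop⟩
  refine ⟨γ.comp r, ?_⟩
  unfold segClass
  congr 1
  ext s
  simp only [ContinuousMap.comp_apply, affineSimplex_pair]
  congr 1
  have : stdSimplexHomeomorphUnitInterval s = projIcc 0 1 zero_le_one (s 1) := by
    rw [projIcc_of_mem zero_le_one ⟨stdSimplex.zero_le s 1, stdSimplex.le_one s 1⟩]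
    rfl
  change s = stdSimplexHomeomorphUnitInterval.symm _
  rw [Homeomorph.eq_symm_apply]
  simpa [AffineMap.lineMap_apply_ring'] using this

/-- A functional on `1`-chains modulo boundaries that is zero on small paths is zero. -/
theorem apply_segClass_eq_zero (φ : OneChains G →ₗ[ℝ] ℝ) (g : C(ℝ, G))
    (h : ∀ s, ∃ U ∈ 𝓝 s, ∀ t ∈ U, φ (segClass g s t) = 0) (x y : ℝ) : φ (segClass g x y) = 0 := by
  have hl : IsLocallyConstant fun t => φ (segClass g x t) := by
    refine (IsLocallyConstant.iff_eventually_eq _).2 fun s => ?_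
    obtain ⟨U, hU, hs⟩ := h s
    filter_upwards [hU] with t ht
    rw [← segClass_add g x s t, map_add, hs t ht, add_zero]
  have := hl.apply_eq_of_isPreconnected isPreconnected_univ (mem_univ y) (mem_univ x)
  simpa [segClass_self] using this

/-- The functional on paths given by the winding number along a map to the circle. -/
theorem exists_winding (q : C(G, AddCircle (1 : ℝ))) :
    ∃ φ : OneChains G →ₗ[ℝ] ℝ, ∀ (g : C(ℝ, G)) (l : C(ℝ, ℝ)) (x y : ℝ), x ≤ y →
      (∀ t ∈ Icc x y, q (g t) = (l t : AddCircle (1 : ℝ))) → φ (segClass g x y) = l y - l x := by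
  have cov := AddCircle.isCoveringMap_coe (1 : ℝ)
  have hconv : ∀ n : ℕ, ∀ γ : C(stdSimplex ℝ (Fin (n + 1)), G),
      ∃ l : C(stdSimplex ℝ (Fin (n + 1)), ℝ), ∀ s, ((l s : ℝ) : AddCircle (1 : ℝ)) = q (γ s) := by
    intro n γ
    let v : stdSimplex ℝ (Fin (n + 1)) := stdSimplex.vertex 0
    let H : C(unitInterval × stdSimplex ℝ (Fin (n + 1)), AddCircle (1 : ℝ)) :=
      (q.comp γ).comp ⟨fun z => ⟨(1 - (z.1 : ℝ)) • (v : Fin (n + 1) → ℝ) + (z.1 : ℝ) • (z.2 : Fin (n + 1) → ℝ),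
        convex_stdSimplex ℝ _ v.2 z.2.2 (by linarith [z.1.2.2]) z.1.2.1 (by ring)⟩, by fun_prop⟩
    obtain ⟨e, he⟩ := QuotientAddGroup.mk_surjective (q (γ v))
    have H0 : ∀ a, H (0, a) = ((ContinuousMap.const (stdSimplex ℝ (Fin (n + 1))) e) a : AddCircle (1 : ℝ)) := by
      intro a
      refine Eq.trans ?_ he.symm
      refine congrArg (fun z => q (γ z)) (Subtype.ext ?_)
      simp
      rfl
    refine ⟨(cov.liftHomotopy H _ H0).comp ⟨fun a => (1, a), by fun_prop⟩, fun s => ?_⟩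
    have := congrFun (cov.liftHomotopy_lifts H _ H0) (1, s)
    refine this.trans (congrArg (fun z => q (γ z)) (Subtype.ext ?_))
    simp
    rfl
  have huniq : ∀ (n : ℕ) (l l' : C(stdSimplex ℝ (Fin (n + 1)), ℝ)),
      (∀ s, ((l s : ℝ) : AddCircle (1 : ℝ)) = l' s) → ∀ s t, l s - l t = l' s - l' t := by
    intro n l l' h s t
    have : PreconnectedSpace (stdSimplex ℝ (Fin (n + 1))) :=
      Subtype.preconnectedSpace (convex_stdSimplex ℝ _).isPreconnected
    let l'' : C(stdSimplex ℝ (Fin (n + 1)), ℝ) := ⟨fun z => l' z + (l t - l' t), by fun_prop⟩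
    have key := cov.eq_of_comp_eq l.continuous l''.continuous (funext fun z => ?_) t
      (by simp [l''])
    · have := congrFun key s
      simp only [l'', ContinuousMap.coe_mk] at this
      linarith
    · simp only [Function.comp_apply, l'', ContinuousMap.coe_mk, AddCircle.coe_add, AddCircle.coe_sub]
      rw [h, h]
      simp
  choose lift hlift using hconv
  obtain ⟨φ, hφ⟩ := exists_oneCocycle (G := G)
    (fun γ => lift 1 γ (stdSimplex.vertex 1) - lift 1 γ (stdSimplex.vertex 0)) (by
      intro γ
      have hf : ∀ i : Fin 3, lift 1 (γ.comp (simplexMap i.succAbove)) (stdSimplex.vertex 1) -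
          lift 1 (γ.comp (simplexMap i.succAbove)) (stdSimplex.vertex 0) =
          lift 2 γ (stdSimplex.vertex (i.succAbove 1)) -
            lift 2 γ (stdSimplex.vertex (i.succAbove 0)) := by
        intro i
        rw [huniq 1 (lift 1 (γ.comp (simplexMap i.succAbove)))
          ((lift 2 γ).comp (simplexMap i.succAbove))
          (fun s => (hlift 1 _ s).trans (hlift 2 γ _).symm)]
        change lift 2 γ (stdSimplex.map i.succAbove _) - lift 2 γ (stdSimplex.map i.succAbove _) = _
        rw [stdSimplex.map_vertex, stdSimplex.map_vertex]
      rw [hf, hf, hf]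
      have e1 : (0 : Fin 3).succAbove 1 = 2 := rfl
      have e2 : (0 : Fin 3).succAbove 0 = 1 := rfl
      have e3 : (1 : Fin 3).succAbove 1 = 2 := rfl
      have e4 : (1 : Fin 3).succAbove 0 = 0 := rfl
      have e5 : (2 : Fin 3).succAbove 1 = 1 := rfl
      have e6 : (2 : Fin 3).succAbove 0 = 0 := rfl
      rw [e1, e2, e3, e4, e5, e6]
      ring)
  refine ⟨φ, fun g l x y hxy h => ?_⟩
  rw [segClass, hφ, huniq 1 _ (l.comp (affineSimplex ![x, y])) fun s => ?_]
  · simp [affineSimplex_vertex]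
  · rw [hlift]
    refine h _ ?_
    rw [← segment_eq_Icc hxy, segment_eq_image_lineMap]
    exact ⟨_, ⟨stdSimplex.zero_le s 1, stdSimplex.le_one s 1⟩, (affineSimplex_pair x y s).symm⟩

end Segments

namespace PMMap

variable (F : PMMap)

/-! ### The chain of a piecewise monotone map on the edges of the graph -/

open Classical in
/-- The limit `F(x+)` (`x` itself, if there is no such limit). -/
def rightLim (x : F.Sp) : F.Sp := if h : ∃ u, F.IsRightLimit x u then h.choose else x

open Classical in
/-- The limit `F(y-)` (`y` itself, if there is no such limit). -/
def leftLim (y : F.Sp) : F.Sp := if h : ∃ v, F.IsLeftLimit y v then h.choose else y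

variable {F} in
theorem MonoInterval.isRightLimit {x y : F.Sp} (h : F.MonoInterval x y) :
    F.IsRightLimit x (F.rightLim x) := by
  have H := F.exists_rightLimit h
  rw [rightLim, dif_pos H]
  exact H.choose_spec

variable {F} in
theorem MonoInterval.isLeftLimit {x y : F.Sp} (h : F.MonoInterval x y) :
    F.IsLeftLimit y (F.leftLim y) := by
  have H := F.exists_leftLimit h
  rw [leftLim, dif_pos H]
  exact H.choose_spec

open Classical in
/-- The laps of `F`, as pairs of consecutive points of `C`. -/
def laps : Finset (F.Sp × F.Sp) := {l ∈ F.C ×ˢ F.C | F.MonoInterval l.1 l.2}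

theorem mem_laps {l : F.Sp × F.Sp} : l ∈ F.laps ↔ F.IsLap l.1 l.2 := by
  simp [laps, IsLap, and_assoc]

/-- Summing increments over the laps of a component telescopes. -/
theorem sum_laps {M : Type*} [AddCommGroup M] (T : F.Sp → M) (i : Fin F.m) :
    ∑ l ∈ F.laps with F.idx l.1 = i, (T l.2 - T l.1) = T (F.rightPt i) - T (F.leftPt i) := by
  classical
  have key : ∀ n, ∀ c ∈ F.C, F.idx c = i → (F.C.filter (· < c)).card = n →
      ∑ l ∈ F.laps with F.idx l.1 = i ∧ l.2 ≤ c, (T l.2 - T l.1) = T c - T (F.leftPt i) := by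
    intro n
    induction n using Nat.strong_induction_on with
    | _ n ih =>
      intro c hc hi hn
      by_cases hca : c = F.leftPt i
      · rw [hca, sub_self]
        refine Finset.sum_eq_zero fun l hl => ?_
        obtain ⟨hl, hli, hlc⟩ := Finset.mem_filter.1 hl
        have h1 := F.leftPt_le hli
        have h2 := ((F.mem_laps).1 hl).2.2.1
        exact absurd (h1.trans_lt h2) (not_lt.2 hlc)
      · have hlt : F.leftPt (F.idx c) < c := F.leftPt_lt (by rwa [hi])
        obtain ⟨c', hc', hm⟩ := F.exists_lap_left hlt
        have hi' : F.idx c' = i := by rw [← hi, hm.idx_eq]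
        have hlap : F.IsLap c' c := ⟨hc', hc, hm⟩
        have hins : F.laps.filter (fun l => F.idx l.1 = i ∧ l.2 ≤ c) =
            insert (c', c) (F.laps.filter (fun l => F.idx l.1 = i ∧ l.2 ≤ c')) := by
          ext l
          simp only [Finset.mem_filter, Finset.mem_insert]
          constructor
          · rintro ⟨hl, hli, hlc⟩
            have hl' := F.mem_laps.1 hl
            rcases hlc.eq_or_lt with h | h
            · left
              have h3 := hl'
              rw [h] at h3
              exact Prod.ext (h3.left_unique hlap) h
            · right
              refine ⟨hl, hli, ?_⟩
              by_contra hcon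
              exact hm.not_mem (not_le.1 hcon) h hl'.2.1
          · rintro (rfl | ⟨hl, hli, hlc⟩)
            · exact ⟨F.mem_laps.2 hlap, hi', le_rfl⟩
            · exact ⟨hl, hli, hlc.trans hm.1.le⟩
        rw [hins, Finset.sum_insert, ih _ ?_ c' hc' hi' rfl]
        · abel
        · rw [← hn]
          refine Finset.card_lt_card ⟨fun d hd => ?_, fun hh => ?_⟩
          · simp only [Finset.mem_filter] at hd ⊢
            exact ⟨hd.1, hd.2.trans hm.1⟩
          · exact lt_irrefl _ (Finset.mem_filter.1 (hh (Finset.mem_filter.2 ⟨hc', hm.1⟩))).2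
        · intro h
          exact absurd (Finset.mem_filter.1 h).2.2 (not_le.2 hm.1)
  rw [← key _ (F.rightPt i) (F.rightPt_mem i) (F.idx_rightPt i) rfl]
  refine Finset.sum_congr (Finset.filter_congr fun l hl => ?_) fun _ _ => rfl
  refine ⟨fun h => ⟨h, F.le_rightPt ?_⟩, fun h => h.1⟩
  rw [← h, (F.mem_laps.1 hl).2.2.idx_eq]

/-- The retraction of the line onto the `i`-th component of `Ω`. -/
def clampPt (i : Fin F.m) : C(ℝ, F.Sp) where
  toFun t := ⟨projIcc (F.a i) (F.b i) (F.a_lt_b i).le t, i,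
    (projIcc (F.a i) (F.b i) (F.a_lt_b i).le t).2⟩
  continuous_toFun := by
    refine Continuous.subtype_mk ?_ _
    exact continuous_subtype_val.comp continuous_projIcc

theorem clampPt_coe {i : Fin F.m} {x : F.Sp} (h : F.idx x = i) : F.clampPt i (x : ℝ) = x := by
  refine Subtype.ext ?_
  have hx : (x : ℝ) ∈ Icc (F.a i) (F.b i) := h ▸ F.idx_mem x
  have := congrArg Subtype.val (projIcc_of_mem (F.a_lt_b i).le hx)
  exact this

theorem idx_clampPt (i : Fin F.m) (t : ℝ) : F.idx (F.clampPt i t) = i :=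
  F.idx_eq_of_mem (projIcc (F.a i) (F.b i) (F.a_lt_b i).le t).2

theorem clampPt_apply {i : Fin F.m} {t : ℝ} (h : t ∈ Icc (F.a i) (F.b i)) :
    (F.clampPt i t : ℝ) = t := by
  exact congrArg Subtype.val (projIcc_of_mem (F.a_lt_b i).le h)

theorem idx_rightLim_eq {x y : F.Sp} (h : F.MonoInterval x y) :
    F.idx (F.leftLim y) = F.idx (F.rightLim x) :=
  F.mem_connectedComponent_iff.1 (F.limits_mem_component h h.isRightLimit h.isLeftLimit)

theorem idx_toFun {x y : F.Sp} (h : F.MonoInterval x y) {w : F.Dom} (hw : w ∈ F.between x y) :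
    F.idx (F.toFun w) = F.idx (F.rightLim x) := by
  rcases F.mono_or_anti h with hm | hm
  · have := (F.image_between_of_mono h hm h.isRightLimit h.isLeftLimit).1 w hw
    exact F.idx_of_mem_Icc (F.idx_rightLim_eq h).symm this.1.le this.2.le
  · have := (F.image_between_of_anti h hm h.isRightLimit h.isLeftLimit).1 w hw
    rw [F.idx_of_mem_Icc (F.idx_rightLim_eq h) this.1.le this.2.le, F.idx_rightLim_eq h]

/-- The continuous extension of `F` from an interval of monotonicity to its end points. -/
theorem exists_extension {x y : F.Sp} (h : F.MonoInterval x y) :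
    ∃ k : C(ℝ, ℝ), k x = F.rightLim x ∧ k y = F.leftLim y ∧
      ∀ w ∈ F.between x y, k (F.val w) = F.toFun w := by
  set φ : ℝ → ℝ := fun t => (F.hat (F.clampPt (F.idx x) t) : ℝ) with hφ
  have hxy : (x : ℝ) < y := h.1
  have hw : ∀ w ∈ F.between x y, F.clampPt (F.idx x) (F.val w) = (w : F.Sp) := fun w hw =>
    F.clampPt_coe (F.idx_of_mem_Icc h.idx_eq hw.1.le hw.2.le)
  have hφw : ∀ w ∈ F.between x y, φ (F.val w) = F.toFun w := fun w hm => by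
    simp only [hφ]
    rw [hw w hm, F.hat_coe]
  have hc : ∀ t ∈ Ioo (x : ℝ) y, ContinuousAt φ t := by
    intro t ht
    obtain ⟨w, rfl⟩ := h.2 t ht
    have h1 : ContinuousAt F.hat (F.clampPt (F.idx x) (F.val w)) := by
      rw [hw w ht]
      exact F.continuousAt_hat w.2
    exact continuous_subtype_val.continuousAt.comp
      (h1.comp (F.clampPt (F.idx x)).continuous.continuousAt)
  have hlim : ∀ (l : Filter ℝ) (r : ℝ), Ioo (x : ℝ) y ∈ l →
      Tendsto (fun w => (F.toFun w : ℝ)) (comap F.val l) (𝓝 r) → Tendsto φ l (𝓝 r) := by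
    intro l r hl ht
    have hr : range F.val ∈ l := mem_of_superset hl fun t ht => h.2 t ht
    rw [← map_comap_of_mem hr, tendsto_map'_iff]
    refine ht.congr' ?_
    filter_upwards [preimage_mem_comap hl] with w hm
    exact (hφw w hm).symm
  have hx := hlim _ _ (Ioo_mem_nhdsGT hxy) (F.tendsto_coe_of_isRightLimit h.isRightLimit)
  have hy := hlim _ _ (Ioo_mem_nhdsLT hxy) (F.tendsto_coe_of_isLeftLimit h.isLeftLimit)
  have hcont := continuousOn_Icc_extendFrom_Ioo (fun t ht => (hc t ht).continuousWithinAt) hx hy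
  have hmem : ∀ t ∈ Icc (x : ℝ) y,
      IccExtend hxy.le ((Icc (x : ℝ) y).domRestrict (extendFrom (Ioo (x : ℝ) y) φ)) t =
        extendFrom (Ioo (x : ℝ) y) φ t := fun t ht => IccExtend_of_mem _ _ ht
  refine ⟨⟨IccExtend hxy.le ((Icc (x : ℝ) y).domRestrict (extendFrom (Ioo (x : ℝ) y) φ)),
    hcont.domRestrict.Icc_extend'⟩, ?_, ?_, fun w hm => ?_⟩
  · refine (hmem _ (left_mem_Icc.2 hxy.le)).trans ?_
    exact eq_lim_at_left_extendFrom_Ioo hxy hx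
  · refine (hmem _ (right_mem_Icc.2 hxy.le)).trans ?_
    exact eq_lim_at_right_extendFrom_Ioo hxy hy
  · refine (hmem _ ⟨hm.1.le, hm.2.le⟩).trans ?_
    rw [← hφw w hm]
    have hm' : F.val w ∈ Ioo (x : ℝ) y := hm
    exact extendFrom_eq (subset_closure hm') ((hc _ hm).tendsto.mono_left nhdsWithin_le_nhds)

variable {G : Type u} [TopologicalSpace G]

/-- The path along the `i`-th component of `Ω`, continued constantly beyond its ends. -/
def edge (p : C(F.Sp, G)) (i : Fin F.m) : C(ℝ, G) := p.comp (F.clampPt i)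

variable {F} in
theorem edge_coe (p : C(F.Sp, G)) {i : Fin F.m} {x : F.Sp} (h : F.idx x = i) :
    F.edge p i x = p x := congrArg p (F.clampPt_coe h)

/-- The class of the path that leads from the left end of its component to `x`. -/
def pathTo (p : C(F.Sp, G)) (x : F.Sp) : OneChains G :=
  segClass (F.edge p (F.idx x)) (F.a (F.idx x)) x

theorem pathTo_leftPt (p : C(F.Sp, G)) (i : Fin F.m) : F.pathTo p (F.leftPt i) = 0 := by
  unfold pathTo
  rw [idx_leftPt]
  exact segClass_self _ _

theorem pathTo_sub (p : C(F.Sp, G)) {x y : F.Sp} {i : Fin F.m} (hx : F.idx x = i)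
    (hy : F.idx y = i) : F.pathTo p y - F.pathTo p x = segClass (F.edge p i) x y := by
  unfold pathTo
  rw [hx, hy, ← segClass_add (F.edge p i) (F.a i) x y]
  abel

theorem boundaryMap_pathTo (p : C(F.Sp, G)) (x : F.Sp) :
    boundaryMap G (F.pathTo p x) = pointChain (p x) - pointChain (p (F.leftPt (F.idx x))) := by
  unfold pathTo
  rw [boundaryMap_segClass, edge_coe p rfl]
  congr 2
  exact edge_coe p (F.idx_leftPt _)

end PMMap

namespace IsInducedBy

variable {G : Type u} [TopologicalSpace G] [T2Space G] {f : C(G, G)} {F : PMMap} {p : C(F.Sp, G)}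

theorem tendsto_coe {x : F.Sp} {s : Set ℝ} :
    Tendsto (fun w : F.Dom => (w : F.Sp)) (comap F.val (𝓝[s] (x : ℝ))) (𝓝 x) :=
  tendsto_subtype_rng.2 (tendsto_comap.mono_right nhdsWithin_le_nhds)

theorem apply_rightLim (h : IsInducedBy f F p) {x y : F.Sp} (hm : F.MonoInterval x y) :
    p (F.rightLim x) = f (p x) := by
  have := F.neBot_right hm
  have h1 : Tendsto (fun w : F.Dom => p (F.toFun w)) (comap F.val (𝓝[>] (x : ℝ)))
      (𝓝 (p (F.rightLim x))) := (p.continuous.tendsto _).comp hm.isRightLimit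
  have h2 : Tendsto (fun w : F.Dom => f (p w)) (comap F.val (𝓝[>] (x : ℝ))) (𝓝 (f (p x))) :=
    ((f.comp p).continuous.tendsto x).comp tendsto_coe
  exact tendsto_nhds_unique (h1.congr h.commutes) h2

theorem apply_leftLim (h : IsInducedBy f F p) {x y : F.Sp} (hm : F.MonoInterval x y) :
    p (F.leftLim y) = f (p y) := by
  have := F.neBot_left hm
  have h1 : Tendsto (fun w : F.Dom => p (F.toFun w)) (comap F.val (𝓝[<] (y : ℝ)))
      (𝓝 (p (F.leftLim y))) := (p.continuous.tendsto _).comp hm.isLeftLimit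
  have h2 : Tendsto (fun w : F.Dom => f (p w)) (comap F.val (𝓝[<] (y : ℝ))) (𝓝 (f (p y))) :=
    ((f.comp p).continuous.tendsto y).comp tendsto_coe
  exact tendsto_nhds_unique (h1.congr h.commutes) h2

/-- On an interval of monotonicity, the image of the edge path under `f` is homotopic to the edge
path between the one-sided limits of `F`. -/
theorem oneMap_pathTo_sub (h : IsInducedBy f F p) {x y : F.Sp} (hm : F.MonoInterval x y) :
    oneMap f (F.pathTo p y - F.pathTo p x) =
      F.pathTo p (F.leftLim y) - F.pathTo p (F.rightLim x) := by
  obtain ⟨k, hkx, hky, hk⟩ := F.exists_extension hm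
  have hxy : (x : ℝ) < y := hm.1
  rw [F.pathTo_sub p rfl hm.idx_eq.symm, F.pathTo_sub p rfl (F.idx_rightLim_eq hm), oneMap_segClass,
    ← hkx, ← hky, ← segClass_comp]
  refine segClass_congr fun s hs => ?_
  have ht : AffineMap.lineMap (x : ℝ) (y : ℝ) s ∈ Icc (x : ℝ) y := by
    rw [← segment_eq_Icc hxy.le, segment_eq_image_lineMap]
    exact ⟨s, hs, rfl⟩
  revert ht
  generalize AffineMap.lineMap (x : ℝ) (y : ℝ) s = t
  intro ht
  change f (F.edge p _ t) = F.edge p _ (k t)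
  rcases eq_or_lt_of_le ht.1 with rfl | h1
  · rw [hkx, PMMap.edge_coe p rfl, PMMap.edge_coe p rfl, h.apply_rightLim hm]
  rcases eq_or_lt_of_le ht.2 with rfl | h2
  · rw [hky, PMMap.edge_coe p hm.idx_eq.symm, PMMap.edge_coe p (F.idx_rightLim_eq hm),
      h.apply_leftLim hm]
  obtain ⟨w, rfl⟩ := hm.2 t ⟨h1, h2⟩
  have hw : w ∈ F.between x y := ⟨h1, h2⟩
  rw [hk w hw, PMMap.edge_coe p (F.idx_toFun hm hw), h.commutes]
  exact congrArg f (PMMap.edge_coe p (F.idx_of_mem_Icc hm.idx_eq hw.1.le hw.2.le))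

end IsInducedBy

/-! ### Traces and exact sequences -/

section TraceExact

variable {A X B : Type*} [AddCommGroup A] [Module ℝ A] [AddCommGroup X] [Module ℝ X]
  [AddCommGroup B] [Module ℝ B]

/-- The trace is additive on short exact sequences. -/
theorem trace_eq_add_of_exact [FiniteDimensional ℝ X] {j : A →ₗ[ℝ] X} {k : X →ₗ[ℝ] B}
    (hj : Function.Injective j) (hk : Function.Surjective k)
    (hex : LinearMap.range j = LinearMap.ker k) {S : Module.End ℝ A} {T : Module.End ℝ X}
    {U : Module.End ℝ B} (h1 : T ∘ₗ j = j ∘ₗ S) (h2 : k ∘ₗ T = U ∘ₗ k) :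
    LinearMap.trace ℝ X T = LinearMap.trace ℝ A S + LinearMap.trace ℝ B U := by
  have : FiniteDimensional ℝ A := FiniteDimensional.of_injective j hj
  have : FiniteDimensional ℝ B := FiniteDimensional.of_surjective k hk
  obtain ⟨σ, hσ⟩ := k.exists_rightInverse_of_surjective (LinearMap.range_eq_top.2 hk)
  obtain ⟨π₀, hπ₀⟩ := j.exists_leftInverse_of_injective (LinearMap.ker_eq_bot.2 hj)
  have hkj : k ∘ₗ j = 0 := by
    ext a
    exact (hex.le ⟨a, rfl⟩ : j a ∈ LinearMap.ker k)
  let π : X →ₗ[ℝ] A := π₀ ∘ₗ (LinearMap.id - σ ∘ₗ k)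
  have hπj : π ∘ₗ j = LinearMap.id := by
    simp only [π, LinearMap.comp_assoc, LinearMap.sub_comp, hkj, LinearMap.comp_zero, sub_zero,
      LinearMap.id_comp, hπ₀]
  have hid : j ∘ₗ π + σ ∘ₗ k = LinearMap.id := by
    ext x
    have hx : x - σ (k x) ∈ LinearMap.range j := by
      rw [hex, LinearMap.mem_ker, map_sub]
      exact sub_eq_zero.2 (LinearMap.congr_fun hσ (k x)).symm
    obtain ⟨a, ha⟩ := hx
    have hπ : π x = a := by
      change π₀ (x - σ (k x)) = a
      rw [← ha]
      exact LinearMap.congr_fun hπ₀ a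
    change j (π x) + σ (k x) = x
    rw [hπ, ha, sub_add_cancel]
  calc LinearMap.trace ℝ X T = LinearMap.trace ℝ X (T ∘ₗ (j ∘ₗ π + σ ∘ₗ k)) := by
        rw [hid, LinearMap.comp_id]
    _ = LinearMap.trace ℝ X ((T ∘ₗ j) ∘ₗ π) + LinearMap.trace ℝ X ((T ∘ₗ σ) ∘ₗ k) := by
        rw [LinearMap.comp_add, map_add, LinearMap.comp_assoc, LinearMap.comp_assoc]
    _ = LinearMap.trace ℝ A (π ∘ₗ T ∘ₗ j) + LinearMap.trace ℝ B (k ∘ₗ T ∘ₗ σ) := by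
        rw [LinearMap.trace_comp_comm', LinearMap.trace_comp_comm' (T ∘ₗ σ)]
    _ = LinearMap.trace ℝ A S + LinearMap.trace ℝ B U := by
        rw [h1, ← LinearMap.comp_assoc, hπj, LinearMap.id_comp, ← LinearMap.comp_assoc σ T k, h2,
          LinearMap.comp_assoc, hσ, LinearMap.comp_id]

/-- Hopf's trace formula for a complex `X → Y` of finite-dimensional spaces. -/
theorem trace_sub_trace_of_exact {Y : Type*} [AddCommGroup Y] [Module ℝ Y]
    [FiniteDimensional ℝ X] [FiniteDimensional ℝ Y] {d : X →ₗ[ℝ] Y} {k : Y →ₗ[ℝ] B}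
    (hk : Function.Surjective k) (hex : LinearMap.ker k = LinearMap.range d)
    {T : Module.End ℝ X} {S : Module.End ℝ Y} {U : Module.End ℝ B} (hd : d ∘ₗ T = S ∘ₗ d)
    (hku : k ∘ₗ S = U ∘ₗ k) (hT : ∀ x ∈ LinearMap.ker d, T x ∈ LinearMap.ker d) :
    LinearMap.trace ℝ B U - LinearMap.trace ℝ (LinearMap.ker d) (T.restrict hT) =
      LinearMap.trace ℝ Y S - LinearMap.trace ℝ X T := by
  have hS : ∀ y ∈ LinearMap.range d, S y ∈ LinearMap.range d := by
    rintro _ ⟨x, rfl⟩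
    exact ⟨T x, LinearMap.congr_fun hd x⟩
  have h1 := trace_eq_add_of_exact (j := (LinearMap.ker d).subtype) (k := d.rangeRestrict)
    (S := T.restrict hT) (T := T) (U := S.restrict hS) Subtype.val_injective
    d.surjective_rangeRestrict (by rw [Submodule.range_subtype, LinearMap.ker_rangeRestrict])
    rfl (by
      ext x
      exact LinearMap.congr_fun hd x)
  have h2 := trace_eq_add_of_exact (j := (LinearMap.range d).subtype) (k := k)
    (S := S.restrict hS) (T := S) (U := U) Subtype.val_injective hk
    (by rw [Submodule.range_subtype, hex]) rfl hku
  rw [h1, h2]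
  ring

/-- Two endomorphisms that are intertwined with the same endomorphism by injections with the same
range have the same trace. -/
theorem trace_eq_of_range_eq {Q : Type*} [AddCommGroup Q] [Module ℝ Q] {j : A →ₗ[ℝ] Q}
    {j' : B →ₗ[ℝ] Q} (hj : Function.Injective j) (hj' : Function.Injective j')
    (h : LinearMap.range j = LinearMap.range j') {S : Module.End ℝ A} {U : Module.End ℝ B}
    {φ : Module.End ℝ Q} (h1 : ∀ a, φ (j a) = j (S a)) (h2 : ∀ b, φ (j' b) = j' (U b)) :
    LinearMap.trace ℝ A S = LinearMap.trace ℝ B U := by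
  let e : A ≃ₗ[ℝ] B := (LinearEquiv.ofInjective j hj).trans
    ((LinearEquiv.ofEq _ _ h).trans (LinearEquiv.ofInjective j' hj').symm)
  have he : ∀ a, j' (e a) = j a := by
    intro a
    have := LinearEquiv.apply_symm_apply (LinearEquiv.ofInjective j' hj')
      (LinearEquiv.ofEq _ _ h (LinearEquiv.ofInjective j hj a))
    exact congrArg Subtype.val this
  have : U = e.conj S := by
    ext b
    apply hj'
    obtain ⟨a, rfl⟩ := e.surjective b
    rw [LinearEquiv.conj_apply_apply, LinearEquiv.symm_apply_apply, he, ← h1, ← h2, he]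
  rw [this, LinearMap.trace_conj']

theorem trace_finsupp {ι : Type*} [Fintype ι] (T : Module.End ℝ (ι →₀ ℝ)) :
    LinearMap.trace ℝ _ T = ∑ i, T (Finsupp.single i 1) i := by
  classical
  rw [LinearMap.trace_eq_matrix_trace ℝ Finsupp.basisSingleOne]
  simp [Matrix.trace, LinearMap.toMatrix_apply]

end TraceExact

/-! ### Graphs as quotients of `Ω` -/

/-- `p` presents `G` as a quotient of `Ω` in which only points of the boundary are identified. -/
structure IsGluing {G : Type u} [TopologicalSpace G] (F : PMMap) (p : C(F.Sp, G)) : Prop where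
  surjective : Function.Surjective p
  eq_of_apply_eq : ∀ {x y : F.Sp}, p x = p y → x ∉ F.boundary → x = y

namespace IsGluing

variable {G : Type u} [TopologicalSpace G] {F : PMMap} {p : C(F.Sp, G)}

instance : CompactSpace F.Sp := isCompact_iff_compactSpace.1 F.isCompact_omega

theorem mem_boundary_of_apply_eq (h : IsGluing F p) {x y : F.Sp} (hxy : p x = p y)
    (hx : x ∈ F.boundary) : y ∈ F.boundary := by
  by_contra hy
  exact hy (h.eq_of_apply_eq hxy.symm hy ▸ hx)

/-- A function on `Ω` descends to `G` as soon as it is compatible with the identification of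
points of the boundary. -/
theorem exists_descent (h : IsGluing F p) {Y : Type*} (T : F.Sp → Y)
    (hT : ∀ x ∈ F.boundary, ∀ y ∈ F.boundary, p x = p y → T x = T y) :
    ∃ q : G → Y, ∀ x, q (p x) = T x := by
  refine ⟨fun g => T (h.surjective g).choose, fun x => ?_⟩
  have hx := (h.surjective (p x)).choose_spec
  by_cases hb : x ∈ F.boundary
  · exact hT _ (h.mem_boundary_of_apply_eq hx.symm hb) _ hb hx
  · exact congrArg T (h.eq_of_apply_eq hx.symm hb).symm

variable [T2Space G]

theorem isQuotientMap (h : IsGluing F p) : IsQuotientMap p :=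
  p.continuous.isClosedMap.isQuotientMap p.continuous h.surjective

theorem isQuotientMap_prod (h : IsGluing F p) (Y : Type*) [TopologicalSpace Y] :
    IsQuotientMap (Prod.map p (id : Y → Y)) :=
  (p.continuous.isProperMap.prodMap isProperMap_id).isClosedMap.isQuotientMap
    (p.continuous.prodMap continuous_id) (h.surjective.prodMap Function.surjective_id)

theorem exists_continuous_descent (h : IsGluing F p) {Y : Type*} [TopologicalSpace Y]
    (T : C(F.Sp, Y)) (hT : ∀ x ∈ F.boundary, ∀ y ∈ F.boundary, p x = p y → T x = T y) :
    ∃ q : C(G, Y), ∀ x, q (p x) = T x := by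
  obtain ⟨q, hq⟩ := h.exists_descent T hT
  refine ⟨⟨q, h.isQuotientMap.continuous_iff.2 ?_⟩, hq⟩
  exact T.continuous.congr fun x => (hq x).symm

/-- The functional that winds once along the `j`-th edge, and not along the others. -/
theorem exists_winding_edge (h : IsGluing F p) (j : Fin F.m) :
    ∃ φ : OneChains G →ₗ[ℝ] ℝ, ∀ i, φ (F.pathTo p (F.rightPt i)) = if i = j then 1 else 0 := by
  have hab := F.a_lt_b j
  let τ : C(ℝ, ℝ) := ⟨fun t => (max (F.a j) (min (F.b j) t) - F.a j) / (F.b j - F.a j), by fun_prop⟩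
  have hτ0 : ∀ t ≤ F.a j, τ t = 0 := fun t ht => by
    change (max (F.a j) (min (F.b j) t) - F.a j) / (F.b j - F.a j) = 0
    rw [min_eq_right (ht.trans hab.le), max_eq_left ht, sub_self, zero_div]
  have hτ1 : ∀ t, F.b j ≤ t → τ t = 1 := fun t ht => by
    change (max (F.a j) (min (F.b j) t) - F.a j) / (F.b j - F.a j) = 1
    rw [min_eq_left ht, max_eq_right hab.le, div_self (sub_ne_zero.2 hab.ne')]
  have h01 : ((0 : ℝ) : AddCircle (1 : ℝ)) = ((1 : ℝ) : AddCircle (1 : ℝ)) := by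
    rw [AddCircle.coe_zero, AddCircle.coe_period]
  have hb : ∀ x ∈ F.boundary, ((τ (x : ℝ) : ℝ) : AddCircle (1 : ℝ)) = ((0 : ℝ) : AddCircle (1 : ℝ)) := by
    intro x hx
    have : τ x = 0 ∨ τ x = 1 := by
      obtain ⟨i, hi⟩ := hx
      rcases lt_trichotomy i j with hij | rfl | hij
      · have := F.b_lt_a i j hij
        have := F.a_lt_b i
        exact Or.inl (hτ0 _ (by rcases hi with hi | hi <;> rw [hi] <;> linarith))
      · rcases hi with hi | hi
        · exact Or.inl (hτ0 _ hi.le)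
        · exact Or.inr (hτ1 _ hi.ge)
      · have := F.b_lt_a j i hij
        have := F.a_lt_b i
        exact Or.inr (hτ1 _ (by rcases hi with hi | hi <;> rw [hi] <;> linarith))
    rcases this with h0 | h1
    · rw [h0]
    · rw [h1, h01]
  obtain ⟨q, hq⟩ := h.exists_continuous_descent
    (⟨fun x => ((τ (x : ℝ) : ℝ) : AddCircle (1 : ℝ)), by
      exact (AddCircle.continuous_mk' 1).comp (τ.continuous.comp continuous_subtype_val)⟩ :
        C(F.Sp, AddCircle (1 : ℝ)))
    (fun x hx y hy _ => (hb x hx).trans (hb y hy).symm)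
  obtain ⟨φ, hφ⟩ := exists_winding q
  refine ⟨φ, fun i => ?_⟩
  have hv := hφ (F.edge p i) (τ.comp ⟨fun t => (F.clampPt i t : ℝ), by fun_prop⟩) (F.a i) (F.b i)
    (F.a_lt_b i).le (fun t _ => hq _)
  unfold PMMap.pathTo
  rw [F.idx_rightPt]
  refine hv.trans ?_
  change τ (F.clampPt i (F.b i) : ℝ) - τ (F.clampPt i (F.a i) : ℝ) = _
  rw [F.clampPt_apply (right_mem_Icc.2 (F.a_lt_b i).le),
    F.clampPt_apply (left_mem_Icc.2 (F.a_lt_b i).le)]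
  rcases lt_trichotomy i j with hij | rfl | hij
  · have := F.b_lt_a i j hij
    have := F.a_lt_b i
    rw [hτ0 _ (by linarith), hτ0 _ (by linarith), if_neg hij.ne, sub_self]
  · rw [hτ0 _ le_rfl, hτ1 _ le_rfl, if_pos rfl, sub_zero]
  · have := F.b_lt_a j i hij
    have := F.a_lt_b i
    rw [hτ1 _ (by linarith), hτ1 _ (by linarith), if_neg hij.ne', sub_self]

end IsGluing

/-! ### Functionals on one-chains of a graph that vanish on its edges -/

namespace PMMap

variable (F : PMMap)

/-- The point `3 x - a - b` of the line, truncated to the component `[a, b]` of `x`: the outer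
thirds of the component are pushed to its ends. -/
def push (x : F.Sp) : ℝ :=
  max (F.a (F.idx x)) (min (F.b (F.idx x)) (3 * (x : ℝ) - F.a (F.idx x) - F.b (F.idx x)))

theorem continuous_comp_idx (s : Fin F.m → ℝ) : Continuous fun x => s (F.idx x) :=
  (F.isLocallyConstant_idx.comp s).continuous

theorem continuous_push : Continuous F.push := by
  have h1 := F.continuous_comp_idx F.a
  have h2 := F.continuous_comp_idx F.b
  have h3 : Continuous fun x : F.Sp => (x : ℝ) := continuous_subtype_val
  unfold push
  fun_prop

theorem push_mem (x : F.Sp) : F.push x ∈ Icc (F.a (F.idx x)) (F.b (F.idx x)) :=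
  ⟨le_max_left _ _, max_le (F.a_lt_b _).le (min_le_left _ _)⟩

theorem push_of_mem_boundary {x : F.Sp} (hx : x ∈ F.boundary) : F.push x = x := by
  obtain ⟨i, rfl | rfl⟩ := F.mem_boundary_iff.1 hx
  · have hab := F.a_lt_b i
    unfold push
    rw [idx_leftPt]
    change max (F.a i) (min (F.b i) (3 * F.a i - F.a i - F.b i)) = F.a i
    rw [min_eq_right (by linarith), max_eq_left (by linarith)]
  · have hab := F.a_lt_b i
    unfold push
    rw [idx_rightPt]
    change max (F.a i) (min (F.b i) (3 * F.b i - F.a i - F.b i)) = F.b i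
    rw [min_eq_left (by linarith), max_eq_right (by linarith)]

/-- The homotopy from the identity of `Ω` to the map that pushes the outer thirds of the
components to their ends. -/
def pushHomotopy : C(F.Sp × ℝ, F.Sp) where
  toFun z := ⟨(z.1 : ℝ) + (max 0 (min 1 z.2)) * (F.push z.1 - z.1), F.idx z.1, by
    have h1 := F.push_mem z.1
    have h2 := F.idx_mem z.1
    have h3 : 0 ≤ max 0 (min 1 z.2) := le_max_left _ _
    have h4 : max 0 (min 1 z.2) ≤ 1 := max_le zero_le_one (min_le_left _ _)
    constructor
    · nlinarith [h1.1, h2.1]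
    · nlinarith [h1.2, h2.2]⟩
  continuous_toFun := by
    refine Continuous.subtype_mk ?_ _
    have h1 := F.continuous_push
    have h3 : Continuous fun x : F.Sp => (x : ℝ) := continuous_subtype_val
    fun_prop

theorem pushHomotopy_coe (x : F.Sp) (τ : ℝ) :
    (F.pushHomotopy (x, τ) : ℝ) = x + max 0 (min 1 τ) * (F.push x - x) := rfl

theorem idx_pushHomotopy (x : F.Sp) (τ : ℝ) : F.idx (F.pushHomotopy (x, τ)) = F.idx x :=
  F.idx_eq_of_mem (by
    have h1 := F.push_mem x
    have h2 := F.idx_mem x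
    have h3 : 0 ≤ max 0 (min 1 τ) := le_max_left _ _
    have h4 : max 0 (min 1 τ) ≤ 1 := max_le zero_le_one (min_le_left _ _)
    rw [pushHomotopy_coe]
    constructor
    · nlinarith [h1.1, h2.1]
    · nlinarith [h1.2, h2.2])

theorem pushHomotopy_zero (x : F.Sp) : F.pushHomotopy (x, 0) = x :=
  Subtype.ext (by simp [pushHomotopy_coe])

theorem pushHomotopy_one (x : F.Sp) : (F.pushHomotopy (x, 1) : ℝ) = F.push x := by
  simp [pushHomotopy_coe]

theorem pushHomotopy_of_mem_boundary {x : F.Sp} (hx : x ∈ F.boundary) (τ : ℝ) :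
    F.pushHomotopy (x, τ) = x :=
  Subtype.ext (by simp [pushHomotopy_coe, F.push_of_mem_boundary hx])

/-- The middle thirds of the components of `Ω`. -/
def middle : Set F.Sp :=
  {x | F.a (F.idx x) ≤ 3 * (x : ℝ) - F.a (F.idx x) - F.b (F.idx x) ∧
    3 * (x : ℝ) - F.a (F.idx x) - F.b (F.idx x) ≤ F.b (F.idx x)}

theorem isClosed_middle : IsClosed F.middle := by
  have h1 := F.continuous_comp_idx F.a
  have h2 := F.continuous_comp_idx F.b
  have h3 : Continuous fun x : F.Sp => (x : ℝ) := continuous_subtype_val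
  have h4 : Continuous fun x : F.Sp => 3 * (x : ℝ) - F.a (F.idx x) - F.b (F.idx x) := by fun_prop
  exact (isClosed_le h1 h4).inter (isClosed_le h4 h2)

theorem not_mem_middle {x : F.Sp} (hx : x ∈ F.boundary) : x ∉ F.middle := by
  rintro ⟨h1, h2⟩
  obtain ⟨i, rfl | rfl⟩ := F.mem_boundary_iff.1 hx
  · have hab := F.a_lt_b i
    rw [idx_leftPt] at h1
    change F.a i ≤ 3 * F.a i - F.a i - F.b i at h1
    linarith
  · have hab := F.a_lt_b i
    rw [idx_rightPt] at h2
    change 3 * F.b i - F.a i - F.b i ≤ F.b i at h2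
    linarith

theorem pushHomotopy_one_mem {x : F.Sp} (hx : x ∉ F.middle) :
    F.pushHomotopy (x, 1) ∈ F.boundary := by
  have hab := F.a_lt_b (F.idx x)
  refine ⟨F.idx x, ?_⟩
  rw [pushHomotopy_one]
  unfold push
  by_cases h : F.a (F.idx x) ≤ 3 * (x : ℝ) - F.a (F.idx x) - F.b (F.idx x)
  · have h2 : F.b (F.idx x) < 3 * (x : ℝ) - F.a (F.idx x) - F.b (F.idx x) :=
      not_le.1 fun h2 => hx ⟨h, h2⟩
    right
    rw [min_eq_left h2.le, max_eq_right hab.le]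
  · left
    rw [min_eq_right (by linarith), max_eq_left (by linarith)]

end PMMap

namespace IsGluing

variable {G : Type u} [TopologicalSpace G] {F : PMMap} {p : C(F.Sp, G)}

section

variable {φ : OneChains G →ₗ[ℝ] ℝ}

theorem apply_edge_eq_zero (hφ : ∀ x, φ (F.pathTo p x) = 0) (i : Fin F.m) (s t : ℝ) :
    φ (segClass (F.edge p i) s t) = 0 := by
  have he : F.edge p i = (F.edge p i).comp ⟨fun r => (F.clampPt i r : ℝ), by fun_prop⟩ := by
    ext r
    exact congrArg p (F.clampPt_coe (F.idx_clampPt i r)).symm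
  rw [he, segClass_comp]
  change φ (segClass (F.edge p i) (F.clampPt i s : ℝ) (F.clampPt i t : ℝ)) = 0
  rw [← F.pathTo_sub p (F.idx_clampPt i s) (F.idx_clampPt i t), map_sub, hφ, hφ, sub_zero]

variable [T2Space G]

/-- Away from the vertices a path is locally the composition of an edge with a path in the line. -/
theorem exists_nhds_of_not_mem (h : IsGluing F p) (hφ : ∀ x, φ (F.pathTo p x) = 0) (g : C(ℝ, G))
    {s : ℝ} (hs : g s ∉ p '' F.boundary) :
    ∃ U ∈ 𝓝 s, ∀ t ∈ U, φ (segClass g s t) = 0 := by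
  classical
  obtain ⟨x, hx⟩ := h.surjective (g s)
  set i := F.idx x with hi
  let W : Set F.Sp := {z | z ∈ F.boundary ∨ F.idx z ≠ i}
  have hWc : IsClosed W :=
    F.finite_boundary.isClosed.union (F.isClosed_idx_preimage {i}ᶜ)
  have hU : IsOpen (p '' W)ᶜ := (p.continuous.isClosedMap _ hWc).isOpen_compl
  have hWp : ∀ z, p z ∈ (p '' W)ᶜ → z ∉ F.boundary ∧ F.idx z = i := by
    intro z hz
    by_contra hcon
    refine hz ⟨z, ?_, rfl⟩
    by_cases hb : z ∈ F.boundary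
    · exact Or.inl hb
    · exact Or.inr fun he => hcon ⟨hb, he⟩
  have hsU : g s ∈ (p '' W)ᶜ := by
    rintro ⟨z, hz | hz, he⟩
    · exact hs ⟨z, hz, he⟩
    · have hxb : x ∉ F.boundary := fun hb => hs ⟨x, hb, hx⟩
      have := h.eq_of_apply_eq (hx.trans he.symm) hxb
      exact hz (this ▸ rfl)
  let co : G → ℝ := fun y => ((h.surjective y).choose : ℝ)
  have hco : ∀ z, p z ∈ (p '' W)ᶜ → co (p z) = z := by
    intro z hz
    have := (h.surjective (p z)).choose_spec
    exact congrArg Subtype.val (h.eq_of_apply_eq this.symm (hWp z hz).1).symm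
  have hcc : ContinuousOn co (p '' W)ᶜ := by
    rw [h.isQuotientMap.continuousOn_isOpen_iff hU]
    exact continuous_subtype_val.continuousOn.congr fun z hz => hco z hz
  obtain ⟨ε, hε, hball⟩ := Metric.mem_nhds_iff.1 (g.continuous.continuousAt (hU.mem_nhds hsU))
  refine ⟨Metric.ball s ε, Metric.ball_mem_nhds s hε, fun t ht => ?_⟩
  have hsub : ∀ r ∈ Icc (0 : ℝ) 1, g (AffineMap.lineMap s t r) ∈ (p '' W)ᶜ := fun r hr =>
    hball ((convex_ball s ε).segment_subset (Metric.mem_ball_self hε) ht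
      (segment_eq_image_lineMap ℝ s t ▸ ⟨r, hr, rfl⟩))
  have hk : ContinuousOn (fun r => co (g (AffineMap.lineMap s t r))) (Icc (0 : ℝ) 1) :=
    hcc.comp (by
      simp only [AffineMap.lineMap_apply_module]
      fun_prop) hsub
  let k : C(ℝ, ℝ) := ⟨_, hk.domRestrict.Icc_extend' (h := zero_le_one)⟩
  have hkv : ∀ r ∈ Icc (0 : ℝ) 1, k r = co (g (AffineMap.lineMap s t r)) := fun r hr =>
    IccExtend_of_mem zero_le_one
      ((Icc (0 : ℝ) 1).domRestrict fun r => co (g (AffineMap.lineMap s t r))) hr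
  have : segClass g s t = segClass ((F.edge p i).comp k) 0 1 := by
    refine segClass_congr fun r hr => ?_
    have hr' : AffineMap.lineMap (0 : ℝ) 1 r = r := by simp [AffineMap.lineMap_apply]
    rw [hr', ContinuousMap.comp_apply, hkv r hr]
    obtain ⟨z, hz⟩ := h.surjective (g (AffineMap.lineMap s t r))
    have hm := hsub r hr
    rw [← hz] at hm ⊢
    rw [hco z hm, PMMap.edge_coe p (hWp z hm).2]
  rw [this, segClass_comp]
  exact apply_edge_eq_zero hφ i _ _

/-- A functional that vanishes on the edges vanishes. -/
theorem eq_zero_of_pathTo (h : IsGluing F p) (hφ : ∀ x, φ (F.pathTo p x) = 0) : φ = 0 := by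
  have hV : IsDiscrete (p '' F.boundary) := (F.finite_boundary.image p).isDiscrete
  -- The homotopy descends to `G`; its tracks run along the edges.
  have hfac : ∀ z z' : F.Sp × ℝ, Prod.map p id z = Prod.map p id z' →
      p (F.pushHomotopy z) = p (F.pushHomotopy z') := by
    rintro ⟨x, τ⟩ ⟨x', τ'⟩ he
    obtain rfl : τ = τ' := congrArg Prod.snd he
    replace he : p x = p x' := congrArg Prod.fst he
    by_cases hb : x ∈ F.boundary
    · rw [F.pushHomotopy_of_mem_boundary hb,
        F.pushHomotopy_of_mem_boundary (h.mem_boundary_of_apply_eq he hb)]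
      exact he
    · rw [h.eq_of_apply_eq he hb]
  let D : C(G × ℝ, G) :=
    (h.isQuotientMap_prod ℝ).lift (f := ⟨Prod.map p id, by fun_prop⟩) (p.comp F.pushHomotopy) hfac
  have hD : ∀ x τ, D (p x, τ) = p (F.pushHomotopy (x, τ)) := fun x τ =>
    DFunLike.congr_fun ((h.isQuotientMap_prod ℝ).lift_comp (f := ⟨Prod.map p id, by fun_prop⟩)
      (p.comp F.pushHomotopy) hfac) (x, τ)
  have key : ∀ g : C(ℝ, G), φ (segClass g 0 1) = 0 := by
    intro g
    refine apply_segClass_eq_zero φ g (fun s => ?_) 0 1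
    by_cases hs : g s ∉ p '' F.boundary
    · exact h.exists_nhds_of_not_mem hφ g hs
    rw [not_not] at hs
    let H : C(ℝ × ℝ, G) := D.comp ⟨fun z => (g z.1, z.2), by fun_prop⟩
    have htrack : ∀ t, φ (segClass (H.comp ⟨fun τ => (t, τ), by fun_prop⟩) 0 1) = 0 := by
      intro t
      obtain ⟨x, hx⟩ := h.surjective (g t)
      have : H.comp ⟨fun τ => (t, τ), by fun_prop⟩ = (F.edge p (F.idx x)).comp
          ⟨fun τ => (F.pushHomotopy (x, τ) : ℝ), continuous_subtype_val.comp
            (F.pushHomotopy.continuous.comp (by fun_prop))⟩ := by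
        ext τ
        change D (g t, τ) = F.edge p _ (F.pushHomotopy (x, τ) : ℝ)
        rw [← hx, hD, PMMap.edge_coe p (F.idx_pushHomotopy x τ)]
      rw [this, segClass_comp]
      exact apply_edge_eq_zero hφ _ _ _
    have hU : IsOpen (p '' F.middle)ᶜ := (p.continuous.isClosedMap _ F.isClosed_middle).isOpen_compl
    have hsU : g s ∈ (p '' F.middle)ᶜ := by
      obtain ⟨x, hx, hxs⟩ := hs
      rintro ⟨z, hz, hzs⟩
      exact F.not_mem_middle (h.mem_boundary_of_apply_eq (hxs.trans hzs.symm) hx) hz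
    obtain ⟨ε, hε, hball⟩ := Metric.mem_nhds_iff.1 (g.continuous.continuousAt (hU.mem_nhds hsU))
    refine ⟨Metric.ball s ε, Metric.ball_mem_nhds s hε, fun t ht => ?_⟩
    have hhom := congrArg φ (segClass_homotopy H s t)
    rw [map_add, map_add, htrack, htrack, add_zero, zero_add] at hhom
    have h0 : H.comp ⟨fun t => (t, 0), by fun_prop⟩ = g := by
      ext t
      obtain ⟨x, hx⟩ := h.surjective (g t)
      change D (g t, 0) = g t
      rw [← hx, hD, F.pushHomotopy_zero]
    rw [h0] at hhom
    rw [hhom]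
    -- Near `s` the end of the homotopy takes values in the finite set of vertices.
    have hmaps : MapsTo (fun r => H (r, 1)) (Metric.ball s ε) (p '' F.boundary) := by
      intro r hr
      obtain ⟨x, hx⟩ := h.surjective (g r)
      have hxm : x ∉ F.middle := fun hm => hball hr ⟨x, hm, hx⟩
      change D (g r, 1) ∈ _
      rw [← hx, hD]
      exact ⟨_, F.pushHomotopy_one_mem hxm, rfl⟩
    have hconst : ∀ r ∈ Metric.ball s ε, H (r, 1) = H (s, 1) := fun r hr =>
      (convex_ball s ε).isPreconnected.constant_of_mapsTo hV
        (f := fun r => H (r, 1)) (by fun_prop) hmaps hr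
        (Metric.mem_ball_self hε)
    rw [segClass_eq_zero, map_zero]
    intro r hr
    exact hconst _ ((convex_ball s ε).segment_subset (Metric.mem_ball_self hε) ht
      (segment_eq_image_lineMap ℝ s t ▸ ⟨r, hr, rfl⟩))
  refine LinearMap.ext_on_range span_pathClass fun γ => ?_
  obtain ⟨g, hg⟩ := pathClass_eq_segClass γ
  rw [hg, key]
  rfl

end

end IsGluing

/-! ### The homology of a graph in terms of edges and vertices -/

/-- A map into a finite set induces a map of `0`-chains, whether or not it is continuous. -/
theorem exists_zeroChain_map {G : Type u} [TopologicalSpace G] {ι : Type*} [Fintype ι]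
    (r : G → ι) : ∃ ρ : ZeroChains G →ₗ[ℝ] (ι →₀ ℝ), ∀ x, ρ (pointChain x) = Finsupp.single (r x) 1 := by
  classical
  choose φ hφ using fun i : ι => exists_zeroCochain fun x : G => if r x = i then (1 : ℝ) else 0
  refine ⟨(Finsupp.linearEquivFunOnFinite ℝ ℝ ι).symm.toLinearMap ∘ₗ LinearMap.pi φ, fun x => ?_⟩
  ext i
  simp [hφ, Finsupp.single_apply]

namespace IsGluing

variable {G : Type u} [TopologicalSpace G] {F : PMMap} {p : C(F.Sp, G)}

instance : Fintype (p '' F.boundary) := (F.finite_boundary.image p).fintype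

variable (p) in
/-- The vertex `p(x)` of `G` given by a point `x` of the boundary.  Here and in what follows all
points of `p(∂Ω)` are regarded as vertices, including those around which `G` is a line. -/
def vert (x : F.boundary) : p '' F.boundary := ⟨p x, x, x.2, rfl⟩

variable (p) in
/-- The vertex of `G` at the left end of the `i`-th edge. -/
def leftVert (i : Fin F.m) : p '' F.boundary := vert p ⟨F.leftPt i, F.leftPt_mem_boundary i⟩

variable (p) in
/-- The vertex of `G` at the right end of the `i`-th edge. -/
def rightVert (i : Fin F.m) : p '' F.boundary := vert p ⟨F.rightPt i, F.rightPt_mem_boundary i⟩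

open Classical in
variable (p) in
/-- The retraction of `Ω` onto the vertices of `G` that collapses every edge, without its right
end, to its left end. -/
def retractSp (x : F.Sp) : p '' F.boundary :=
  if x = F.rightPt (F.idx x) then rightVert p (F.idx x) else leftVert p (F.idx x)

theorem retractSp_rightPt (i : Fin F.m) : retractSp p (F.rightPt i) = rightVert p i := by
  unfold retractSp
  rw [F.idx_rightPt, if_pos rfl]

theorem leftPt_ne_rightPt (i : Fin F.m) : F.leftPt i ≠ F.rightPt i := fun h =>
  (F.a_lt_b i).ne (congrArg Subtype.val h)

theorem retractSp_of_mem_boundary {x : F.Sp} (hx : x ∈ F.boundary) :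
    (retractSp p x : G) = p x := by
  obtain ⟨i, rfl | rfl⟩ := F.mem_boundary_iff.1 hx
  · unfold retractSp
    rw [F.idx_leftPt, if_neg (leftPt_ne_rightPt i)]
    rfl
  · rw [retractSp_rightPt]
    rfl

theorem exists_retract (h : IsGluing F p) :
    ∃ r : G → p '' F.boundary, ∀ x, r (p x) = retractSp p x :=
  h.exists_descent _ fun x hx y hy hxy => Subtype.ext (by
    rw [retractSp_of_mem_boundary hx, retractSp_of_mem_boundary hy, hxy])

/-- The retraction of `G` onto its vertices that collapses every edge, without its right end, to
its left end. -/
def retract (h : IsGluing F p) : G → p '' F.boundary := h.exists_retract.choose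

theorem retract_apply (h : IsGluing F p) (x : F.Sp) : h.retract (p x) = retractSp p x :=
  h.exists_retract.choose_spec x

theorem retract_vertex (h : IsGluing F p) (v : p '' F.boundary) : h.retract v = v := by
  obtain ⟨_, x, hx, rfl⟩ := v
  exact Subtype.ext ((congrArg Subtype.val (h.retract_apply x)).trans (retractSp_of_mem_boundary hx))

variable (p) in
/-- The boundary map of the cellular chain complex: the `i`-th edge goes to the difference of its
ends. -/
def endsMap : (Fin F.m →₀ ℝ) →ₗ[ℝ] (p '' F.boundary →₀ ℝ) :=
  Finsupp.linearCombination ℝ fun i =>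
    Finsupp.single (rightVert p i) 1 - Finsupp.single (leftVert p i) 1

variable (p) in
/-- The `1`-chain given by a combination of edges. -/
def edgeMap : (Fin F.m →₀ ℝ) →ₗ[ℝ] OneChains G :=
  Finsupp.linearCombination ℝ fun i => F.pathTo p (F.rightPt i)

variable (p) in
/-- The `0`-chain given by a combination of vertices. -/
def vertexMap : (p '' F.boundary →₀ ℝ) →ₗ[ℝ] ZeroChains G :=
  Finsupp.linearCombination ℝ fun v => pointChain (v : G)

theorem endsMap_single (i : Fin F.m) : endsMap p (Finsupp.single i 1) =
    Finsupp.single (rightVert p i) 1 - Finsupp.single (leftVert p i) 1 := by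
  simp [endsMap]

theorem edgeMap_single (i : Fin F.m) :
    edgeMap p (Finsupp.single i 1) = F.pathTo p (F.rightPt i) := by
  simp [edgeMap]

theorem vertexMap_single (v : p '' F.boundary) :
    vertexMap p (Finsupp.single v 1) = pointChain (v : G) := by
  simp [vertexMap]

theorem boundaryMap_edgeMap (z : Fin F.m →₀ ℝ) :
    boundaryMap G (edgeMap p z) = vertexMap p (endsMap p z) := by
  suffices boundaryMap G ∘ₗ edgeMap p = vertexMap p ∘ₗ endsMap p from LinearMap.congr_fun this z
  refine Finsupp.lhom_ext' fun i => LinearMap.ext_ring ?_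
  change boundaryMap G (edgeMap p (Finsupp.single i 1)) = vertexMap p (endsMap p (Finsupp.single i 1))
  rw [edgeMap_single, endsMap_single, map_sub, vertexMap_single, vertexMap_single,
    F.boundaryMap_pathTo, F.idx_rightPt]
  rfl

theorem exists_retractChain (h : IsGluing F p) : ∃ ρ : ZeroChains G →ₗ[ℝ] (p '' F.boundary →₀ ℝ),
    ∀ x, ρ (pointChain x) = Finsupp.single (h.retract x) 1 := exists_zeroChain_map _

/-- The map of `0`-chains induced by the retraction onto the vertices. -/
def retractChain (h : IsGluing F p) : ZeroChains G →ₗ[ℝ] (p '' F.boundary →₀ ℝ) :=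
  h.exists_retractChain.choose

theorem retractChain_pointChain (h : IsGluing F p) (x : G) :
    h.retractChain (pointChain x) = Finsupp.single (h.retract x) 1 :=
  h.exists_retractChain.choose_spec x

theorem retractChain_vertexMap (h : IsGluing F p) (c : p '' F.boundary →₀ ℝ) :
    h.retractChain (vertexMap p c) = c := by
  suffices h.retractChain ∘ₗ vertexMap p = LinearMap.id from LinearMap.congr_fun this c
  refine Finsupp.lhom_ext' fun i => LinearMap.ext_ring ?_
  change h.retractChain (vertexMap p (Finsupp.single i 1)) = Finsupp.single i 1
  rw [vertexMap_single, retractChain_pointChain, retract_vertex]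

theorem vertexMap_injective (h : IsGluing F p) : Function.Injective (vertexMap p) :=
  Function.LeftInverse.injective h.retractChain_vertexMap

theorem boundaryMap_edgeMap_eq_zero_iff (h : IsGluing F p) {z : Fin F.m →₀ ℝ} :
    boundaryMap G (edgeMap p z) = 0 ↔ z ∈ LinearMap.ker (endsMap p) := by
  rw [boundaryMap_edgeMap, LinearMap.mem_ker]
  exact ⟨fun he => h.vertexMap_injective (he.trans (map_zero _).symm), fun he => by rw [he, map_zero]⟩

/-- Every point is joined with a vertex, so the vertices span the homology in degree zero. -/
theorem surjective_projection (h : IsGluing F p) :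
    Function.Surjective (homologyProjection G ∘ₗ vertexMap p) := by
  rw [← LinearMap.range_eq_top, eq_top_iff,
    ← LinearMap.range_eq_top.2 (homologyProjection_surjective (G := G)), LinearMap.range_eq_map,
    ← span_pointChain, Submodule.map_span, Submodule.span_le]
  rintro _ ⟨_, ⟨y, rfl⟩, rfl⟩
  obtain ⟨x, rfl⟩ := h.surjective y
  refine ⟨Finsupp.single (leftVert p (F.idx x)) 1, ?_⟩
  rw [LinearMap.comp_apply, vertexMap_single, eq_comm, ← sub_eq_zero, ← map_sub,
    ← LinearMap.mem_ker, ker_homologyProjection]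
  exact ⟨_, F.boundaryMap_pathTo p x⟩

variable [T2Space G]

/-- The winding functionals form a dual family to the edges. -/
theorem edgeMap_injective (h : IsGluing F p) : Function.Injective (edgeMap p) := by
  refine (injective_iff_map_eq_zero _).2 fun z hz => ?_
  ext j
  obtain ⟨φ, hφ⟩ := h.exists_winding_edge j
  have key : φ ∘ₗ edgeMap p = Finsupp.lapply j := by
    refine Finsupp.lhom_ext' fun i => LinearMap.ext_ring ?_
    change φ (edgeMap p (Finsupp.single i 1)) = (Finsupp.single i (1 : ℝ)) j
    rw [edgeMap_single, hφ, Finsupp.single_apply]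
  have := LinearMap.congr_fun key z
  rw [LinearMap.comp_apply, hz, map_zero] at this
  exact this.symm

/-- Up to boundaries, the cycles of `G` are combinations of edges: a functional that vanishes on the
cycles of this form agrees with a coboundary on the edges, hence everywhere, and a coboundary
vanishes on cycles. -/
theorem ker_boundaryMap_le (h : IsGluing F p) :
    LinearMap.ker (boundaryMap G) ≤ (LinearMap.ker (endsMap p)).map (edgeMap p) := by
  intro w hw
  by_contra hcon
  obtain ⟨φ, hφw, hφ⟩ := Submodule.exists_le_ker_of_notMem hcon
  have hmem : φ ∘ₗ edgeMap p ∈ LinearMap.range (endsMap p).dualMap := by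
    rw [LinearMap.range_dualMap_eq_dualAnnihilator_ker, Submodule.mem_dualAnnihilator]
    exact fun z hz => hφ ⟨z, hz, rfl⟩
  obtain ⟨ψ, hψ⟩ := hmem
  have hψ' : ∀ i, ψ (Finsupp.single (rightVert p i) 1) - ψ (Finsupp.single (leftVert p i) 1) =
      φ (F.pathTo p (F.rightPt i)) := by
    intro i
    rw [← map_sub, ← endsMap_single, ← edgeMap_single]
    exact LinearMap.congr_fun hψ (Finsupp.single i 1)
  -- The function `k` is a primitive of `φ` along the edges; it descends to `G`.
  let k : F.Sp → ℝ := fun x => ψ (Finsupp.single (leftVert p (F.idx x)) 1) + φ (F.pathTo p x)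
  have hk : ∀ x (hx : x ∈ F.boundary), k x = ψ (Finsupp.single (vert p ⟨x, hx⟩) 1) := by
    intro x hx
    obtain ⟨i, rfl | rfl⟩ := F.mem_boundary_iff.1 hx
    · simp only [k]
      rw [F.idx_leftPt, F.pathTo_leftPt, map_zero, add_zero]
      rfl
    · simp only [k]
      rw [F.idx_rightPt, ← hψ', add_sub_cancel]
      rfl
  obtain ⟨u, hu⟩ := h.exists_descent k fun x hx y hy hxy => by
    rw [hk x hx, hk y hy]
    congr 2
    exact Subtype.ext hxy
  obtain ⟨θ, hθ⟩ := exists_zeroCochain u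
  have hzero : φ - θ ∘ₗ boundaryMap G = 0 := by
    refine h.eq_zero_of_pathTo fun x => ?_
    rw [LinearMap.sub_apply, LinearMap.comp_apply, F.boundaryMap_pathTo, map_sub, hθ, hθ, hu, hu]
    simp only [k]
    rw [F.idx_leftPt, F.pathTo_leftPt, map_zero]
    ring
  have := LinearMap.congr_fun hzero w
  rw [LinearMap.sub_apply, LinearMap.comp_apply, LinearMap.mem_ker.1 hw, map_zero, sub_zero] at this
  exact hφw this

theorem map_edgeMap (h : IsGluing F p) :
    (LinearMap.ker (endsMap p)).map (edgeMap p) = LinearMap.ker (boundaryMap G) := by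
  refine le_antisymm ?_ h.ker_boundaryMap_le
  rintro _ ⟨z, hz, rfl⟩
  exact h.boundaryMap_edgeMap_eq_zero_iff.2 hz

/-- A functional on the vertices that takes equal values at the two ends of every edge extends to a
locally constant function on `G`, which annihilates boundaries. -/
theorem ker_projection (h : IsGluing F p) :
    LinearMap.ker (homologyProjection G ∘ₗ vertexMap p) = LinearMap.range (endsMap p) := by
  apply le_antisymm
  · intro c hc
    by_contra hcon
    obtain ⟨ψ, hψc, hψ⟩ := Submodule.exists_le_ker_of_notMem hcon
    let u : G → ℝ := fun y => ψ (Finsupp.single (h.retract y) 1)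
    obtain ⟨θ, hθ⟩ := exists_zeroCochain u
    have hux : ∀ x, u (p x) = ψ (Finsupp.single (leftVert p (F.idx x)) 1) := by
      intro x
      simp only [u]
      rw [h.retract_apply, retractSp]
      split_ifs
      · rw [← sub_eq_zero, ← map_sub, ← endsMap_single]
        exact hψ ⟨_, rfl⟩
      · rfl
    have hu : IsLocallyConstant u := fun s => by
      rw [← h.isQuotientMap.isOpen_preimage]
      have := (F.isLocallyConstant_idx.comp
        fun i => ψ (Finsupp.single (leftVert p i) 1)) s
      convert this using 1
      ext x
      simp [hux]
    have hzero : θ ∘ₗ boundaryMap G = 0 := by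
      refine LinearMap.ext_on_range span_pathClass fun γ => ?_
      have : PreconnectedSpace (stdSimplex ℝ (Fin 2)) :=
        Subtype.preconnectedSpace (convex_stdSimplex ℝ _).isPreconnected
      rw [LinearMap.comp_apply, boundaryMap_pathClass, map_sub, hθ, hθ, LinearMap.zero_apply,
        sub_eq_zero]
      exact (hu.comp_continuous γ.continuous).apply_eq_of_preconnectedSpace _ _
    have hc' : vertexMap p c ∈ LinearMap.ker (homologyProjection G) := hc
    rw [ker_homologyProjection] at hc'
    obtain ⟨w, hw⟩ := hc'
    have h1 : θ (vertexMap p c) = 0 := by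
      rw [← hw]
      exact LinearMap.congr_fun hzero w
    have h2 : θ ∘ₗ vertexMap p = ψ := by
      refine Finsupp.lhom_ext' fun v => LinearMap.ext_ring ?_
      change θ (vertexMap p (Finsupp.single v 1)) = ψ (Finsupp.single v 1)
      rw [vertexMap_single, hθ]
      simp only [u]
      rw [h.retract_vertex]
    exact hψc ((LinearMap.congr_fun h2 c).symm.trans h1)
  · rintro _ ⟨z, rfl⟩
    rw [LinearMap.mem_ker, LinearMap.comp_apply, ← boundaryMap_edgeMap, ← LinearMap.mem_ker,
      ker_homologyProjection]
    exact ⟨_, rfl⟩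

end IsGluing

/-! ### The Lefschetz number on edges and vertices -/

/-- The trace on the first homology group can be computed on any space of cycles that represents
it. -/
theorem trace_homologyMap_one {G : Type u} [TopologicalSpace G] (f : C(G, G)) {X : Type*}
    [AddCommGroup X] [Module ℝ X] (K : Submodule ℝ X) {j : X →ₗ[ℝ] OneChains G}
    (hj : Function.Injective j) (h : K.map j = LinearMap.ker (boundaryMap G))
    {T : Module.End ℝ X} (hT : ∀ x ∈ K, T x ∈ K) (h1 : ∀ z ∈ K, oneMap f (j z) = j (T z)) :
    LinearMap.trace ℝ K (T.restrict hT) = LinearMap.trace ℝ _ (homologyMap f 1) := by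
  have hr : LinearMap.range (j ∘ₗ K.subtype) = LinearMap.range (homologyInclusion G) := by
    rw [LinearMap.range_comp, Submodule.range_subtype, h, range_homologyInclusion]
  have hinj : Function.Injective (j ∘ₗ K.subtype) := hj.comp Subtype.val_injective
  exact trace_eq_of_range_eq (j' := homologyInclusion G) hinj
    homologyInclusion_injective hr (S := T.restrict hT) (fun a => h1 a a.2)
    fun b => (homologyInclusion_homologyMap f b).symm

namespace PMMap

variable (F : PMMap)

/-- The `0`-chain of `Ω` that is the boundary of the image of the `i`-th component under `F`. -/
def lapChain : (Fin F.m →₀ ℝ) →ₗ[ℝ] (F.Sp →₀ ℝ) :=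
  Finsupp.linearCombination ℝ fun i => ∑ l ∈ F.laps with F.idx l.1 = i,
    (Finsupp.single (F.leftLim l.2) 1 - Finsupp.single (F.rightLim l.1) 1)

theorem lapChain_single (i : Fin F.m) : F.lapChain (Finsupp.single i 1) =
    ∑ l ∈ F.laps with F.idx l.1 = i,
      (Finsupp.single (F.leftLim l.2) 1 - Finsupp.single (F.rightLim l.1) 1) := by
  simp [lapChain]

open Classical in
/-- The coefficients of a `0`-chain of `Ω` at the right ends of the components. -/
def endCoord : (F.Sp →₀ ℝ) →ₗ[ℝ] (Fin F.m →₀ ℝ) :=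
  Finsupp.linearCombination ℝ fun x =>
    if x = F.rightPt (F.idx x) then Finsupp.single (F.idx x) 1 else 0

open Classical in
theorem endCoord_single (x : F.Sp) : F.endCoord (Finsupp.single x 1) =
    if x = F.rightPt (F.idx x) then Finsupp.single (F.idx x) 1 else 0 := by
  simp [endCoord]

open Classical in
theorem endCoord_single_apply (x : F.Sp) (i : Fin F.m) : F.endCoord (Finsupp.single x 1) i =
    if x = F.rightPt i then 1 else 0 := by
  rw [endCoord_single]
  by_cases h : x = F.rightPt i
  · have hi : F.idx x = i := by rw [h, F.idx_rightPt]
    rw [if_pos h, hi, if_pos h, Finsupp.single_eq_same]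
  · rw [if_neg h]
    split_ifs with h1
    · refine Finsupp.single_eq_of_ne ?_
      rintro rfl
      exact h h1
    · rfl

/-- The endomorphism of the cellular `1`-chains induced by `F`. -/
def edgeEnd : Module.End ℝ (Fin F.m →₀ ℝ) := F.endCoord ∘ₗ F.lapChain

open Classical in
theorem trace_edgeEnd : LinearMap.trace ℝ _ F.edgeEnd = ∑ l ∈ F.laps,
    ((if F.leftLim l.2 = F.rightPt (F.idx l.1) then (1 : ℝ) else 0) -
      if F.rightLim l.1 = F.rightPt (F.idx l.1) then 1 else 0) := by
  rw [trace_finsupp, ← Finset.sum_fiberwise_of_maps_to (s := F.laps) (g := fun l => F.idx l.1)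
    (t := Finset.univ) (fun _ _ => Finset.mem_univ _)]
  refine Finset.sum_congr rfl fun i _ => ?_
  change F.endCoord (F.lapChain (Finsupp.single i 1)) i = _
  rw [lapChain_single, map_sum, Finsupp.finsetSum_apply]
  refine Finset.sum_congr rfl fun l hl => ?_
  rw [map_sub, Finsupp.sub_apply, endCoord_single_apply, endCoord_single_apply,
    (Finset.mem_filter.1 hl).2]

end PMMap

namespace IsGluing

variable {G : Type u} [TopologicalSpace G] {F : PMMap} {p : C(F.Sp, G)}

variable (p) in
/-- The `1`-chain given by a combination of the paths from the left ends of the components. -/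
def pathMap : (F.Sp →₀ ℝ) →ₗ[ℝ] OneChains G := Finsupp.linearCombination ℝ (F.pathTo p)

variable (p) in
/-- The `0`-chain of `G` that is the image of a `0`-chain of `Ω`. -/
def pointMap : (F.Sp →₀ ℝ) →ₗ[ℝ] ZeroChains G :=
  Finsupp.linearCombination ℝ fun x => pointChain (p x)

theorem pathMap_single (x : F.Sp) : pathMap p (Finsupp.single x 1) = F.pathTo p x := by
  simp [pathMap]

theorem pointMap_single (x : F.Sp) : pointMap p (Finsupp.single x 1) = pointChain (p x) := by
  simp [pointMap]

/-- Nothing cancels at points outside of the boundary, where `p` is injective. -/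
theorem apply_eq_zero_of_pointMap (h : IsGluing F p) {s : F.Sp →₀ ℝ} (hs : pointMap p s = 0)
    {x : F.Sp} (hx : x ∉ F.boundary) : s x = 0 := by
  classical
  obtain ⟨θ, hθ⟩ := exists_zeroCochain fun y : G => if y = p x then (1 : ℝ) else 0
  have key : θ ∘ₗ pointMap p = Finsupp.lapply x := by
    refine Finsupp.lhom_ext' fun y => LinearMap.ext_ring ?_
    change θ (pointMap p (Finsupp.single y 1)) = (Finsupp.single y (1 : ℝ)) x
    rw [pointMap_single, hθ, Finsupp.single_apply]
    refine if_congr ⟨fun he => (h.eq_of_apply_eq he.symm hx).symm, fun he => by rw [he]⟩ rfl rfl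
  have := LinearMap.congr_fun key s
  rw [LinearMap.comp_apply, hs, map_zero] at this
  exact this.symm

/-- The paths of a chain whose image in `G` is zero combine to whole edges. -/
theorem pathMap_eq (h : IsGluing F p) {s : F.Sp →₀ ℝ} (hs : pointMap p s = 0) :
    pathMap p s = edgeMap p (F.endCoord s) := by
  classical
  rw [pathMap, PMMap.endCoord, Finsupp.linearCombination_apply, Finsupp.linearCombination_apply,
    Finsupp.sum, Finsupp.sum, map_sum]
  refine Finset.sum_congr rfl fun x hx => ?_
  have hxb : x ∈ F.boundary := by
    by_contra hxb
    exact Finsupp.mem_support_iff.1 hx (h.apply_eq_zero_of_pointMap hs hxb)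
  rw [map_smul]
  congr 1
  obtain ⟨i, rfl | rfl⟩ := F.mem_boundary_iff.1 hxb
  · rw [F.pathTo_leftPt, F.idx_leftPt, if_neg (leftPt_ne_rightPt i), map_zero]
  · rw [F.idx_rightPt, if_pos rfl, edgeMap_single]

/-- The retraction of `G` onto the vertices, seen on `Ω`: the left end of the component of `x`,
corrected by the whole edge if `x` is a right end. -/
theorem retractChain_pointMap (h : IsGluing F p) (s : F.Sp →₀ ℝ) :
    h.retractChain (pointMap p s) = endsMap p (F.endCoord s) +
      Finsupp.linearCombination ℝ
        (fun x => Finsupp.single (leftVert p (F.idx x)) (1 : ℝ)) s := by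
  classical
  suffices h.retractChain ∘ₗ pointMap p = endsMap p ∘ₗ F.endCoord + Finsupp.linearCombination ℝ
      (fun x => Finsupp.single (leftVert p (F.idx x)) (1 : ℝ)) from LinearMap.congr_fun this s
  refine Finsupp.lhom_ext' fun x => LinearMap.ext_ring ?_
  change h.retractChain (pointMap p (Finsupp.single x 1)) =
    endsMap p (F.endCoord (Finsupp.single x 1)) + Finsupp.linearCombination ℝ
      (fun x => Finsupp.single (leftVert p (F.idx x)) (1 : ℝ)) (Finsupp.single x 1)
  rw [pointMap_single, retractChain_pointChain, retract_apply, retractSp, F.endCoord_single,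
    Finsupp.linearCombination_single, one_smul]
  split_ifs
  · rw [endsMap_single, sub_add_cancel]
  · rw [map_zero, zero_add]

end IsGluing

namespace IsInducedBy

variable {G : Type u} [TopologicalSpace G] {f : C(G, G)} {F : PMMap} {p : C(F.Sp, G)}

theorem isGluing (h : IsInducedBy f F p) : IsGluing F p where
  surjective y := by
    by_cases hy : y ∈ p '' F.boundary
    · obtain ⟨x, _, hx⟩ := hy
      exact ⟨x, hx⟩
    · obtain ⟨x, _, hx⟩ : y ∈ p '' F.boundaryᶜ := h.image_eq ▸ hy
      exact ⟨x, hx⟩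
  eq_of_apply_eq {x y} hxy hx := by
    have hy : y ∉ F.boundary := fun hy => by
      have : p x ∈ (p '' F.boundary)ᶜ := h.image_eq ▸ ⟨x, hx, rfl⟩
      exact this ⟨y, hy, hxy.symm⟩
    have := h.isEmbedding.injective (a₁ := ⟨x, hx⟩) (a₂ := ⟨y, hy⟩) hxy
    exact congrArg Subtype.val this

open IsGluing

variable (f) in
/-- The endomorphism of the cellular `0`-chains induced by `f`. -/
def vertexEnd (h : IsGluing F p) : Module.End ℝ (p '' F.boundary →₀ ℝ) :=
  h.retractChain ∘ₗ zeroMap f ∘ₗ vertexMap p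

/-- The trace on the vertices is the number of vertices `v` such that `f(v)` retracts to `v`. -/
theorem exists_trace_vertexEnd (h : IsInducedBy f F p) {S : Finset F.Sp} (hS : F.boundary ⊆ S) :
    ∃ N : ℕ, LinearMap.trace ℝ _ (vertexEnd f h.isGluing) = N ∧ N ≤ S.card := by
  classical
  refine ⟨(Finset.univ.filter fun v : p '' F.boundary => h.isGluing.retract (f v) = v).card, ?_, ?_⟩
  · rw [trace_finsupp, Finset.card_filter, Nat.cast_sum]
    refine Finset.sum_congr rfl fun v _ => ?_
    change h.isGluing.retractChain (zeroMap f (vertexMap p (Finsupp.single v 1))) v = _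
    rw [vertexMap_single, zeroMap_pointChain, retractChain_pointChain, Finsupp.single_apply]
    push_cast
    rfl
  · refine (Finset.card_filter_le _ _).trans ?_
    rw [Finset.card_univ, ← Set.toFinset_card]
    refine (Finset.card_le_card ?_).trans (Finset.card_image_le (s := S) (f := p))
    intro y hy
    obtain ⟨x, hx, rfl⟩ := Set.mem_toFinset.1 hy
    exact Finset.mem_image_of_mem _ (hS hx)

variable [T2Space G]

/-- The image of an edge under `f` is subdivided by the laps. -/
theorem oneMap_edgeMap (h : IsInducedBy f F p) (z : Fin F.m →₀ ℝ) :
    oneMap f (edgeMap p z) = pathMap p (F.lapChain z) := by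
  suffices oneMap f ∘ₗ edgeMap p = pathMap p ∘ₗ F.lapChain from LinearMap.congr_fun this z
  refine Finsupp.lhom_ext' fun i => LinearMap.ext_ring ?_
  change oneMap f (edgeMap p (Finsupp.single i 1)) = pathMap p (F.lapChain (Finsupp.single i 1))
  have := F.sum_laps (fun x => oneMap f (F.pathTo p x)) i
  rw [F.pathTo_leftPt, map_zero, sub_zero] at this
  rw [edgeMap_single, ← this, F.lapChain_single, map_sum]
  refine Finset.sum_congr rfl fun l hl => ?_
  have hm := (F.mem_laps.1 (Finset.mem_filter.1 hl).1).2.2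
  rw [← map_sub, h.oneMap_pathTo_sub hm, map_sub, pathMap_single, pathMap_single]

theorem pointMap_lapChain (h : IsInducedBy f F p) (z : Fin F.m →₀ ℝ) :
    pointMap p (F.lapChain z) = zeroMap f (boundaryMap G (edgeMap p z)) := by
  suffices pointMap p ∘ₗ F.lapChain = zeroMap f ∘ₗ boundaryMap G ∘ₗ edgeMap p from
    LinearMap.congr_fun this z
  refine Finsupp.lhom_ext' fun i => LinearMap.ext_ring ?_
  change pointMap p (F.lapChain (Finsupp.single i 1)) =
    zeroMap f (boundaryMap G (edgeMap p (Finsupp.single i 1)))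
  rw [edgeMap_single, F.boundaryMap_pathTo, map_sub, zeroMap_pointChain, zeroMap_pointChain,
    F.idx_rightPt, ← F.sum_laps (fun x => pointChain (f (p x))) i, F.lapChain_single, map_sum]
  refine Finset.sum_congr rfl fun l hl => ?_
  have hm := (F.mem_laps.1 (Finset.mem_filter.1 hl).1).2.2
  rw [map_sub, pointMap_single, pointMap_single, h.apply_leftLim hm, h.apply_rightLim hm]

/-- `edgeEnd` and `vertexEnd` form a chain map. -/
theorem endsMap_edgeEnd (h : IsInducedBy f F p) :
    endsMap p ∘ₗ F.edgeEnd = vertexEnd f h.isGluing ∘ₗ endsMap p := by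
  refine LinearMap.ext fun z => ?_
  change endsMap p (F.endCoord (F.lapChain z)) =
    h.isGluing.retractChain (zeroMap f (vertexMap p (endsMap p z)))
  rw [← boundaryMap_edgeMap, ← h.pointMap_lapChain, retractChain_pointMap, left_eq_add]
  suffices Finsupp.linearCombination ℝ
      (fun x => Finsupp.single (leftVert p (F.idx x)) (1 : ℝ)) ∘ₗ F.lapChain = 0 from
    LinearMap.congr_fun this z
  refine Finsupp.lhom_ext' fun i => LinearMap.ext_ring ?_
  change Finsupp.linearCombination ℝ (fun x => Finsupp.single (leftVert p (F.idx x)) (1 : ℝ))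
    (F.lapChain (Finsupp.single i 1)) = 0
  rw [F.lapChain_single, map_sum]
  refine Finset.sum_eq_zero fun l hl => ?_
  have hm := (F.mem_laps.1 (Finset.mem_filter.1 hl).1).2.2
  rw [map_sub, Finsupp.linearCombination_single, Finsupp.linearCombination_single,
    F.idx_rightLim_eq hm, sub_self]

/-- Hopf's trace formula: the Lefschetz number of `f` can be computed on the cellular chains. -/
theorem lefschetz_eq (h : IsInducedBy f F p) :
    LinearMap.trace ℝ _ (homologyMap f 0) - LinearMap.trace ℝ _ (homologyMap f 1) =
      LinearMap.trace ℝ _ (vertexEnd f h.isGluing) - LinearMap.trace ℝ _ F.edgeEnd := by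
  have hg := h.isGluing
  have hker : ∀ z ∈ LinearMap.ker (endsMap p), F.edgeEnd z ∈ LinearMap.ker (endsMap p) := by
    intro z hz
    have := LinearMap.congr_fun h.endsMap_edgeEnd z
    rw [LinearMap.comp_apply, LinearMap.comp_apply, LinearMap.mem_ker.1 hz, map_zero] at this
    exact this
  have hone : LinearMap.trace ℝ _ (homologyMap f 1) =
      LinearMap.trace ℝ _ (F.edgeEnd.restrict hker) := by
    refine (trace_homologyMap_one f _ hg.edgeMap_injective hg.map_edgeMap hker fun z hz => ?_).symm
    change oneMap f (edgeMap p z) = edgeMap p (F.endCoord (F.lapChain z))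
    rw [h.oneMap_edgeMap, hg.pathMap_eq]
    rw [h.pointMap_lapChain, hg.boundaryMap_edgeMap_eq_zero_iff.2 hz, map_zero]
  rw [hone]
  refine trace_sub_trace_of_exact hg.surjective_projection hg.ker_projection h.endsMap_edgeEnd ?_
    hker
  refine Finsupp.lhom_ext' fun v => LinearMap.ext_ring ?_
  change homologyProjection G (vertexMap p (h.isGluing.retractChain
    (zeroMap f (vertexMap p (Finsupp.single v 1))))) =
      homologyMap f 0 (homologyProjection G (vertexMap p (Finsupp.single v 1)))
  rw [homologyMap_homologyProjection, vertexMap_single, zeroMap_pointChain]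
  obtain ⟨x, hx⟩ := hg.surjective (f v)
  rw [← hx, retractChain_pointChain, vertexMap_single, retract_apply, eq_comm]
  unfold retractSp
  split_ifs with hr
  · conv_lhs => rw [hr]
    rfl
  · rw [← sub_eq_zero, ← map_sub, ← LinearMap.mem_ker, ker_homologyProjection]
    exact ⟨_, F.boundaryMap_pathTo p x⟩

end IsInducedBy

namespace PMMap

variable (F : PMMap)

/-! ### The trace of the pair as a sum over the laps -/

open Classical in
theorem sum_left_laps (T : F.Sp → ℝ) :
    ∑ c ∈ F.C, (if ∃ z, F.MonoInterval z c then T c else 0) = ∑ l ∈ F.laps, T l.2 := by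
  rw [← Finset.sum_filter]
  refine (Finset.sum_bij (fun l _ => l.2) (fun l hl => ?_) (fun l hl l' hl' he => ?_)
    (fun c hc => ?_) fun _ _ => rfl).symm
  · have hl' := F.mem_laps.1 hl
    exact Finset.mem_filter.2 ⟨hl'.2.1, l.1, hl'.2.2⟩
  · have h1 := F.mem_laps.1 hl
    have h2 := F.mem_laps.1 hl'
    refine Prod.ext ?_ he
    rw [he] at h1
    exact h1.left_unique h2
  · obtain ⟨hc, z, hz⟩ := Finset.mem_filter.1 hc
    have hlt : F.leftPt (F.idx c) < c := (F.leftPt_le hz.idx_eq).trans_lt hz.1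
    obtain ⟨c', hc', hm⟩ := F.exists_lap_left hlt
    exact ⟨(c', c), F.mem_laps.2 ⟨hc', hc, hm⟩, rfl⟩

open Classical in
theorem sum_right_laps (T : F.Sp → ℝ) :
    ∑ c ∈ F.C, (if ∃ z, F.MonoInterval c z then T c else 0) = ∑ l ∈ F.laps, T l.1 := by
  rw [← Finset.sum_filter]
  refine (Finset.sum_bij (fun l _ => l.1) (fun l hl => ?_) (fun l hl l' hl' he => ?_)
    (fun c hc => ?_) fun _ _ => rfl).symm
  · have hl' := F.mem_laps.1 hl
    exact Finset.mem_filter.2 ⟨hl'.1, l.2, hl'.2.2⟩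
  · have h1 := F.mem_laps.1 hl
    have h2 := F.mem_laps.1 hl'
    refine Prod.ext he ?_
    rw [he] at h1
    exact h1.right_unique h2
  · obtain ⟨hc, z, hz⟩ := Finset.mem_filter.1 hc
    have hlt : c < F.rightPt (F.idx c) := hz.1.trans_le (F.le_rightPt hz.idx_eq.symm)
    obtain ⟨d, hd, hm⟩ := F.exists_lap_right hlt
    exact ⟨(c, d), F.mem_laps.2 ⟨hc, hd, hm⟩, rfl⟩

/-- The unsigned contribution of a lap `]c, d[` to the trace: `[F(d-) ≥ d] - [F(c+) > c]`, where
only values in the component of the lap count. -/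
def lapTerm (l : F.Sp × F.Sp) : ℝ :=
  F.geFun l.2 (Finsupp.single (F.leftLim l.2) 1) - F.gtFun l.1 (Finsupp.single (F.rightLim l.1) 1)

theorem pairTrace_eq_sum_laps :
    pairTrace (V₀ := (⊤ : Submodule ℝ (F.Sp →₀ ℝ))) (V₁ := chainsOne F.Sp)
      (Submodule.topEquiv.symm.conj F.signedZero) F.signedOne =
      ∑ l ∈ F.laps, F.signOn l.1 l.2 * F.lapTerm l := by
  classical
  have hL : ∀ c ∈ F.C, F.geFun c (F.leftVec c) =
      if ∃ z, F.MonoInterval z c then F.geFun c (F.leftVec c) else 0 := by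
    intro c _
    split_ifs with h
    · rfl
    · rw [leftVec, dif_neg fun ⟨q, hq⟩ => h ⟨_, hq.1⟩, map_zero]
  have hR : ∀ c ∈ F.C, F.gtFun c (F.rightVec c) =
      if ∃ z, F.MonoInterval c z then F.gtFun c (F.rightVec c) else 0 := by
    intro c _
    split_ifs with h
    · rfl
    · rw [rightVec, dif_neg fun ⟨q, hq⟩ => h ⟨_, hq.1⟩, map_zero]
  rw [pairTrace_eq, Finset.sum_sub_distrib, Finset.sum_congr rfl hL, Finset.sum_congr rfl hR,
    F.sum_left_laps fun c => F.geFun c (F.leftVec c),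
    F.sum_right_laps fun c => F.gtFun c (F.rightVec c), ← Finset.sum_sub_distrib]
  refine Finset.sum_congr rfl fun l hl => ?_
  have hm := (F.mem_laps.1 hl).2.2
  rw [F.leftVec_eq hm hm.isLeftLimit, F.rightVec_eq hm hm.isRightLimit, map_smul, map_smul,
    smul_eq_mul, smul_eq_mul, ← mul_sub]
  rfl

open Classical in
/-- The decreasing laps that contain a fixed point. -/
def negLaps : Finset (F.Sp × F.Sp) :=
  {l ∈ F.laps | StrictAntiOn F.toFun (F.between l.1 l.2) ∧
    ∃ w ∈ F.between l.1 l.2, F.toFun w = w}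

open Classical in
/-- The signed and the unsigned contribution of a lap agree, unless the lap is decreasing and crosses
the diagonal: then its unsigned contribution is `-1`, and its signed one `1`. -/
theorem signOn_mul_lapTerm {l : F.Sp × F.Sp} (hm : F.MonoInterval l.1 l.2) :
    F.signOn l.1 l.2 * F.lapTerm l = F.lapTerm l +
      if StrictAntiOn F.toFun (F.between l.1 l.2) ∧
        ∃ w ∈ F.between l.1 l.2, F.toFun w = w then 2 else 0 := by
  rcases F.mono_or_anti hm with h | h
  · rw [F.signOn_of_mono h, one_mul, if_neg fun ha => F.not_mono_of_anti hm Subset.rfl ha.1 h,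
      add_zero]
  rw [F.signOn_of_anti hm h]
  obtain ⟨himg, hsurj⟩ := F.image_between_of_anti hm h hm.isRightLimit hm.isLeftLimit
  obtain ⟨c, d⟩ := l
  have hcd : c < d := hm.1
  have hidx : F.idx d = F.idx c := hm.idx_eq.symm
  have huv : F.leftLim d < F.rightLim c := by
    obtain ⟨w, hw⟩ := F.between_nonempty hm
    exact (himg w hw).1.trans (himg w hw).2
  have hi := F.idx_rightLim_eq hm
  simp only [lapTerm, geFun_single, gtFun_single] at *
  by_cases hv : F.idx (F.leftLim d) = F.idx d ∧ d ≤ F.leftLim d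
  · -- The values of the lap lie to the right of it.
    rw [if_pos hv, if_pos ⟨by rw [← hi, hv.1, hidx], hcd.trans_le (hv.2.trans huv.le)⟩, if_neg]
    · norm_num
    · rintro ⟨_, w, hw, hfix⟩
      have h1 := (himg w hw).1
      rw [hfix] at h1
      have h2 : (w : F.Sp) < d := hw.2
      exact absurd (hv.2.trans_lt h1) (not_lt.2 h2.le)
  by_cases hu : F.idx (F.rightLim c) = F.idx c ∧ c < F.rightLim c
  · have hvd : F.leftLim d < d := not_le.1 fun hle => hv ⟨by rw [hi, hu.1, hidx], hle⟩
    rw [if_neg hv, if_pos hu, if_pos]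
    · norm_num
    refine ⟨h, ?_⟩
    -- The graph of a decreasing function crosses the diagonal.
    obtain ⟨k, hkc, hkd, hk⟩ := F.exists_extension hm
    have huc : (c : ℝ) < F.rightLim c := hu.2
    have hvd' : (F.leftLim d : ℝ) < d := hvd
    obtain ⟨t, ht, hkt⟩ := intermediate_value_Icc' (f := fun t => k t - t) (le_of_lt hm.1)
      (by fun_prop) (show (0 : ℝ) ∈ Icc (k d - d) (k c - c) from
        ⟨by rw [hkd]; linarith, by rw [hkc]; linarith⟩)
    have hkt' : k t = t := sub_eq_zero.1 hkt
    have htc : (c : ℝ) ≠ t := by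
      rintro rfl
      rw [hkc] at hkt'
      exact huc.ne' hkt'
    have htd : t ≠ (d : ℝ) := by
      rintro rfl
      rw [hkd] at hkt'
      exact hvd'.ne hkt'
    obtain ⟨w, rfl⟩ := hm.2 t ⟨lt_of_le_of_ne ht.1 htc, lt_of_le_of_ne ht.2 htd⟩
    have hw : w ∈ F.between c d := ⟨lt_of_le_of_ne ht.1 htc, lt_of_le_of_ne ht.2 htd⟩
    exact ⟨w, hw, Subtype.ext ((hk w hw).symm.trans hkt')⟩
  · rw [if_neg hv, if_neg hu, if_neg]
    · norm_num
    · rintro ⟨_, w, hw, hfix⟩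
      have h1 := (himg w hw).2
      rw [hfix] at h1
      have h2 : c < (w : F.Sp) := hw.1
      refine hu ⟨?_, h2.trans h1⟩
      have h3 := F.idx_toFun hm hw
      rw [hfix, F.idx_of_mem_Icc hidx.symm hw.1.le hw.2.le] at h3
      exact h3.symm

/-- The trace of the pair counts the fixed points in decreasing laps twice. -/
theorem pairTrace_eq_add :
    pairTrace (V₀ := (⊤ : Submodule ℝ (F.Sp →₀ ℝ))) (V₁ := chainsOne F.Sp)
      (Submodule.topEquiv.symm.conj F.signedZero) F.signedOne =
      ∑ l ∈ F.laps, F.lapTerm l + 2 * F.negLaps.card := by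
  classical
  rw [pairTrace_eq_sum_laps, Finset.sum_congr rfl fun l hl =>
    F.signOn_mul_lapTerm (F.mem_laps.1 hl).2.2, Finset.sum_add_distrib, ← Finset.sum_filter,
    Finset.sum_const, nsmul_eq_mul, mul_comm]
  rfl

open Classical in
/-- The difference between `[x ≥ c]` and `[x = b]`, where `b` is the right end of the component of
`c`, is zero if `x` is on the boundary of `Ω` but `c` is not. -/
theorem geFun_of_mem_boundary {c x : F.Sp} (hc : c ∉ F.boundary) (hx : x ∈ F.boundary) :
    F.geFun c (Finsupp.single x 1) = if x = F.rightPt (F.idx c) then 1 else 0 := by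
  rw [geFun_single]
  refine if_congr ⟨fun ⟨h1, h2⟩ => ?_, fun h => ?_⟩ rfl rfl
  · obtain ⟨i, rfl | rfl⟩ := F.mem_boundary_iff.1 hx
    · rw [F.idx_leftPt] at h1
      exact absurd (le_antisymm h2 (F.leftPt_le h1.symm) ▸ F.leftPt_mem_boundary i) hc
    · rw [F.idx_rightPt] at h1
      rw [h1]
  · rw [h]
    exact ⟨F.idx_rightPt _, F.le_rightPt rfl⟩

theorem gtFun_eq_geFun {c x : F.Sp} (h : x ≠ c) :
    F.gtFun c (Finsupp.single x 1) = F.geFun c (Finsupp.single x 1) := by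
  classical
  rw [geFun_single, gtFun_single]
  exact if_congr ⟨fun h1 => ⟨h1.1, h1.2.le⟩, fun h1 => ⟨h1.1, lt_of_le_of_ne h1.2 h.symm⟩⟩ rfl rfl

end PMMap

namespace IsInducedBy

variable {G : Type u} [TopologicalSpace G] [T2Space G] {f : C(G, G)} {F : PMMap} {p : C(F.Sp, G)}

/-- The sum of the unsigned contributions of the laps differs from the trace on the edges only by
contributions of the points of `C` that are on the boundary or fixed: at any other point `c` of `C`
the two one-sided limits of `F` lie in the same fibre of `p`, and their contributions cancel. -/
theorem exists_sum_lapTerm_sub (h : IsInducedBy f F p) {S : Finset F.Sp} (hb : F.boundary ⊆ S)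
    (hS : ∀ c ∈ F.C, f (p c) = p c → c ∈ S) :
    ∃ N : ℤ, ∑ l ∈ F.laps, F.lapTerm l - LinearMap.trace ℝ _ F.edgeEnd = N ∧ |N| ≤ S.card := by
  classical
  let α : F.Sp → ℝ := fun c => F.geFun c (Finsupp.single (F.leftLim c) 1) -
    if F.leftLim c = F.rightPt (F.idx c) then 1 else 0
  let β : F.Sp → ℝ := fun c => F.gtFun c (Finsupp.single (F.rightLim c) 1) -
    if F.rightLim c = F.rightPt (F.idx c) then 1 else 0
  have hsum : ∑ l ∈ F.laps, F.lapTerm l - LinearMap.trace ℝ _ F.edgeEnd =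
      ∑ c ∈ F.C, ((if ∃ z, F.MonoInterval z c then α c else 0) -
        if ∃ z, F.MonoInterval c z then β c else 0) := by
    rw [Finset.sum_sub_distrib, F.sum_left_laps, F.sum_right_laps, F.trace_edgeEnd,
      ← Finset.sum_sub_distrib, ← Finset.sum_sub_distrib]
    refine Finset.sum_congr rfl fun l hl => ?_
    simp only [α, β, PMMap.lapTerm, ← (F.mem_laps.1 hl).2.2.idx_eq]
    ring
  have hα : ∀ c, (if ∃ z, F.MonoInterval z c then α c else 0) = 0 ∨
      (if ∃ z, F.MonoInterval z c then α c else 0) = 1 := by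
    intro c
    split_ifs
    · simp only [α, F.geFun_single]
      by_cases h1 : F.leftLim c = F.rightPt (F.idx c)
      · left
        rw [if_pos h1, if_pos ⟨by rw [h1, F.idx_rightPt], h1 ▸ F.le_rightPt rfl⟩, sub_self]
      · rw [if_neg h1, sub_zero]
        split_ifs <;> simp
    · exact Or.inl rfl
  have hβ : ∀ c, (if ∃ z, F.MonoInterval c z then β c else 0) = 0 ∨
      (if ∃ z, F.MonoInterval c z then β c else 0) = 1 := by
    intro c
    split_ifs with hz
    · simp only [β, F.gtFun_single]
      by_cases h1 : F.rightLim c = F.rightPt (F.idx c)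
      · obtain ⟨z, hz⟩ := hz
        left
        rw [if_pos h1, if_pos ⟨by rw [h1, F.idx_rightPt],
          h1 ▸ hz.1.trans_le (F.le_rightPt hz.idx_eq.symm)⟩, sub_self]
      · rw [if_neg h1, sub_zero]
        split_ifs <;> simp
    · exact Or.inl rfl
  have hzero : ∀ c ∈ F.C, c ∉ S → (if ∃ z, F.MonoInterval z c then α c else 0) -
      (if ∃ z, F.MonoInterval c z then β c else 0) = 0 := by
    intro c hc hcS
    have hcb : c ∉ F.boundary := fun hcb => hcS (hb hcb)
    have hfix : f (p c) ≠ p c := fun hfix => hcS (hS c hc hfix)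
    obtain ⟨z, -, hz⟩ := F.exists_lap_left (F.leftPt_lt (x := c) fun he =>
      hcb (he ▸ F.leftPt_mem_boundary _))
    obtain ⟨z', -, hz'⟩ := F.exists_lap_right (F.lt_rightPt (x := c) fun he =>
      hcb (he ▸ F.rightPt_mem_boundary _))
    rw [if_pos ⟨z, hz⟩, if_pos ⟨z', hz'⟩]
    have hl := h.apply_leftLim hz
    have hr := h.apply_rightLim hz'
    have hrc : F.rightLim c ≠ c := fun he => hfix (by rw [← hr, he])
    simp only [α, β]
    rw [F.gtFun_eq_geFun hrc]
    by_cases hlb : F.leftLim c ∈ F.boundary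
    · have hrb := h.isGluing.mem_boundary_of_apply_eq (hl.trans hr.symm) hlb
      rw [F.geFun_of_mem_boundary hcb hlb, F.geFun_of_mem_boundary hcb hrb, sub_self, sub_self,
        sub_self]
    · rw [h.isGluing.eq_of_apply_eq (hl.trans hr.symm) hlb, sub_self]
  have hint : ∀ c ∈ F.C, ∃ k : ℤ, ((if ∃ z, F.MonoInterval z c then α c else 0) -
      (if ∃ z, F.MonoInterval c z then β c else 0)) = k ∧ |k| ≤ if c ∈ S then 1 else 0 := by
    intro c hc
    by_cases hcS : c ∈ S
    · rw [if_pos hcS]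
      rcases hα c with h1 | h1 <;> rcases hβ c with h2 | h2 <;> rw [h1, h2]
      · exact ⟨0, by simp, by simp⟩
      · exact ⟨-1, by simp, by simp⟩
      · exact ⟨1, by simp, by simp⟩
      · exact ⟨0, by simp, by simp⟩
    · rw [if_neg hcS, hzero c hc hcS]
      exact ⟨0, by simp, by simp⟩
  choose! k hk hk1 using hint
  refine ⟨∑ c ∈ F.C, k c, ?_, ?_⟩
  · rw [hsum, Int.cast_sum]
    exact Finset.sum_congr rfl hk
  · refine (Finset.abs_sum_le_sum_abs _ _).trans ((Finset.sum_le_sum hk1).trans ?_)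
    rw [← Finset.sum_filter, Finset.sum_const, nsmul_eq_mul, mul_one]
    exact_mod_cast Finset.card_le_card fun c hc => (Finset.mem_filter.1 hc).2

end IsInducedBy

/-! ### Fixed points of negative type and decreasing laps -/

/-- A chart of the real line around `t` with values in a given neighbourhood. -/
theorem exists_strictMono_chart {t : ℝ} {U : Set ℝ} (hU : U ∈ 𝓝 t) :
    ∃ k : ℝ → ℝ, StrictMono k ∧ IsOpenEmbedding k ∧ k 0 = t ∧ range k ⊆ U := by
  obtain ⟨r, hr, hrU⟩ := Metric.mem_nhds_iff.1 hU
  let o := orderIsoIooNegOneOne ℝ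
  have h1 : IsOpenEmbedding fun s => ((o s : ℝ)) :=
    isOpen_Ioo.isOpenEmbedding_subtypeVal.comp o.toHomeomorph.isOpenEmbedding
  have h2 : IsOpenEmbedding fun s : ℝ => t + r * s :=
    ((Homeomorph.addLeft t).isOpenEmbedding).comp (Homeomorph.mulLeft₀ r hr.ne').isOpenEmbedding
  let c : ℝ := (o.symm ⟨0, by norm_num⟩)
  have hc : (o c : ℝ) = 0 := by simp [c]
  refine ⟨fun s => t + r * o (c + s), fun s s' h => ?_,
    (h2.comp h1).comp (Homeomorph.addLeft c).isOpenEmbedding, ?_, ?_⟩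
  · have : (o (c + s) : ℝ) < o (c + s') := o.strictMono (by linarith)
    have := mul_lt_mul_of_pos_left this hr
    change t + r * o (c + s) < t + r * o (c + s')
    linarith
  · simp [hc]
  · rintro _ ⟨s, rfl⟩
    refine hrU ?_
    obtain ⟨h3, h4⟩ := (o (c + s)).2
    rw [Metric.mem_ball, Real.dist_eq, add_sub_cancel_left, abs_mul, abs_of_pos hr]
    have := abs_lt.2 ⟨h3, h4⟩
    nlinarith

namespace PMMap

variable (F : PMMap)

theorem lap_unique {l l' : F.Sp × F.Sp} (h : F.IsLap l.1 l.2) (h' : F.IsLap l'.1 l'.2) {w : F.Dom}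
    (hw : w ∈ F.between l.1 l.2) (hw' : w ∈ F.between l'.1 l'.2) : l = l' := by
  have key : ∀ {c d c' d' : F.Sp}, F.IsLap c d → F.IsLap c' d' → w ∈ F.between c d →
      w ∈ F.between c' d' → c' ≤ c := by
    intro c d c' d' h h' hw hw'
    by_contra hlt
    exact h.2.2.not_mem (not_le.1 hlt) (lt_trans (show c' < (w : F.Sp) from hw'.1) hw.2) h'.1
  have h1 : l.1 = l'.1 := le_antisymm (key h' h hw' hw) (key h h' hw hw')
  rw [h1] at h
  exact Prod.ext h1 (h.right_unique h')

theorem isOpenEmbedding_compl_boundary :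
    IsOpenEmbedding fun x : (F.boundaryᶜ : Set F.Sp) => ((x : F.Sp) : ℝ) := by
  refine ⟨IsEmbedding.subtypeVal.comp IsEmbedding.subtypeVal, ?_⟩
  have : range (fun x : (F.boundaryᶜ : Set F.Sp) => ((x : F.Sp) : ℝ)) =
      ⋃ i, Ioo (F.a i) (F.b i) := by
    ext t
    rw [mem_iUnion]
    constructor
    · rintro ⟨⟨⟨t, i, hi⟩, hx⟩, rfl⟩
      exact ⟨i, lt_of_le_of_ne hi.1 fun h => hx ⟨i, Or.inl h.symm⟩,
        lt_of_le_of_ne hi.2 fun h => hx ⟨i, Or.inr h⟩⟩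
    · rintro ⟨i, hi⟩
      refine ⟨⟨⟨t, i, hi.1.le, hi.2.le⟩, fun hb => ?_⟩, rfl⟩
      obtain ⟨j, hj⟩ := F.mem_boundary_iff.1 hb
      have hidx : F.idx ⟨t, i, hi.1.le, hi.2.le⟩ = i := F.idx_eq_of_mem ⟨hi.1.le, hi.2.le⟩
      have hij : i = j := by
        rw [← hidx]
        rcases hj with hj | hj <;> rw [hj]
        · exact F.idx_leftPt j
        · exact F.idx_rightPt j
      subst hij
      rcases hj with hj | hj
      · exact hi.1.ne' (congrArg Subtype.val hj)
      · exact hi.2.ne (congrArg Subtype.val hj)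
  rw [this]
  exact isOpen_iUnion fun i => isOpen_Ioo

end PMMap

namespace IsInducedBy

variable {G : Type u} [TopologicalSpace G] {f : C(G, G)} {F : PMMap} {p : C(F.Sp, G)}

theorem apply_hat (h : IsInducedBy f F p) {x : F.Sp} (hx : x ∉ F.C) : p (F.hat x) = f (p x) := by
  rw [F.hat_of_not_mem hx]
  exact h.commutes ⟨x, hx⟩

variable [T2Space G]

/-- A chart of `Ω` around a point outside of the boundary which is also a chart of `G`. -/
theorem exists_chart (h : IsInducedBy f F p) {w : F.Sp} (hw : w ∉ F.boundary) {U : Set F.Sp}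
    (hU : U ∈ 𝓝 w) : ∃ k : ℝ → F.Sp, StrictMono k ∧ Continuous k ∧ (∀ s, range k ∈ 𝓝 (k s)) ∧
      IsOpenEmbedding (p ∘ k) ∧ k 0 = w ∧ range k ⊆ U := by
  have hv := F.isOpenEmbedding_compl_boundary
  have hp : IsOpenEmbedding (F.boundaryᶜ.domRestrict p) := by
    refine ⟨h.isEmbedding, ?_⟩
    rw [Set.range_domRestrict, h.image_eq]
    exact (F.finite_boundary.image p).isClosed.isOpen_compl
  have hcl : IsOpen (F.boundaryᶜ : Set F.Sp) := F.finite_boundary.isClosed.isOpen_compl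
  have hi : IsOpenEmbedding (Subtype.val : (F.boundaryᶜ : Set F.Sp) → F.Sp) :=
    hcl.isOpenEmbedding_subtypeVal
  have hU' : (fun x : (F.boundaryᶜ : Set F.Sp) => ((x : F.Sp) : ℝ)) '' (Subtype.val ⁻¹' U) ∈
      𝓝 (w : ℝ) :=
    hv.image_mem_nhds (x := ⟨w, hw⟩) |>.2 (continuous_subtype_val.continuousAt.preimage_mem_nhds hU)
  obtain ⟨k, hk, hko, hk0, hkU⟩ := exists_strictMono_chart hU'
  choose κ hκU hκ using fun s => hkU ⟨s, rfl⟩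
  have hκo : IsOpenEmbedding κ := by
    rw [← IsOpenEmbedding.of_comp_iff κ hv]
    convert hko using 1
    exact funext hκ
  have hκ' : IsOpenEmbedding fun s => (κ s : F.Sp) := hi.comp hκo
  refine ⟨fun s => κ s, fun s s' hs => ?_, hκ'.continuous,
    fun s => hκ'.isOpen_range.mem_nhds ⟨s, rfl⟩, hp.comp hκo, ?_, ?_⟩
  · change ((κ s : F.Sp) : ℝ) < (κ s' : F.Sp)
    have h1 := hk hs
    rwa [← hκ s, ← hκ s'] at h1
  · exact Subtype.ext ((hκ 0).trans hk0)
  · rintro _ ⟨s, rfl⟩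
    exact hκU s

/-- A fixed point of `F` in a decreasing lap gives a fixed point of negative type. -/
theorem mem_negFix (h : IsInducedBy f F p) {c d : F.Sp} (hl : F.IsLap c d)
    (ha : StrictAntiOn F.toFun (F.between c d)) {w : F.Dom} (hw : w ∈ F.between c d)
    (hfix : F.toFun w = w) : p w ∈ negFix f := by
  have hwb : (w : F.Sp) ∉ F.boundary := fun hb => w.2 (F.boundary_subset_C hb)
  refine ⟨by rw [← h.commutes, hfix], fun hv => ?_, ?_⟩
  · obtain ⟨x, hx, hxw⟩ := h.vertices_subset hv
    exact hwb (h.isGluing.mem_boundary_of_apply_eq hxw hx)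
  obtain ⟨k, hk, hkc, hkr, hkp, hk0, hkU⟩ := h.exists_chart hwb (U := Ioo c d)
    (Ioo_mem_nhds hw.1 hw.2)
  have hC : ∀ s, k s ∉ F.C := fun s => hl.2.2.not_mem (hkU ⟨s, rfl⟩).1 (hkU ⟨s, rfl⟩).2
  have hcont : Continuous fun s => F.hat (k s) := by
    refine continuous_iff_continuousAt.2 fun s => ?_
    exact (F.continuousAt_hat (hC s)).comp hkc.continuousAt
  have h0 : F.hat (k 0) = k 0 := by rw [hk0, F.hat_coe, hfix]
  let q : ℝ → ℝ := Function.invFun k ∘ fun s => F.hat (k s)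
  have hq : ∀ s, F.hat (k s) ∈ range k → k (q s) = F.hat (k s) := fun s hs =>
    Function.invFun_eq hs
  refine ⟨p ∘ k, 0, hkp, by rw [Function.comp_apply, hk0], {s | F.hat (k s) ∈ range k},
    hcont.continuousAt.preimage_mem_nhds (by rw [h0]; exact hkr 0), q, fun s hs s' hs' hss => ?_,
    fun s hs => ?_⟩
  · rw [← hk.lt_iff_lt, hq s hs, hq s' hs', F.hat_of_not_mem (hC s), F.hat_of_not_mem (hC s')]
    exact ha (show (⟨k s, hC s⟩ : F.Dom) ∈ _ from hkU ⟨s, rfl⟩) (hkU ⟨s', rfl⟩) (hk hss)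
  · rw [Function.comp_apply, Function.comp_apply, hq s hs, h.apply_hat (hC s)]

/-- The type of a fixed point does not depend on the chart: `F` is decreasing near a point that
lies over a fixed point of negative type. -/
theorem exists_lap_of_mem_negFix (h : IsInducedBy f F p) {w : F.Sp} (hw : w ∉ F.C)
    (hx : p w ∈ negFix f) : ∃ c d, F.IsLap c d ∧ StrictAntiOn F.toFun (F.between c d) ∧
      ⟨w, hw⟩ ∈ F.between c d ∧ F.toFun ⟨w, hw⟩ = w := by
  obtain ⟨hfix, -, e, t, he, het, W, hW, q, hq, hqe⟩ := hx
  have hwb : w ∉ F.boundary := fun hb => hw (F.boundary_subset_C hb)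
  have hhat : F.hat w = w :=
    (h.isGluing.eq_of_apply_eq ((h.apply_hat hw).trans hfix).symm hwb).symm
  obtain ⟨c, d, hl, hm⟩ := F.exists_isLap ⟨w, hw⟩
  refine ⟨c, d, hl, (F.mono_or_anti hl.2.2).resolve_left fun hmono => ?_, hm,
    by rw [← F.hat_of_not_mem hw, hhat]⟩
  obtain ⟨k, hk, hkc, hkr, hkp, hk0, hkU⟩ := h.exists_chart hwb (U := Ioo c d)
    (Ioo_mem_nhds hm.1 hm.2)
  have hC : ∀ s, k s ∉ F.C := fun s => hl.2.2.not_mem (hkU ⟨s, rfl⟩).1 (hkU ⟨s, rfl⟩).2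
  have hcont : Continuous fun s => F.hat (k s) := by
    refine continuous_iff_continuousAt.2 fun s => ?_
    exact (F.continuousAt_hat (hC s)).comp hkc.continuousAt
  -- The change of charts `θ` is defined on `]-r, r[`.
  have hA : (p ∘ k) ⁻¹' (e '' W) ∈ 𝓝 (0 : ℝ) := by
    refine hkp.continuous.continuousAt.preimage_mem_nhds ?_
    rw [Function.comp_apply, hk0, ← het]
    exact he.image_mem_nhds.2 hW
  obtain ⟨r, hr, hrA⟩ := Metric.mem_nhds_iff.1 hA
  rw [Real.ball_eq_Ioo, zero_sub, zero_add] at hrA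
  have hrA' : ∀ s ∈ Ioo (-r) r, ∃ u ∈ W, e u = (p ∘ k) s := fun s hs => hrA hs
  choose! θ hθW hθ using hrA'
  have hθc : ContinuousOn θ (Ioo (-r) r) := by
    rw [he.isInducing.continuousOn_iff]
    exact hkp.continuous.continuousOn.congr fun s hs => hθ s hs
  have hθi : InjOn θ (Ioo (-r) r) := fun s hs s' hs' hss => by
    refine hkp.injective ?_
    rw [← hθ s hs, ← hθ s' hs', hss]
  have hqθ : ∀ s ∈ Ioo (-r) r, ∀ s' ∈ Ioo (-r) r, F.hat (k s) = k s' → q (θ s) = θ s' := by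
    intro s hs s' hs' hss
    refine he.injective ?_
    rw [← hqe _ (hθW s hs), hθ s hs, hθ s' hs', Function.comp_apply, Function.comp_apply, ← hss,
      h.apply_hat (hC s)]
  have h0 : (0 : ℝ) ∈ Ioo (-r) r := ⟨by linarith, hr⟩
  -- A point `s > 0` near `0` is mapped to a point `s' > 0`, since `F` is increasing.
  have hki : k '' Ioo (-r) r ∈ 𝓝 (k 0) := by
    have h1 : p ⁻¹' ((p ∘ k) '' Ioo (-r) r) ∈ 𝓝 (k 0) :=
      p.continuous.continuousAt.preimage_mem_nhds (hkp.image_mem_nhds.2 (Ioo_mem_nhds h0.1 h0.2))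
    filter_upwards [h1, hkr 0] with x hx hx'
    obtain ⟨s, hs, hsx⟩ := hx
    obtain ⟨s', rfl⟩ := hx'
    exact ⟨s, hs, congrArg k (hkp.injective hsx)⟩
  have hev : ∀ᶠ s in 𝓝[>] (0 : ℝ), F.hat (k s) ∈ k '' Ioo (-r) r := by
    refine Eventually.filter_mono nhdsWithin_le_nhds ?_
    exact hcont.continuousAt.eventually_mem (by rwa [hk0, hhat, ← hk0])
  obtain ⟨s, ⟨s', hs', hss'⟩, hs⟩ := (hev.and (Ioo_mem_nhdsGT hr)).exists
  have hsr : s ∈ Ioo (-r) r := ⟨by linarith [hs.1], hs.2⟩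
  have hs'0 : 0 < s' := by
    rw [← hk.lt_iff_lt, hss', hk0]
    have h1 := hmono hm (show (⟨k s, hC s⟩ : F.Dom) ∈ _ from hkU ⟨s, rfl⟩)
      (show w < k s by rw [← hk0]; exact hk hs.1)
    rwa [← F.hat_of_not_mem hw, hhat, ← F.hat_of_not_mem] at h1
  have e0 := hqθ 0 h0 0 h0 (by rw [hk0, hhat])
  have e1 := hqθ s hsr s' hs' hss'.symm
  rcases hθc.strictMonoOn_of_injOn_Ioo (by linarith) hθi with hθm | hθm
  · have h1 := hq (hθW 0 h0) (hθW s hsr) (hθm h0 hsr hs.1)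
    rw [e0, e1] at h1
    exact lt_asymm h1 (hθm h0 hs' hs'0)
  · have h1 := hq (hθW s hsr) (hθW 0 h0) (hθm h0 hsr hs.1)
    rw [e0, e1] at h1
    exact lt_asymm h1 (hθm h0 hs' hs'0)

/-- The fixed points of negative type correspond to the decreasing laps with a fixed point, up to
fixed points in `p(C)`, whose type `F` does not determine. -/
theorem card_negLaps (h : IsInducedBy f F p) {S : Finset F.Sp}
    (hS : ∀ c ∈ F.C, f (p c) = p c → c ∈ S) :
    F.negLaps.card ≤ (negFix f).ncard ∧
      (negFix f).ncard ≤ F.negLaps.card + S.card := by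
  classical
  have hneg : ∀ l ∈ F.negLaps, ∃ w ∈ F.between l.1 l.2, F.IsLap l.1 l.2 ∧
      StrictAntiOn F.toFun (F.between l.1 l.2) ∧ F.toFun w = w := by
    intro l hl
    obtain ⟨hl, ha, w, hw, hfix⟩ := Finset.mem_filter.1 hl
    exact ⟨w, hw, F.mem_laps.1 hl, ha, hfix⟩
  choose w hw hl ha hfix using hneg
  let A : Finset G := F.negLaps.attach.image fun l => p (w l.1 l.2)
  have hA : A.card = F.negLaps.card := by
    rw [Finset.card_image_of_injective, Finset.card_attach]
    rintro ⟨l, hl₁⟩ ⟨l', hl₂⟩ he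
    have hww : (w l hl₁ : F.Sp) = w l' hl₂ := h.isGluing.eq_of_apply_eq he
      fun hb => (w l hl₁).2 (F.boundary_subset_C hb)
    exact Subtype.ext (F.lap_unique (hl l hl₁) (hl l' hl₂) (hw _ hl₁) (Subtype.ext hww ▸ hw _ hl₂))
  have hAf : (A : Set G) ⊆ negFix f := by
    intro x hx
    obtain ⟨l, -, rfl⟩ := Finset.mem_image.1 hx
    exact h.mem_negFix (hl _ l.2) (ha _ l.2) (hw _ l.2) (hfix _ l.2)
  have hfA : negFix f ⊆ (A ∪ S.image p : Finset G) := by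
    intro x hx
    rw [Finset.mem_coe, Finset.mem_union]
    obtain ⟨v, rfl⟩ := h.isGluing.surjective x
    by_cases hv : v ∈ F.C
    · exact Or.inr (Finset.mem_image_of_mem _ (hS v hv hx.1))
    obtain ⟨c, d, hcd, hanti, hm, hvfix⟩ := h.exists_lap_of_mem_negFix hv hx
    have hmem : (c, d) ∈ F.negLaps :=
      Finset.mem_filter.2 ⟨F.mem_laps.2 hcd, hanti, _, hm, hvfix⟩
    refine Or.inl (Finset.mem_image.2 ⟨⟨_, hmem⟩, Finset.mem_attach _ _, ?_⟩)
    refine congrArg p ?_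
    by_contra hne
    -- A decreasing function has at most one fixed point.
    have h1 := ha _ hmem
    rcases lt_or_gt_of_ne hne with hlt | hlt
    · have h2 := h1 (hw _ hmem) hm hlt
      rw [hvfix, hfix] at h2
      exact lt_asymm hlt h2
    · have h2 := h1 hm (hw _ hmem) hlt
      rw [hvfix, hfix] at h2
      exact lt_asymm hlt h2
  have hfin : (negFix f).Finite := (Finset.finite_toSet _).subset hfA
  refine ⟨?_, ?_⟩
  · rw [← hA, ← Set.ncard_coe_finset]
    exact Set.ncard_le_ncard hAf hfin
  · refine (Set.ncard_le_ncard hfA (Finset.finite_toSet _)).trans ?_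
    rw [Set.ncard_coe_finset, ← hA]
    exact (Finset.card_union_le _ _).trans (Nat.add_le_add_left Finset.card_image_le _)

end IsInducedBy

/-! ### Comparison of traces for a map and for its iterates -/

theorem homologyMap_comp {G : Type u} [TopologicalSpace G] (f g : C(G, G)) (i : ℕ) :
    homologyMap (g.comp f) i = homologyMap g i * homologyMap f i := by
  unfold homologyMap
  rw [TopCat.ofHom_comp, CategoryTheory.Functor.map_comp, ModuleCat.hom_comp]
  rfl

theorem homologyMap_id {G : Type u} [TopologicalSpace G] (i : ℕ) :
    homologyMap (ContinuousMap.id G) i = 1 := by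
  unfold homologyMap
  rw [TopCat.ofHom_id, CategoryTheory.Functor.map_id, ModuleCat.hom_id]
  rfl

/-- The iterate of a continuous map, as a continuous map. -/
def iterateMap {G : Type u} [TopologicalSpace G] (f : C(G, G)) (n : ℕ) : C(G, G) :=
  ⟨f^[n], f.continuous.iterate n⟩

theorem homologyMap_iterateMap {G : Type u} [TopologicalSpace G] (f : C(G, G)) (i n : ℕ) :
    homologyMap (iterateMap f n) i = homologyMap f i ^ n := by
  induction n with
  | zero => exact homologyMap_id i
  | succ n ih =>
    rw [pow_succ, ← ih, ← homologyMap_comp]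
    rfl

namespace IsGluing

variable {G : Type u} [TopologicalSpace G] {F : PMMap} {p : C(F.Sp, G)}

theorem finite_preimage (h : IsGluing F p) {T : Set G} (hT : T.Finite) : (p ⁻¹' T).Finite := by
  refine hT.preimage' fun g _ => ?_
  obtain ⟨x, rfl⟩ := h.surjective g
  refine (F.finite_boundary.insert x).subset fun y hy => ?_
  by_cases hb : y ∈ F.boundary
  · exact Or.inr hb
  · exact Or.inl (h.eq_of_apply_eq hy hb)

end IsGluing

namespace IsInducedBy

variable {G : Type u} [TopologicalSpace G] {f : C(G, G)} {F : PMMap} {p : C(F.Sp, G)}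

theorem apply_hat_iterate (h : IsInducedBy f F p) (n : ℕ) :
    ∀ {x : F.Sp}, x ∉ F.iterCritical n → p (F.hat^[n + 1] x) = f^[n + 1] (p x) := by
  induction n with
  | zero => exact fun {x} hx => h.apply_hat hx
  | succ n ih =>
    intro x hx
    have hx' : x ∉ F.C := F.not_mem_of_not_mem_iterCritical hx
    rw [F.mem_iterCritical_succ] at hx
    rw [Function.iterate_succ_apply, ih hx, h.apply_hat hx', ← Function.iterate_succ_apply]

theorem iter (h : IsInducedBy f F p) (n : ℕ) : IsInducedBy (iterateMap f (n + 1)) (F.iter n) p where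
  continuous := h.continuous
  vertices_subset := h.vertices_subset
  isEmbedding := h.isEmbedding
  image_eq := h.image_eq
  commutes w := h.apply_hat_iterate n fun hw => w.2 (F.mem_iter_C.2 hw)

/-- A critical point of an iterate lies over a point whose orbit meets the finite set `p(C)`. -/
theorem exists_iterate_mem (h : IsInducedBy f F p) (n : ℕ) :
    ∀ {c : F.Sp}, c ∈ F.iterCritical n → ∃ k ≤ n, f^[k] (p c) ∈ p '' F.C := by
  induction n with
  | zero => exact fun {c} hc => ⟨0, le_rfl, c, hc, rfl⟩
  | succ n ih =>
    intro c hc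
    by_cases hcC : c ∈ F.C
    · exact ⟨0, Nat.zero_le _, c, hcC, rfl⟩
    obtain ⟨k, hk, hkc⟩ := ih (F.mem_iterCritical_succ.1 hc)
    rw [h.apply_hat hcC, ← Function.iterate_succ_apply] at hkc
    exact ⟨k + 1, Nat.succ_le_succ hk, hkc⟩

/-- The exceptional points of all iterates are contained in one finite set: they are boundary points
or lie over the orbits of the periodic points in the finite set `p(C)`. -/
theorem exists_uniform_finset (h : IsInducedBy f F p) :
    ∃ S : Finset F.Sp, F.boundary ⊆ S ∧
      ∀ n, ∀ c ∈ F.iterCritical n, f^[n + 1] (p c) = p c → c ∈ S := by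
  let T : Set G := ⋃ y ∈ {y ∈ p '' F.C | y ∈ Function.periodicPts f}, range fun j => f^[j] y
  have hT : T.Finite := by
    refine ((F.C.finite_toSet.image p).subset fun y hy => hy.1).biUnion fun y hy => ?_
    obtain ⟨m, hm, hym⟩ := hy.2
    refine ((Set.finite_lt_nat m).image fun j => f^[j] y).subset ?_
    rintro _ ⟨j, rfl⟩
    exact ⟨j % m, Nat.mod_lt _ hm, hym.iterate_mod_apply j⟩
  have hfin := F.finite_boundary.union (h.isGluing.finite_preimage hT)
  refine ⟨hfin.toFinset, fun x hx => hfin.mem_toFinset.2 (Or.inl hx), fun n c hc hfix => ?_⟩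
  refine hfin.mem_toFinset.2 (Or.inr ?_)
  obtain ⟨k, hk, hkc⟩ := h.exists_iterate_mem n hc
  refine mem_biUnion (x := f^[k] (p c)) ⟨hkc, n + 1, Nat.succ_pos n, ?_⟩ ⟨n + 1 - k, ?_⟩
  · exact Function.IsPeriodicPt.apply_iterate hfix k
  · change f^[n + 1 - k] (f^[k] (p c)) = p c
    rw [← Function.iterate_add_apply, Nat.sub_add_cancel (by omega), hfix]

variable [T2Space G]

/-- Twice the number of fixed points of negative type differs from the Lefschetz number plus the
trace of the pair `(εF_{#0}, εF_{#1})` by an integer, which is bounded by the number of boundary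
points and of fixed points in `C`. -/
theorem exists_defect (h : IsInducedBy f F p) {S : Finset F.Sp} (hb : F.boundary ⊆ S)
    (hS : ∀ c ∈ F.C, f (p c) = p c → c ∈ S) :
    ∃ N : ℤ, 2 * ((negFix f).ncard : ℝ) = (LinearMap.trace ℝ _ (homologyMap f 0) -
      LinearMap.trace ℝ _ (homologyMap f 1)) +
      pairTrace (V₀ := (⊤ : Submodule ℝ (F.Sp →₀ ℝ))) (V₁ := chainsOne F.Sp)
        (Submodule.topEquiv.symm.conj F.signedZero) F.signedOne + N ∧ |N| ≤ 4 * S.card := by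
  obtain ⟨A, hA, hAS⟩ := h.exists_sum_lapTerm_sub hb hS
  obtain ⟨B, hB, hBS⟩ := h.exists_trace_vertexEnd hb
  obtain ⟨h1, h2⟩ := h.card_negLaps hS
  refine ⟨2 * ((negFix f).ncard - F.negLaps.card) - B - A, ?_, ?_⟩
  · rw [h.lefschetz_eq, F.pairTrace_eq_add, hB]
    push_cast
    linarith
  · rw [abs_le] at hAS ⊢
    constructor <;> omega

/-- The comparison for all iterates, with a uniform bound. -/
theorem exists_bounded_defect (h : IsInducedBy f F p) :
    ∃ (N : ℕ → ℤ) (k : ℕ), ∀ n, |N (n + 1)| ≤ k ∧ 2 * ((negFix f^[n + 1]).ncard : ℝ) =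
      (LinearMap.trace ℝ _ (homologyMap f 0 ^ (n + 1)) -
        LinearMap.trace ℝ _ (homologyMap f 1 ^ (n + 1))) +
      pairTrace (V₀ := (⊤ : Submodule ℝ (F.Sp →₀ ℝ))) (V₁ := chainsOne F.Sp)
        (Submodule.topEquiv.symm.conj F.signedZero ^ (n + 1)) (F.signedOne ^ (n + 1)) +
          N (n + 1) := by
  obtain ⟨S, hb, hS⟩ := h.exists_uniform_finset
  have key := fun n => (h.iter n).exists_defect hb fun c hc => hS n c (F.mem_iter_C.1 hc)
  choose N hN hNS using key
  refine ⟨fun n => N (n - 1), 4 * S.card, fun n => ⟨by exact_mod_cast hNS n, ?_⟩⟩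
  rw [← homologyMap_iterateMap, ← homologyMap_iterateMap, PMMap.topEquiv_conj_pow, ← F.signedZero_iter,
    ← F.signedOne_iter]
  exact hN n

end IsInducedBy

end KneadingGraph

end

theorem theoremt10 {G : Type*} [TopologicalSpace G] (hG : KneadingGraph.IsTopGraph G)
    (f : C(G, G)) (hf : KneadingGraph.IsPMG f) (F : KneadingGraph.PMMap) (p : F.Sp → G)
    (hF : KneadingGraph.IsInducedBy f F p) :
    (∃ H : PowerSeries ℚ,
      (∀ z : ℂ, ‖z‖ < 1 →
        ∃ w : ℂ, w ≠ 0 ∧ HasSum (fun n : ℕ => ((PowerSeries.coeff n H : ℚ) : ℂ) * z ^ n) w) ∧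
      KneadingGraph.zetaMT f = PowerSeries.map (algebraMap ℚ ℝ) H * F.kneadingDet⁻¹) ∧
    ∃ D : PowerSeries ℤ, PowerSeries.constantCoeff D = 1 ∧
      PowerSeries.map (algebraMap ℤ ℝ) D = F.kneadingDet := by
  have := hG.hausdorff
  refine ⟨?_, F.exists_int_kneadingDet⟩
  have h : KneadingGraph.IsInducedBy f F (⟨p, hF.continuous⟩ : C(F.Sp, G)) := hF
  obtain ⟨N, k, hN⟩ := h.exists_bounded_defect
  refine ⟨KneadingGraph.zetaSeries fun n => (N n : ℚ),
    fun z hz => KneadingGraph.exists_hasSum_zetaSeries (fun n => (hN n).1) hz, ?_⟩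
  change KneadingGraph.zetaSeries _ * (KneadingGraph.zetaSeries _)⁻¹ =
    _ * (KneadingGraph.zetaSeries _)⁻¹
  rw [KneadingGraph.map_zetaSeries, ← KneadingGraph.zetaSeries_neg, ← KneadingGraph.zetaSeries_neg,
    ← KneadingGraph.zetaSeries_add, ← KneadingGraph.zetaSeries_add]
  refine KneadingGraph.zetaSeries_congr fun n => ?_
  rw [(hN n).2, neg_neg]
  simp only [eq_ratCast, Rat.cast_intCast]
  ring
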